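/- We work in ZFC; cardinals are identified with von Neumann ordinals, $H(\theta)$ is the set of all sets whose transitive closure has size less than $\theta$, and $\prec$ means elementary substructure in the language $\{\in\}$. For cardinals, $\kappa^{<\kappa}=\sup_{\mu<\kappa}\kappa^{\mu}$. A *weak $\kappa$-model* is a (not necessarily transitive) set $M$ of size $\kappa$ with $\kappa+1\subseteq M$ and $\langle M,\in\rangle\models\mathsf{ZFC}^-$ (ZFC without powerset, with the collection scheme and the well-ordering principle). $M$ is *closed under ${<}\alpha$-sequences* if every function $f\colon\beta\to M$ with $\beta<\alpha$ is an element of $M$. A *$\kappa$-model* is a weak $\kappa$-model closed under ${<}\kappa$-sequences. Let $\alpha\le\kappa$ be regular cardinals. $\kappa$ is *$\alpha$-Ramsey* if for arbitrarily large regular cardinals $\theta$, every $A\subseteq\kappa$ is an element of some weak $\kappa$-model $M\prec H(\theta)$ that is closed under ${<}\alpha$-sequences and for which there are a transitive set $N$ and an elementary embedding $j\colon M\to N$ with critical point $\kappa$ such that $\mathcal P(\kappa)\cap M=\mathcal P(\kappa)\cap N$. A *filter on $\kappa$* is a set $F\subseteq\mathcal P(\kappa)$ such that all intersections of finitely many elements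 of $F$ have size $\kappa$. It *measures* $X\subseteq\mathcal P(\kappa)$ if for each $A\in X$ we have $A\in F$ or $\kappa\setminus A\in F$. It is *$M$-normal* if it measures $\mathcal P(\kappa)\cap M$ and $\{\beta<\kappa\mid\forall\xi<\beta\ \beta\in X_\xi\}\in F$ whenever $\langle X_\xi\mid\xi<\kappa\rangle\in M$ is a sequence of elements of $F$. Let $\kappa=\kappa^{<\kappa}<\theta$ be regular uncountable cardinals and let $\gamma\le\kappa^+$ be an ordinal. In the game $G_\gamma^\theta(\kappa)$, at each stage $\beta<\gamma$ the challenger first plays a $\kappa$-model $M_\beta\prec H(\theta)$ with $M_\xi\subseteq M_\beta$ for all $\xi<\beta$ and $\langle M_\xi\mid\xi<\beta\rangle,\ \langle F_\xi\cap M_\xi\mid\xi<\beta\rangle\in M_\beta$, and then the judge plays a filter $F_\beta$ on $\kappa$ that measures $\mathcal P(\kappa)\cap M_\beta$, with $F_\beta\supseteq\bigcup_{\xi<\beta}F_\xi$. A player who has no move that obeys these rules loses. In a run of full length $\gamma$, the judge wins if $\bigcup_{\beta<\gamma}F_\beta$ is $\bigcup_{\beta<\gamma}M_\beta$-normal; otherwise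 the challenger wins. A winning strategy for the challenger determines his moves from the previous moves, provides a move obeying the rules as long as the judge obeys them, and wins every run played according to it. **Theorem 5.6.** Let $\alpha\le\kappa$ be regular uncountable cardinals, and let $\theta>\kappa$ be any regular cardinal. Then $\kappa$ is $\alpha$-Ramsey if and only if $\kappa=\kappa^{<\kappa}$ and $\kappa$ has the $\alpha$-filter property, i.e. the challenger has no winning strategy in the game $G_\alpha^\theta(\kappa)$ of length $\alpha$. -/

import Mathlib

universe u

noncomputable section

namespace FilterGames

open FirstOrder

/-! ### The language of set theory and `∈`-structures

The universe of sets is `ZFSet.{u}`. A cardinal `κ` is identified with the von Neumann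
ordinal `κ.ord.toZFSet`. -/

/-- The relation symbols of the language of set theory: one binary symbol. -/
inductive SetRel : ℕ → Type
  | mem : SetRel 2

/-- The first-order language `{∈}`. -/
def setLanguage : Language := ⟨fun _ => Empty, SetRel⟩

/-- Every set `M` is regarded as the structure `⟨M, ∈⟩`. -/
instance setStructure (M : ZFSet.{u}) : setLanguage.Structure M where
  funMap := fun f => f.elim
  RelMap := fun {_} r =>
    match r with
    | SetRel.mem => fun v => (v 0 : ZFSet.{u}) ∈ (v 1 : ZFSet.{u})

/-- `M ≺ H`: `M` is a subset of `H` and the inclusion of `⟨M, ∈⟩` in `⟨H, ∈⟩` is elementary. -/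
def IsElemSubmodel (M H : ZFSet.{u}) : Prop :=
  ∃ i : M ↪ₑ[setLanguage] H, ∀ x : M, (i x : ZFSet.{u}) = x

/-- `H(θ)`, the set of all sets whose transitive closure has fewer than `θ` elements, i.e. which
are included in a transitive set with fewer than `θ` elements. (All such sets have rank below
`θ` when `θ` is infinite.) -/
def hereditary (θ : Cardinal.{u}) : ZFSet.{u} :=
  ZFSet.sep (fun x => ∃ t : ZFSet.{u}, t.IsTransitive ∧ x ⊆ t ∧ t.card < θ)
    (ZFSet.vonNeumann θ.ord)

/-- The membership relation of the structure `⟨M, ∈⟩`. -/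
def E {M : ZFSet.{u}} (x y : M) : Prop := (x : ZFSet.{u}) ∈ (y : ZFSet.{u})

/-- `⟨M, ∈⟩` satisfies `p = {x, y}`. -/
def IsPairIn {M : ZFSet.{u}} (p x y : M) : Prop := ∀ z : M, E z p ↔ z = x ∨ z = y

/-- `⟨M, ∈⟩` satisfies that the ordered pair `(x, y) = {{x}, {x, y}}` is an element of `r`. -/
def RelIn {M : ZFSet.{u}} (r x y : M) : Prop :=
  ∃ s d p : M, IsPairIn s x x ∧ IsPairIn d x y ∧ IsPairIn p s d ∧ E p r

/-- `⟨M, ∈⟩ ⊨ ZFC⁻`: the axioms of `ZFC` without powerset, with the schemes of separation and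
collection (for formulas with parameters from `M`), and with choice in the form of the
well-ordering principle. -/
structure ModelsZFCMinus (M : ZFSet.{u}) : Prop where
  extensionality : ∀ x y : M, (∀ z : M, E z x ↔ E z y) → x = y
  foundation : ∀ x : M, (∃ z, E z x) → ∃ y, E y x ∧ ¬ ∃ z, E z x ∧ E z y
  pairing : ∀ x y : M, ∃ p, IsPairIn p x y
  union : ∀ x : M, ∃ w : M, ∀ z, E z w ↔ ∃ y, E y x ∧ E z y
  infinity : ∃ w : M, (∃ e, E e w ∧ ∀ z, ¬ E z e) ∧
    ∀ x, E x w → ∃ s, E s w ∧ ∀ z, E z s ↔ (E z x ∨ z = x)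
  separation : ∀ S : Set M, (Set.univ : Set M).Definable₁ setLanguage S →
    ∀ a : M, ∃ b : M, ∀ z, E z b ↔ (E z a ∧ z ∈ S)
  collection : ∀ R : Set (M × M),
    (Set.univ : Set M).Definable₂ setLanguage R →
    ∀ a : M, (∀ x, E x a → ∃ y, (x, y) ∈ R) → ∃ b : M, ∀ x, E x a → ∃ y, E y b ∧ (x, y) ∈ R
  wellOrdering : ∀ a : M, ∃ r : M,
    (∀ x, E x a → ¬ RelIn r x x) ∧
    (∀ x y z, E x a → E y a → E z a → RelIn r x y → RelIn r y z → RelIn r x z) ∧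
    (∀ x y, E x a → E y a → x = y ∨ RelIn r x y ∨ RelIn r y x) ∧
    (∀ b : M, (∀ z, E z b → E z a) → (∃ z, E z b) →
      ∃ m, E m b ∧ ∀ z, E z b → z = m ∨ RelIn r m z)

/-! ### Weak `κ`-models -/

/-- A weak `κ`-model: a (not necessarily transitive) set `M` of size `κ` with `κ + 1 ⊆ M` and
`⟨M, ∈⟩ ⊨ ZFC⁻`. -/
structure IsWeakModel (κ : Cardinal.{u}) (M : ZFSet.{u}) : Prop where
  card_eq : M.card = κ
  succ_subset : (Order.succ κ.ord).toZFSet ⊆ M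
  models : ModelsZFCMinus M

/-- `M` is closed under `<α`-sequences: `M^{<α} ⊆ M`. -/
def ClosedUnderSeq (α : Cardinal.{u}) (M : ZFSet.{u}) : Prop :=
  ∀ β < α.ord, ∀ f ∈ ZFSet.funs β.toZFSet M, f ∈ M

/-- A `κ`-model: a weak `κ`-model `M` with `M^{<κ} ⊆ M`. -/
def IsModel (κ : Cardinal.{u}) (M : ZFSet.{u}) : Prop :=
  IsWeakModel κ M ∧ ClosedUnderSeq κ M

/-! ### `α`-Ramsey cardinals -/

/-- `j : M → N` is `κ`-powerset preserving: it has critical point `κ` (`κ` is the least ordinal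
that it moves), and `M` and `N` have the same subsets of `κ`. -/
structure IsPowersetPreserving (κ : Cardinal.{u}) {M N : ZFSet.{u}}
    (j : M ↪ₑ[setLanguage] N) : Prop where
  fixes_below : ∀ x : M, (x : ZFSet.{u}) ∈ κ.ord.toZFSet → (j x : ZFSet.{u}) = x
  moves : ∃ x : M, (x : ZFSet.{u}) = κ.ord.toZFSet ∧ (j x : ZFSet.{u}) ≠ x
  same_subsets : ∀ A : ZFSet.{u}, A ⊆ κ.ord.toZFSet → (A ∈ M ↔ A ∈ N)

/-- `κ` is `α`-Ramsey: for arbitrarily large regular `θ`, every `A ⊆ κ` is an element of some weak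
`κ`-model `M ≺ H(θ)` which is closed under `<α`-sequences and for which there is a `κ`-powerset
preserving elementary embedding `j : M → N` into a transitive set `N`. -/
def IsRamsey (α κ : Cardinal.{u}) : Prop :=
  ∀ μ : Cardinal.{u}, ∃ θ : Cardinal.{u}, μ ≤ θ ∧ θ.IsRegular ∧
    ∀ A : ZFSet.{u}, A ⊆ κ.ord.toZFSet →
      ∃ M : ZFSet.{u}, A ∈ M ∧ IsWeakModel κ M ∧ IsElemSubmodel M (hereditary θ) ∧
        ClosedUnderSeq α M ∧
        ∃ (N : ZFSet.{u}) (j : M ↪ₑ[setLanguage] N), N.IsTransitive ∧ IsPowersetPreserving κ j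

/-! ### Filters -/

/-- `F` is a filter on `κ`: a set of subsets of `κ` all of whose finite intersections have
size `κ` (the empty intersection being `κ`). -/
def IsFilterOn (κ : Cardinal.{u}) (F : ZFSet.{u}) : Prop :=
  F ⊆ κ.ord.toZFSet.powerset ∧
  ∀ s : Set ZFSet.{u}, s.Finite → (∀ A ∈ s, A ∈ F) →
    (ZFSet.sep (fun x => ∀ A ∈ s, x ∈ A) κ.ord.toZFSet).card = κ

/-- `F` measures the set `X` of subsets of `κ`. -/
def Measures (κ : Cardinal.{u}) (F X : ZFSet.{u}) : Prop :=
  ∀ A ∈ X, A ∈ F ∨ κ.ord.toZFSet \ A ∈ F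

/-- The diagonal intersection `{β < κ | ∀ ξ < β, β ∈ X(ξ)}` of a sequence `X` of length `κ`. -/
def diagInter (κ : Cardinal.{u}) (X : ZFSet.{u}) : ZFSet.{u} :=
  ZFSet.sep (fun β => ∀ ξ ∈ β, ∀ A, ZFSet.pair ξ A ∈ X → β ∈ A) κ.ord.toZFSet

/-- `F` is an `M`-normal filter on `κ`: it measures `𝒫(κ) ∩ M`, and it contains the diagonal
intersection of every `κ`-sequence of elements of `F` that is an element of `M`. -/
def IsNormalFor (κ : Cardinal.{u}) (M F : ZFSet.{u}) : Prop :=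
  IsFilterOn κ F ∧ Measures κ F (κ.ord.toZFSet.powerset ∩ M) ∧
  ∀ X ∈ M, X ∈ ZFSet.funs κ.ord.toZFSet F → diagInter κ X ∈ F

/-! ### The filter games

A run is given by the sequences `M` and `F` of the models played by the challenger and of the
filters played by the judge; in a game of length `γ` only their values below `γ` matter. -/

/-- The sequence `⟨f ξ | ξ < β⟩`, as a set of ordered pairs. -/
def seqSet (β : Ordinal.{u}) (f : Ordinal.{u} → ZFSet.{u}) : ZFSet.{u} :=
  ZFSet.range fun ξ : Set.Iio β => ZFSet.pair (ξ : Ordinal.{u}).toZFSet (f ξ)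

/-- The union `⋃_{ξ < β} f ξ`. -/
def seqUnion (β : Ordinal.{u}) (f : Ordinal.{u} → ZFSet.{u}) : ZFSet.{u} :=
  ZFSet.iUnion fun ξ : Set.Iio β => f ξ

/-- The challenger's move `M β` at stage `β` obeys the rules of the game for `κ` and `θ`. -/
structure ChallengerLegal (κ θ : Cardinal.{u}) (M F : Ordinal.{u} → ZFSet.{u})
    (β : Ordinal.{u}) : Prop where
  isModel : IsModel κ (M β)
  elem : IsElemSubmodel (M β) (hereditary θ)
  mono : ∀ ξ < β, M ξ ⊆ M β
  models_mem : seqSet β M ∈ M β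
  filters_mem : seqSet β (fun ξ => F ξ ∩ M ξ) ∈ M β

/-- The judge's move `F β` at stage `β` obeys the rules of the game for `κ`. -/
structure JudgeLegal (κ : Cardinal.{u}) (M F : Ordinal.{u} → ZFSet.{u})
    (β : Ordinal.{u}) : Prop where
  isFilter : IsFilterOn κ (F β)
  measures : Measures κ (F β) (κ.ord.toZFSet.powerset ∩ M β)
  mono : ∀ ξ < β, F ξ ⊆ F β

/-- A strategy for the challenger maps the sequence of all models and the sequence of all filters
that have been played so far to the next model. -/
abbrev Strategy : Type (u + 1) := ZFSet.{u} → ZFSet.{u} → ZFSet.{u}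

/-- At stage `β` of the run the challenger moves according to `σ`. -/
def FollowsAt (σ : Strategy.{u}) (M F : Ordinal.{u} → ZFSet.{u}) (β : Ordinal.{u}) : Prop :=
  M β = σ (seqSet β M) (seqSet β F)

/-- `σ` is a winning strategy for the challenger in the game `G_γ^θ(κ)`: as long as the judge
obeys the rules, `σ` provides moves that obey the rules, and the judge does not win any run of
full length `γ` in which the challenger follows `σ` and the judge obeys the rules. (Thus the judge
loses a run when she has no move that obeys the rules.) -/
def IsWinning (κ θ : Cardinal.{u}) (γ : Ordinal.{u}) (σ : Strategy.{u}) : Prop :=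
  ∀ M F : Ordinal.{u} → ZFSet.{u},
    (∀ β < γ, (∀ ξ ≤ β, FollowsAt σ M F ξ) → (∀ ξ < β, JudgeLegal κ M F ξ) →
      ChallengerLegal κ θ M F β) ∧
    ((∀ ξ < γ, FollowsAt σ M F ξ) → (∀ ξ < γ, JudgeLegal κ M F ξ) →
      ¬ IsNormalFor κ (seqUnion γ M) (seqUnion γ F))

/-- `κ` has the `γ`-filter property, as computed with the game `G_γ^θ(κ)`: the challenger has no
winning strategy in this game. -/
def FilterProperty (κ θ : Cardinal.{u}) (γ : Ordinal.{u}) : Prop :=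
  ¬ ∃ σ : Strategy.{u}, IsWinning κ θ γ σ

end FilterGames

end

noncomputable section

namespace FilterGames

open FirstOrder

/-! From the filter property to Ramsey: fix `A ⊆ κ` and a large regular `θ'`. Let the challenger
play the traces on `H(θ)` of Skolem hulls in `H(θ')` which contain `A` and the history of the run
and are closed under sequences of length less than `κ`; `κ^{<κ} = κ` keeps them of size `κ`. These
moves are legal and the strategy is not winning, so the judge wins some run against it. The union
`M` of the hulls is elementary in `H(θ')`, and it is closed under `<α`-sequences because `α` is
regular. The union `F` of the filters is `M`-normal, since subsets of `κ` and `κ`-sequences of them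
lie in `H(θ)`, and it is amenable to `M`, since every `F ξ ∩ M ξ` enters the next hull. As `α` is
uncountable, `M` is closed under `ω`-sequences, so the ultrapower of `M` by `F` is well-founded.
Normality makes `κ` the critical point and keeps the subsets of `κ` that are in `M`; amenability
shows that no new ones appear (`IsMeasureFor.exists_embedding`).

From Ramsey to the filter property: a powerset preserving `j : M → N` makes `κ` a strong limit,
whence `κ^{<κ} = κ`. Against a winning strategy the judge would play the sets `{X ∈ m | κ ∈ j(X)}`.
They belong to `M`, because `m` is enumerated in `M` by `κ` and the subsets of `κ` in `N` are in `M`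
(`IsRamseyEmbedding.exists_filter`). The strategy itself need not be in `M`. Therefore winning is
replaced by a first-order property `IsWinIn` with only `κ` and `α` as parameters, where the judge
must play a normal ultrafilter on each single model. A winning strategy, coded as a set, has this
property (`IsWinning.isWinIn`), so by elementarity some `T ∈ M` has it. The judge then survives `α`
stages against `T`, since by closure the histories of length less than `α` remain in `M`; this
contradicts `IsWinIn` (`IsRamseyEmbedding.not_isWinIn`). -/

/-- The membership symbol of the language of set theory. -/
def memSymbol : setLanguage.Relations 2 := SetRel.mem

/-- A predicate on tuples from `∈`-structures is first-order if one formula of the language of set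
theory defines it in all of these structures. -/
def FO {ι : Type*} (P : ∀ K : ZFSet.{u}, (ι → K) → Prop) : Prop :=
  ∃ φ : setLanguage.Formula ι, ∀ K v, φ.Realize v ↔ P K v

/-! ### Predicates that one formula defines in all structures -/

namespace FO

variable {ι ι' : Type*} {P Q : ∀ K : ZFSet.{u}, (ι → K) → Prop}

theorem formula (φ : setLanguage.Formula ι) : FO.{u} fun _ v => φ.Realize v :=
  ⟨φ, fun _ _ => Iff.rfl⟩

theorem mem (i j : ι) : FO.{u} fun _ v => E (v i) (v j) :=
  ⟨memSymbol.formula₂ (.var i) (.var j), fun K v => by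
    rw [Language.Formula.realize_rel₂]
    exact Iff.rfl⟩

theorem eq (i j : ι) : FO.{u} fun _ v => v i = v j :=
  ⟨Language.Term.equal (.var i) (.var j), fun K v => by
    rw [Language.Formula.realize_equal]
    exact Iff.rfl⟩

theorem not (h : FO P) : FO fun K v => ¬ P K v := by
  obtain ⟨φ, h⟩ := h
  exact ⟨φ.not, fun K v => by rw [Language.Formula.realize_not, h]⟩

theorem imp (h : FO P) (h' : FO Q) : FO fun K v => P K v → Q K v := by
  obtain ⟨φ, h⟩ := h
  obtain ⟨ψ, h'⟩ := h'
  exact ⟨φ.imp ψ, fun K v => by rw [Language.Formula.realize_imp, h, h']⟩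

theorem and (h : FO P) (h' : FO Q) : FO fun K v => P K v ∧ Q K v := by
  obtain ⟨φ, h⟩ := h
  obtain ⟨ψ, h'⟩ := h'
  exact ⟨φ ⊓ ψ, fun K v => by rw [Language.Formula.realize_inf, h, h']⟩

theorem or (h : FO P) (h' : FO Q) : FO fun K v => P K v ∨ Q K v := by
  obtain ⟨φ, h⟩ := h
  obtain ⟨ψ, h'⟩ := h'
  exact ⟨φ ⊔ ψ, fun K v => by rw [Language.Formula.realize_sup, h, h']⟩

theorem iff (h : FO P) (h' : FO Q) : FO fun K v => P K v ↔ Q K v := by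
  obtain ⟨φ, h⟩ := h
  obtain ⟨ψ, h'⟩ := h'
  exact ⟨φ.iff ψ, fun K v => by rw [Language.Formula.realize_iff, h, h']⟩

theorem relabel (g : ι → ι') (h : FO P) : FO fun K v => P K fun i => v (g i) := by
  obtain ⟨φ, h⟩ := h
  exact ⟨φ.relabel g, fun K v => by rw [Language.Formula.realize_relabel, h]; rfl⟩

/-- The variable `none` of `Option ι` is the one that gets bound. -/
theorem ex {P : ∀ K : ZFSet.{u}, (ι → K) → K → Prop}
    (h : FO fun K (v : Option ι → K) => P K (fun i => v (some i)) (v none)) :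
    FO fun K v => ∃ x, P K v x := by
  obtain ⟨φ, h⟩ := h
  refine ⟨(φ.relabel fun o : Option ι => o.elim (Sum.inr ()) Sum.inl).iExs Unit, fun K v => ?_⟩
  rw [Language.Formula.realize_iExs]
  simp only [Language.Formula.realize_relabel, h]
  exact ⟨fun ⟨i, hi⟩ => ⟨i (), hi⟩, fun ⟨x, hx⟩ => ⟨fun _ => x, hx⟩⟩

theorem all {P : ∀ K : ZFSet.{u}, (ι → K) → K → Prop}
    (h : FO fun K (v : Option ι → K) => P K (fun i => v (some i)) (v none)) :
    FO fun K v => ∀ x, P K v x := by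
  obtain ⟨φ, h⟩ := h
  refine ⟨(φ.relabel fun o : Option ι => o.elim (Sum.inr ()) Sum.inl).iAlls Unit, fun K v => ?_⟩
  rw [Language.Formula.realize_iAlls]
  simp only [Language.Formula.realize_relabel, h]
  exact ⟨fun H x => H fun _ => x, fun H i => H (i ())⟩

theorem allTuple [Finite ι'] {P : ∀ K : ZFSet.{u}, (ι → K) → (ι' → K) → Prop}
    (h : FO fun K (v : ι ⊕ ι' → K) => P K (fun i => v (.inl i)) (fun i => v (.inr i))) :
    FO fun K v => ∀ x, P K v x := by
  obtain ⟨φ, h⟩ := h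
  refine ⟨φ.iAlls ι', fun K v => ?_⟩
  rw [Language.Formula.realize_iAlls]
  simp only [h]
  rfl

theorem forallFinite [Finite ι'] {P : ι' → ∀ K : ZFSet.{u}, (ι → K) → Prop}
    (h : ∀ i, FO (P i)) : FO fun K v => ∀ i, P i K v := by
  choose φ h using h
  refine ⟨Language.Formula.iInf φ, fun K v => ?_⟩
  rw [Language.Formula.realize_iInf]
  simp only [h]

theorem isPair (i j k : ι) : FO.{u} fun _ v => IsPairIn (v i) (v j) (v k) := by
  unfold IsPairIn
  exact .all (.iff (.mem _ _) (.or (.eq _ _) (.eq _ _)))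

theorem rel (i j k : ι) : FO.{u} fun _ v => RelIn (v i) (v j) (v k) := by
  unfold RelIn
  exact .ex (.ex (.ex (.and (.isPair _ _ _) (.and (.isPair _ _ _) (.and (.isPair _ _ _)
    (.mem _ _))))))

/-- The purpose of `FO`: a predicate assembled by the combinators above is preserved in both
directions by every elementary embedding. -/
theorem transfer (h : FO P) {M N : ZFSet.{u}} (j : M ↪ₑ[setLanguage] N) (v : ι → M) :
    P M v ↔ P N fun i => j (v i) := by
  obtain ⟨φ, h⟩ := h
  rw [← h, ← h]
  exact (j.map_formula φ v).symm

end FO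

theorem FO.existsUnique {ι : Type*} {P : ∀ K : ZFSet.{u}, (ι → K) → K → Prop}
    (h : FO fun K (v : Option ι → K) => P K (fun i => v (some i)) (v none)) :
    FO fun K v => ∃! x, P K v x := by
  unfold ExistsUnique
  refine .ex (.and h (.all (.imp ?_ (.eq _ _))))
  exact h.relabel (fun o : Option ι => o.elim none (fun i => some (some i)))

/-! ### Elementary submodels -/

theorem IsElemSubmodel.subset {M H : ZFSet.{u}} (h : IsElemSubmodel M H) : M ⊆ H := by
  obtain ⟨i, hi⟩ := h
  intro x hx
  have := (i ⟨x, hx⟩).2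
  rwa [hi] at this

/-- The elementary inclusion. -/
def IsElemSubmodel.incl {M H : ZFSet.{u}} (h : IsElemSubmodel M H) : M ↪ₑ[setLanguage] H :=
  h.choose

@[simp] theorem IsElemSubmodel.coe_incl {M H : ZFSet.{u}} (h : IsElemSubmodel M H) (x : M) :
    (h.incl x : ZFSet.{u}) = x :=
  h.choose_spec x

theorem IsElemSubmodel.exists_mem {M H : ZFSet.{u}} (hM : IsElemSubmodel M H) {ι : Type*}
    {P : ∀ K : ZFSet.{u}, (ι → K) → K → Prop}
    (hP : FO fun K (v : Option ι → K) => P K (fun i => v (some i)) (v none))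
    {v : ι → H} (hv : ∀ i, (v i : ZFSet.{u}) ∈ M) (hx : ∃ x, P H v x) :
    ∃ x : H, (x : ZFSet.{u}) ∈ M ∧ P H v x := by
  have hv' : (fun i => hM.incl ⟨v i, hv i⟩) = v := by
    funext i
    exact Subtype.ext (hM.coe_incl _)
  rw [← hv', ← hP.ex.transfer hM.incl fun i => ⟨v i, hv i⟩] at hx
  obtain ⟨x, hx⟩ := hx
  have := (hP.transfer hM.incl (fun o : Option ι => o.elim x fun i => ⟨v i, hv i⟩)).1 hx
  refine ⟨hM.incl x, by simp, ?_⟩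
  convert this using 1
  · exact hv'.symm
  · rfl

theorem IsElemSubmodel.mem_of_unique {M H : ZFSet.{u}} (hM : IsElemSubmodel M H) {ι : Type*}
    {P : ∀ K : ZFSet.{u}, (ι → K) → K → Prop}
    (hP : FO fun K (v : Option ι → K) => P K (fun i => v (some i)) (v none))
    {v : ι → H} (hv : ∀ i, (v i : ZFSet.{u}) ∈ M) {x : H} (hx : P H v x)
    (hu : ∀ y, P H v y → y = x) : (x : ZFSet.{u}) ∈ M := by
  obtain ⟨y, hy, h⟩ := hM.exists_mem hP hv ⟨x, hx⟩
  rwa [← hu y h]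

/-- An element of a transitive `H` that is definable in `H` as a class, with parameters from
`M ≺ H`, belongs to `M`. -/
theorem IsElemSubmodel.mem_of_definable {M H : ZFSet.{u}} (hM : IsElemSubmodel M H)
    (hH : H.IsTransitive) {ι : Type*} {P : ∀ K : ZFSet.{u}, (ι → K) → K → Prop}
    (hP : FO fun K (v : Option ι → K) => P K (fun i => v (some i)) (v none))
    {v : ι → H} (hv : ∀ i, (v i : ZFSet.{u}) ∈ M) {x : ZFSet.{u}} (hxH : x ∈ H)
    (hx : ∀ z : H, (z : ZFSet.{u}) ∈ x ↔ P H v z) : x ∈ M := by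
  -- By extensionality in the transitive set `H`, `x` is the only element of `H` whose elements are
  -- those given by `P`.
  refine hM.mem_of_unique (P := fun K v x => ∀ z, E z x ↔ P K v z) (x := ⟨x, hxH⟩)
    (.all (.iff (.mem _ _) ?_)) hv hx fun y hy => ?_
  · exact hP.relabel fun o : Option ι => o.elim none fun i => some (some i)
  · refine Subtype.ext (ZFSet.ext fun z => ⟨fun h => ?_, fun h => ?_⟩)
    · exact (hx ⟨z, hH _ y.2 h⟩).2 ((hy _).1 h)
    · exact (hy ⟨z, hH _ hxH h⟩).2 ((hx _).1 h)

/-! ### Absoluteness -/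

theorem isPairIn_iff {H : ZFSet.{u}} (hH : H.IsTransitive) {p x y : H} :
    IsPairIn p x y ↔ (p : ZFSet.{u}) = {↑x, ↑y} := by
  constructor
  · intro h
    ext z
    rw [ZFSet.mem_pair]
    constructor
    · intro hz
      have := (h ⟨z, hH _ p.2 hz⟩).1 hz
      simpa [Subtype.ext_iff] using this
    · rintro (rfl | rfl)
      · exact (h x).2 (.inl rfl)
      · exact (h y).2 (.inr rfl)
  · intro h z
    rw [E, h, ZFSet.mem_pair, Subtype.ext_iff, Subtype.ext_iff]

theorem relIn_iff {H : ZFSet.{u}} (hH : H.IsTransitive) {r x y : H} :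
    RelIn r x y ↔ ZFSet.pair x y ∈ (r : ZFSet.{u}) := by
  constructor
  · rintro ⟨s, d, p, hs, hd, hp, h⟩
    rw [isPairIn_iff hH] at hs hd hp
    rw [E, hp, hs, hd, ZFSet.pair_eq_singleton] at h
    exact h
  · intro h
    have hp : ZFSet.pair x y ∈ H := hH _ r.2 h
    have hs : ({↑x} : ZFSet.{u}) ∈ H := hH _ hp (by simp [ZFSet.pair])
    have hd : ({↑x, ↑y} : ZFSet.{u}) ∈ H := hH _ hp (by simp [ZFSet.pair])
    refine ⟨⟨_, hs⟩, ⟨_, hd⟩, ⟨_, hp⟩, ?_, ?_, ?_, h⟩ <;> rw [isPairIn_iff hH]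
    · simp
    · rfl

/-! ### Cardinalities of sets -/

theorem card_le_of_forall_exists {ι : Type u} {x : ZFSet.{u}} (f : ι → ZFSet.{u})
    (h : ∀ z ∈ x, ∃ i, f i = z) : x.card ≤ Cardinal.mk ι := by
  have h₁ : x.card ≤ (ZFSet.range f).card :=
    ZFSet.card_mono fun z hz => ZFSet.mem_range.2 (h z hz)
  have h₂ := ZFSet.lift_card_range_le (f := f)
  rw [Cardinal.lift_le] at h₂
  exact h₁.trans h₂

/-- The elements of a set form a type one universe too high; `Shrink` makes them an index type for
cardinalities and unions. -/
theorem exists_shrink {x z : ZFSet.{u}} (hz : z ∈ x) :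
    ∃ i : Shrink.{u} x, ((equivShrink x).symm i : ZFSet.{u}) = z :=
  ⟨equivShrink x ⟨z, hz⟩, by simp⟩

theorem shrink_mem {x : ZFSet.{u}} (i : Shrink.{u} x) :
    ((equivShrink x).symm i : ZFSet.{u}) ∈ x :=
  ((equivShrink x).symm i).2

theorem card_le_of_forall_exists_mem {x y : ZFSet.{u}} (f : ZFSet.{u} → ZFSet.{u})
    (h : ∀ z ∈ y, ∃ w ∈ x, f w = z) : y.card ≤ x.card := by
  refine card_le_of_forall_exists (ι := Shrink.{u} x) (fun i => f ((equivShrink x).symm i)) ?_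
  intro z hz
  obtain ⟨w, hw, rfl⟩ := h z hz
  obtain ⟨i, hi⟩ := exists_shrink hw
  exact ⟨i, congrArg f hi⟩

theorem card_prod_le (x y : ZFSet.{u}) : (x.prod y).card ≤ x.card * y.card := by
  rw [ZFSet.card, ZFSet.card, ZFSet.card, Cardinal.mul_def]
  refine card_le_of_forall_exists (ι := Shrink.{u} x × Shrink.{u} y) (fun i =>
    ZFSet.pair ((equivShrink x).symm i.1) ((equivShrink y).symm i.2)) ?_
  intro z hz
  obtain ⟨a, ha, b, hb, rfl⟩ := ZFSet.mem_prod.1 hz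
  obtain ⟨i, hi⟩ := exists_shrink ha
  obtain ⟨j, hj⟩ := exists_shrink hb
  exact ⟨(i, j), by rw [hi, hj]⟩

theorem card_iUnion_lt {θ : Cardinal.{u}} (hθ : θ.IsRegular) {ι : Type u}
    (hι : Cardinal.mk ι < θ) {f : ι → ZFSet.{u}} (hf : ∀ i, (f i).card < θ) :
    (ZFSet.iUnion f).card < θ := by
  have h := ZFSet.lift_card_iUnion_le_sum_card (f := f)
  rw [Cardinal.lift_id] at h
  exact h.trans_lt (Cardinal.sum_lt_of_isRegular hθ hι hf)

theorem card_iUnion_le {κ : Cardinal.{u}} (hκ : Cardinal.aleph0 ≤ κ) {ι : Type u}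
    (hι : Cardinal.mk ι ≤ κ) {f : ι → ZFSet.{u}} (hf : ∀ i, (f i).card ≤ κ) :
    (ZFSet.iUnion f).card ≤ κ := by
  have h := ZFSet.lift_card_iUnion_le_sum_card (f := f)
  rw [Cardinal.lift_id] at h
  refine h.trans ((Cardinal.sum_le_sum _ _ hf).trans ?_)
  rw [Cardinal.sum_const']
  exact (mul_le_mul_left hι _).trans (Cardinal.mul_eq_self hκ).le

theorem card_ord_toZFSet (κ : Cardinal.{u}) : κ.ord.toZFSet.card = κ := by
  rw [Ordinal.card_toZFSet, Cardinal.card_ord]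

theorem card_toZFSet_lt {κ : Cardinal.{u}} {o : Ordinal.{u}} (h : o < κ.ord) :
    o.toZFSet.card < κ := by
  rw [Ordinal.card_toZFSet]
  exact Cardinal.lt_ord.1 h

/-! ### The set `H(θ)` -/

/-- The ranks of the elements of a transitive set fill all of its rank, so the rank has no more
elements than the set. -/
theorem rank_lt_of_isTransitive {θ : Cardinal.{u}} {t : ZFSet.{u}}
    (ht : t.IsTransitive) (hc : t.card < θ) : t.rank < θ.ord := by
  rw [Cardinal.lt_ord]
  refine lt_of_le_of_lt ?_ hc
  have key : ∀ y : ZFSet.{u}, y ∈ t → ∀ β < y.rank, ∃ z ∈ t, z.rank = β := by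
    intro y
    induction y using ZFSet.inductionOn with
    | _ y ih =>
      intro hy β hβ
      obtain ⟨z, hz, hβz⟩ := ZFSet.lt_rank_iff.1 hβ
      rcases hβz.eq_or_lt with h | h
      · exact ⟨z, ht _ hy hz, h.symm⟩
      · exact ih z hz (ht _ hy hz) β h
  rw [← Ordinal.card_toZFSet]
  refine card_le_of_forall_exists_mem (fun z => z.rank.toZFSet) fun z hz => ?_
  obtain ⟨β, hβ, rfl⟩ := Ordinal.mem_toZFSet_iff.1 hz
  obtain ⟨y, hy, hβy⟩ := ZFSet.lt_rank_iff.1 hβ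
  rcases hβy.eq_or_lt with h | h
  · exact ⟨y, hy, by rw [h]⟩
  · obtain ⟨w, hw, h⟩ := key y hy β h
    exact ⟨w, hw, by rw [h]⟩

/-- The bound on the rank in the definition of `hereditary` is automatic. -/
theorem mem_hereditary {θ : Cardinal.{u}} {x : ZFSet.{u}} :
    x ∈ hereditary θ ↔ ∃ t : ZFSet.{u}, t.IsTransitive ∧ x ⊆ t ∧ t.card < θ := by
  rw [hereditary, ZFSet.mem_sep, ZFSet.mem_vonNeumann]
  refine ⟨fun h => h.2, fun h => ⟨?_, h⟩⟩
  obtain ⟨t, ht, hxt, hc⟩ := h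
  exact (ZFSet.rank_mono hxt).trans_lt (rank_lt_of_isTransitive ht hc)

theorem isTransitive_hereditary (θ : Cardinal.{u}) : (hereditary θ).IsTransitive := by
  intro x hx y hy
  obtain ⟨t, ht, hxt, hc⟩ := mem_hereditary.1 hx
  exact mem_hereditary.2 ⟨t, ht, ht _ (hxt hy), hc⟩

theorem hereditary_mono {θ θ' : Cardinal.{u}} (h : θ ≤ θ') : hereditary θ ⊆ hereditary θ' := by
  intro x hx
  obtain ⟨t, ht, hxt, hc⟩ := mem_hereditary.1 hx
  exact mem_hereditary.2 ⟨t, ht, hxt, hc.trans_le h⟩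

theorem card_lt_of_mem_hereditary {θ : Cardinal.{u}} {x : ZFSet.{u}} (hx : x ∈ hereditary θ) :
    x.card < θ := by
  obtain ⟨t, ht, hxt, hc⟩ := mem_hereditary.1 hx
  exact (ZFSet.card_mono hxt).trans_lt hc

theorem mem_hereditary_of_subset_mem {θ : Cardinal.{u}} {x y : ZFSet.{u}} (hx : x ∈ hereditary θ)
    (h : y ⊆ x) : y ∈ hereditary θ := by
  obtain ⟨t, ht, hxt, hc⟩ := mem_hereditary.1 hx
  exact mem_hereditary.2 ⟨t, ht, fun z hz => hxt (h hz), hc⟩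

/-- Adjoin to `x` a small transitive cover of each of its elements; regularity of `θ` keeps the
union small. -/
theorem mem_hereditary_of_subset {θ : Cardinal.{u}} (hθ : θ.IsRegular) {x : ZFSet.{u}}
    (hx : x ⊆ hereditary θ) (hc : x.card < θ) : x ∈ hereditary θ := by
  have h : ∀ i : Shrink.{u} x, ∃ t : ZFSet.{u}, t.IsTransitive ∧
      ((equivShrink x).symm i : ZFSet.{u}) ⊆ t ∧ t.card < θ :=
    fun i => mem_hereditary.1 (hx (shrink_mem i))
  choose t ht hxt hct using h
  refine mem_hereditary.2 ⟨x ∪ ZFSet.iUnion t, ?_, fun z hz => ZFSet.mem_union.2 (.inl hz), ?_⟩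
  · intro y hy z hz
    rw [ZFSet.mem_union, ZFSet.mem_iUnion] at hy ⊢
    rcases hy with hy | ⟨i, hy⟩
    · obtain ⟨i, rfl⟩ := exists_shrink hy
      exact .inr ⟨i, hxt i hz⟩
    · exact .inr ⟨i, ht i _ hy hz⟩
  · exact ZFSet.card_union_le.trans_lt
      (Cardinal.add_lt_of_lt hθ.aleph0_le hc (card_iUnion_lt hθ hc hct))

theorem toZFSet_mem_hereditary {θ : Cardinal.{u}} {o : Ordinal.{u}} (ho : o < θ.ord) :
    o.toZFSet ∈ hereditary θ :=
  mem_hereditary.2 ⟨_, (ZFSet.isOrdinal_toZFSet o).isTransitive, fun _ h => h, card_toZFSet_lt ho⟩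

theorem insert_mem_hereditary {θ : Cardinal.{u}} (hθ : θ.IsRegular) {x y : ZFSet.{u}}
    (hx : x ∈ hereditary θ) (hy : y ∈ hereditary θ) : insert x y ∈ hereditary θ := by
  refine mem_hereditary_of_subset hθ (fun z hz => ?_) ?_
  · rcases ZFSet.mem_insert_iff.1 hz with rfl | hz
    · exact hx
    · exact isTransitive_hereditary θ _ hy hz
  · exact ZFSet.card_insert_le.trans_lt (Cardinal.add_lt_of_lt hθ.aleph0_le
      (card_lt_of_mem_hereditary hy) (Cardinal.one_lt_aleph0.trans_le hθ.aleph0_le))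

theorem empty_mem_hereditary {θ : Cardinal.{u}} (hθ : θ.IsRegular) : ∅ ∈ hereditary θ :=
  mem_hereditary_of_subset hθ (ZFSet.empty_subset _) (by simpa using hθ.pos)

theorem unordered_mem_hereditary {θ : Cardinal.{u}} (hθ : θ.IsRegular) {x y : ZFSet.{u}}
    (hx : x ∈ hereditary θ) (hy : y ∈ hereditary θ) : ({x, y} : ZFSet.{u}) ∈ hereditary θ := by
  refine insert_mem_hereditary hθ hx ?_
  rw [← insert_empty_eq]
  exact insert_mem_hereditary hθ hy (empty_mem_hereditary hθ)

theorem pair_mem_hereditary {θ : Cardinal.{u}} (hθ : θ.IsRegular) {x y : ZFSet.{u}}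
    (hx : x ∈ hereditary θ) (hy : y ∈ hereditary θ) : ZFSet.pair x y ∈ hereditary θ := by
  have := unordered_mem_hereditary hθ hx hx
  rw [ZFSet.pair_eq_singleton] at this
  exact unordered_mem_hereditary hθ this (unordered_mem_hereditary hθ hx hy)

theorem sUnion_mem_hereditary {θ : Cardinal.{u}} {x : ZFSet.{u}}
    (hx : x ∈ hereditary θ) : (ZFSet.sUnion x) ∈ hereditary θ := by
  obtain ⟨t, ht, hxt, hc⟩ := mem_hereditary.1 hx
  refine mem_hereditary.2 ⟨t, ht, fun z hz => ?_, hc⟩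
  obtain ⟨y, hy, hz⟩ := ZFSet.mem_sUnion.1 hz
  exact ht _ (hxt hy) hz

theorem exists_mem_hereditary (x : ZFSet.{u}) :
    ∃ μ : Cardinal.{u}, ∀ θ, μ ≤ θ → x ∈ hereditary θ := by
  refine ⟨Order.succ (ZFSet.vonNeumann x.rank).card, fun θ hθ => mem_hereditary.2
    ⟨_, ZFSet.isTransitive_vonNeumann _, ZFSet.subset_vonNeumann_self x, ?_⟩⟩
  exact (Order.lt_succ _).trans_le hθ

/-! ### `H(θ)` and its elementary submodels satisfy `ZFC⁻` -/

variable {θ : Cardinal.{u}}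

theorem separation_hereditary (S : Set (hereditary θ)) (a : hereditary θ) :
    ∃ b : hereditary θ, ∀ z, E z b ↔ E z a ∧ z ∈ S := by
  refine ⟨⟨ZFSet.sep (fun z => ∃ h, (⟨z, h⟩ : hereditary θ) ∈ S) a,
    mem_hereditary_of_subset_mem a.2 ZFSet.sep_subset⟩, fun z => ?_⟩
  rw [E, ZFSet.mem_sep]
  exact and_congr_right fun _ => ⟨fun ⟨_, h⟩ => h, fun h => ⟨z.2, h⟩⟩

/-- One chosen value for each element of `a` gives a subset of `H(θ)` of size less than `θ`, which
is an element by regularity. -/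
theorem collection_hereditary (hθ : θ.IsRegular) (R : hereditary θ → hereditary θ → Prop)
    (a : hereditary θ) (ha : ∀ x, E x a → ∃ y, R x y) :
    ∃ b : hereditary θ, ∀ x, E x a → ∃ y, E y b ∧ R x y := by
  have h : ∀ i : Shrink.{u} (a : ZFSet.{u}), ∃ y : hereditary θ,
      R ⟨_, isTransitive_hereditary θ _ a.2 (shrink_mem i)⟩ y :=
    fun i => ha _ (shrink_mem i)
  choose f hf using h
  refine ⟨⟨ZFSet.range fun i => (f i : ZFSet.{u}), mem_hereditary_of_subset hθ ?_ ?_⟩, ?_⟩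
  · intro z hz
    obtain ⟨i, rfl⟩ := ZFSet.mem_range.1 hz
    exact (f i).2
  · refine lt_of_le_of_lt (card_le_of_forall_exists (ι := Shrink.{u} (a : ZFSet.{u}))
      (fun i => (f i : ZFSet.{u})) fun z hz => ZFSet.mem_range.1 hz) ?_
    exact card_lt_of_mem_hereditary a.2
  · intro x hx
    obtain ⟨i, hi⟩ := exists_shrink hx
    refine ⟨f i, ZFSet.mem_range.2 ⟨i, rfl⟩, ?_⟩
    have hxi : x = ⟨_, isTransitive_hereditary θ _ a.2 (shrink_mem i)⟩ := Subtype.ext hi.symm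
    rw [hxi]
    exact hf i

theorem infinity_hereditary (hθ : θ.IsRegular) (hθ₀ : Cardinal.aleph0 < θ) :
    ∃ w : hereditary θ, (∃ e, E e w ∧ ∀ z, ¬ E z e) ∧
      ∀ x, E x w → ∃ s, E s w ∧ ∀ z, E z s ↔ (E z x ∨ z = x) := by
  have hlim : ∀ o, o < Ordinal.omega0 → Order.succ o < Ordinal.omega0 := fun o ho => by
    simpa using Ordinal.isSuccLimit_omega0.succ_lt ho
  have hw : Ordinal.omega0.toZFSet ∈ hereditary θ := by
    refine toZFSet_mem_hereditary ?_
    rw [← Cardinal.ord_aleph0]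
    exact Cardinal.ord_lt_ord.2 hθ₀
  refine ⟨⟨_, hw⟩, ⟨⟨∅, empty_mem_hereditary hθ⟩, ?_, fun z => ZFSet.notMem_empty _⟩, ?_⟩
  · change (∅ : ZFSet.{u}) ∈ Ordinal.omega0.toZFSet
    rw [← Ordinal.toZFSet_zero]
    exact Ordinal.toZFSet_mem_toZFSet_iff.2 Ordinal.omega0_pos
  · intro x hx
    obtain ⟨o, ho, hox⟩ := Ordinal.mem_toZFSet_iff.1 hx
    refine ⟨⟨insert ↑x ↑x, insert_mem_hereditary hθ x.2 x.2⟩, ?_, fun z => ?_⟩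
    · change insert (x : ZFSet.{u}) (x : ZFSet.{u}) ∈ Ordinal.omega0.toZFSet
      rw [← hox, ← Ordinal.toZFSet_add_one, ← Order.succ_eq_add_one]
      exact Ordinal.toZFSet_mem_toZFSet_iff.2 (hlim o ho)
    · rw [E, ZFSet.mem_insert_iff, or_comm, Subtype.ext_iff]
      exact Iff.rfl

theorem wellOrdering_hereditary (hθ : θ.IsRegular) (a : hereditary θ) :
    ∃ r : hereditary θ,
      (∀ x, E x a → ¬ RelIn r x x) ∧
      (∀ x y z, E x a → E y a → E z a → RelIn r x y → RelIn r y z → RelIn r x z) ∧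
      (∀ x y, E x a → E y a → x = y ∨ RelIn r x y ∨ RelIn r y x) ∧
      (∀ b : hereditary θ, (∀ z, E z b → E z a) → (∃ z, E z b) →
        ∃ m, E m b ∧ ∀ z, E z b → z = m ∨ RelIn r m z) := by
  set lt : ZFSet.{u} → ZFSet.{u} → Prop := WellOrderingRel with hlt
  have hr : ZFSet.sep (fun p => ∃ x y, p = ZFSet.pair x y ∧ lt x y)
      (ZFSet.prod a a) ∈ hereditary θ := by
    refine mem_hereditary_of_subset hθ (fun p hp => ?_) ?_
    · obtain ⟨x, hx, y, hy, rfl⟩ := ZFSet.mem_prod.1 (ZFSet.mem_sep.1 hp).1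
      exact pair_mem_hereditary hθ (isTransitive_hereditary θ _ a.2 hx)
        (isTransitive_hereditary θ _ a.2 hy)
    · refine ((ZFSet.card_mono ZFSet.sep_subset).trans (card_prod_le _ _)).trans_lt ?_
      exact Cardinal.mul_lt_of_lt hθ.aleph0_le (card_lt_of_mem_hereditary a.2)
        (card_lt_of_mem_hereditary a.2)
  have key : ∀ x y : hereditary θ, E x a → E y a → (RelIn ⟨_, hr⟩ x y ↔ lt x y) := by
    intro x y hx hy
    rw [relIn_iff (isTransitive_hereditary θ), ZFSet.mem_sep, ZFSet.pair_mem_prod]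
    constructor
    · rintro ⟨-, x', y', h, h'⟩
      obtain ⟨h₁, h₂⟩ := ZFSet.pair_inj.1 h
      rwa [h₁, h₂]
    · exact fun h => ⟨⟨hx, hy⟩, _, _, rfl, h⟩
  refine ⟨⟨_, hr⟩, ?_, ?_, ?_, ?_⟩
  · intro x hx
    rw [key x x hx hx]
    exact irrefl_of lt _
  · intro x y z hx hy hz
    rw [key x y hx hy, key y z hy hz, key x z hx hz]
    exact trans_of lt
  · intro x y hx hy
    rw [key x y hx hy, key y x hy hx, Subtype.ext_iff]
    rcases trichotomous_of lt (x : ZFSet.{u}) y with h | h | h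
    · exact .inr (.inl h)
    · exact .inl h
    · exact .inr (.inr h)
  · intro b hb ⟨z, hz⟩
    obtain ⟨m, hm, hmin⟩ := WellOrderingRel.isWellOrder.wf.has_min
      {z : ZFSet.{u} | z ∈ (b : ZFSet.{u})} ⟨z, hz⟩
    have hmH := isTransitive_hereditary θ _ b.2 hm
    refine ⟨⟨m, hmH⟩, hm, fun z hz => ?_⟩
    rw [key _ z (hb ⟨m, hmH⟩ hm) (hb _ hz), Subtype.ext_iff]
    rcases trichotomous_of lt (z : ZFSet.{u}) m with h | h | h
    · exact absurd h (hmin _ hz)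
    · exact .inl h
    · exact .inr h

/-- Each axiom, and each instance of a scheme with its parameters as free variables, is a single
formula that transfers from `H(θ)`. Only foundation is read off directly from the well-foundedness
of `∈`. -/
theorem IsElemSubmodel.modelsZFCMinus {M : ZFSet.{u}} (hθ : θ.IsRegular)
    (hθ₀ : Cardinal.aleph0 < θ) (hM : IsElemSubmodel M (hereditary θ)) : ModelsZFCMinus M where
  extensionality := by
    have h : FO.{u} fun K (_ : Empty → K) => ∀ x y : K, (∀ z : K, E z x ↔ E z y) → x = y :=
      .all (.all (.imp (.all (.iff (.mem _ _) (.mem _ _))) (.eq _ _)))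
    refine (h.transfer hM.incl Empty.elim).2 fun x y hxy => Subtype.ext (ZFSet.ext fun z => ?_)
    constructor
    · exact fun hz => (hxy ⟨z, isTransitive_hereditary θ _ x.2 hz⟩).1 hz
    · exact fun hz => (hxy ⟨z, isTransitive_hereditary θ _ y.2 hz⟩).2 hz
  foundation := by
    rintro x ⟨z, hz⟩
    obtain ⟨y, hy, h⟩ := ZFSet.mem_wf.has_min
      {y : ZFSet.{u} | y ∈ M ∧ y ∈ (x : ZFSet.{u})} ⟨z, z.2, hz⟩
    exact ⟨⟨y, hy.1⟩, hy.2, fun ⟨w, hw, hwy⟩ => h w ⟨w.2, hw⟩ hwy⟩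
  pairing := by
    have h : FO.{u} fun K (_ : Empty → K) => ∀ x y : K, ∃ p, IsPairIn p x y :=
      .all (.all (.ex (.isPair _ _ _)))
    exact (h.transfer hM.incl Empty.elim).2 fun x y =>
      ⟨⟨_, unordered_mem_hereditary hθ x.2 y.2⟩,
        (isPairIn_iff (isTransitive_hereditary θ)).2 rfl⟩
  union := by
    have h : FO.{u} fun K (_ : Empty → K) =>
        ∀ x : K, ∃ w : K, ∀ z, E z w ↔ ∃ y, E y x ∧ E z y :=
      .all (.ex (.all (.iff (.mem _ _) (.ex (.and (.mem _ _) (.mem _ _))))))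
    refine (h.transfer hM.incl Empty.elim).2 fun x =>
      ⟨⟨_, sUnion_mem_hereditary x.2⟩, fun z => ?_⟩
    rw [E, ZFSet.mem_sUnion]
    exact ⟨fun ⟨y, hy, hz⟩ => ⟨⟨y, isTransitive_hereditary θ _ x.2 hy⟩, hy, hz⟩,
      fun ⟨y, hy, hz⟩ => ⟨y, hy, hz⟩⟩
  infinity := by
    have h : FO.{u} fun K (_ : Empty → K) => ∃ w : K, (∃ e, E e w ∧ ∀ z, ¬ E z e) ∧
        ∀ x, E x w → ∃ s, E s w ∧ ∀ z, E z s ↔ (E z x ∨ z = x) :=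
      .ex (.and (.ex (.and (.mem _ _) (.all (.not (.mem _ _)))))
        (.all (.imp (.mem _ _) (.ex (.and (.mem _ _)
          (.all (.iff (.mem _ _) (.or (.mem _ _) (.eq _ _)))))))))
    exact (h.transfer hM.incl Empty.elim).2 (infinity_hereditary hθ hθ₀)
  separation := by
    intro S hS
    obtain ⟨φ, hφ⟩ := Set.definable_iff_exists_formula_sum.1 hS
    have h : FO.{u} fun K (v : ↥(Set.univ : Set M) → K) => ∀ a : K, ∃ b : K,
        ∀ z, E z b ↔ E z a ∧ φ.Realize (Sum.elim v fun _ => z) := by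
      refine .all (.ex (.all (.iff (.mem _ _) (.and (.mem _ _) ?_))))
      convert (FO.formula φ).relabel (fun i : (Set.univ : Set M) ⊕ Fin 1 =>
        (i.elim (fun i => some (some (some i))) fun _ => none :
          Option (Option (Option (Set.univ : Set M))))) using 4
      ext i
      rcases i with i | i <;> rfl
    intro a
    obtain ⟨b, hb⟩ := (h.transfer hM.incl fun i => (i : M)).2
      (fun a => separation_hereditary {z | φ.Realize (Sum.elim _ fun _ => z)} a) a
    refine ⟨b, fun z => (hb z).trans (and_congr_right fun _ => ?_)⟩
    exact (Set.ext_iff.1 hφ fun _ => z).symm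
  collection := by
    intro R hR
    obtain ⟨φ, hφ⟩ := Set.definable_iff_exists_formula_sum.1 hR
    have hR' : ∀ x y, (x, y) ∈ R ↔ φ.Realize (Sum.elim (↑) ![x, y]) :=
      fun x y => Set.ext_iff.1 hφ ![x, y]
    have h : FO.{u} fun K (v : ↥(Set.univ : Set M) → K) => ∀ a : K,
        (∀ x, E x a → ∃ y, φ.Realize (Sum.elim v ![x, y])) →
          ∃ b : K, ∀ x, E x a → ∃ y, E y b ∧ φ.Realize (Sum.elim v ![x, y]) := by
      refine .all (.imp (.all (.imp (.mem _ _) (.ex ?_)))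
        (.ex (.all (.imp (.mem _ _) (.ex (.and (.mem _ _) ?_))))))
      · convert (FO.formula φ).relabel (fun i : (Set.univ : Set M) ⊕ Fin 2 =>
          (i.elim (fun i => some (some (some i))) ![some none, none] :
            Option (Option (Option (Set.univ : Set M))))) using 4
        ext i
        rcases i with i | i
        · rfl
        · fin_cases i <;> rfl
      · convert (FO.formula φ).relabel (fun i : (Set.univ : Set M) ⊕ Fin 2 =>
          (i.elim (fun i => some (some (some (some i)))) ![some none, none] :
            Option (Option (Option (Option (Set.univ : Set M)))))) using 4
        ext i
        rcases i with i | i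
        · rfl
        · fin_cases i <;> rfl
    simp only [hR']
    exact (h.transfer hM.incl fun i => (i : M)).2
      fun a => collection_hereditary hθ (fun x y => φ.Realize (Sum.elim _ ![x, y])) a
  wellOrdering := by
    have h : FO.{u} fun K (_ : Empty → K) => ∀ a : K, ∃ r : K,
        (∀ x, E x a → ¬ RelIn r x x) ∧
        (∀ x y z, E x a → E y a → E z a → RelIn r x y → RelIn r y z → RelIn r x z) ∧
        (∀ x y, E x a → E y a → x = y ∨ RelIn r x y ∨ RelIn r y x) ∧
        (∀ b : K, (∀ z, E z b → E z a) → (∃ z, E z b) →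
          ∃ m, E m b ∧ ∀ z, E z b → z = m ∨ RelIn r m z) :=
      .all (.ex (.and (.all (.imp (.mem _ _) (.not (.rel _ _ _))))
        (.and (.all (.all (.all (.imp (.mem _ _) (.imp (.mem _ _) (.imp (.mem _ _)
          (.imp (.rel _ _ _) (.imp (.rel _ _ _) (.rel _ _ _)))))))))
        (.and (.all (.all (.imp (.mem _ _) (.imp (.mem _ _)
          (.or (.eq _ _) (.or (.rel _ _ _) (.rel _ _ _)))))))
        (.all (.imp (.all (.imp (.mem _ _) (.mem _ _))) (.imp (.ex (.mem _ _))
          (.ex (.and (.mem _ _) (.all (.imp (.mem _ _)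
            (.or (.eq _ _) (.rel _ _ _)))))))))))))
    exact (h.transfer hM.incl Empty.elim).2 (wellOrdering_hereditary hθ)

/-! ### Sequences as sets of ordered pairs -/

theorem mem_seqSet {β : Ordinal.{u}} {f : Ordinal.{u} → ZFSet.{u}} {p : ZFSet.{u}} :
    p ∈ seqSet β f ↔ ∃ ξ < β, ZFSet.pair ξ.toZFSet (f ξ) = p := by
  rw [seqSet, ZFSet.mem_range]
  exact ⟨fun ⟨ξ, h⟩ => ⟨ξ, ξ.2, h⟩, fun ⟨ξ, hξ, h⟩ => ⟨⟨ξ, hξ⟩, h⟩⟩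

theorem pair_mem_seqSet {β ξ : Ordinal.{u}} {f : Ordinal.{u} → ZFSet.{u}} {y : ZFSet.{u}} :
    ZFSet.pair ξ.toZFSet y ∈ seqSet β f ↔ ξ < β ∧ y = f ξ := by
  rw [mem_seqSet]
  constructor
  · rintro ⟨η, hη, h⟩
    obtain ⟨h₁, h₂⟩ := ZFSet.pair_inj.1 h
    obtain rfl := Ordinal.toZFSet_injective h₁
    exact ⟨hη, h₂.symm⟩
  · rintro ⟨h, rfl⟩
    exact ⟨ξ, h, rfl⟩

theorem mem_seqUnion {β : Ordinal.{u}} {f : Ordinal.{u} → ZFSet.{u}} {x : ZFSet.{u}} :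
    x ∈ seqUnion β f ↔ ∃ ξ < β, x ∈ f ξ := by
  rw [seqUnion, ZFSet.mem_iUnion]
  exact ⟨fun ⟨ξ, h⟩ => ⟨ξ, ξ.2, h⟩, fun ⟨ξ, hξ, h⟩ => ⟨⟨ξ, hξ⟩, h⟩⟩

theorem seqSet_congr {β : Ordinal.{u}} {f g : Ordinal.{u} → ZFSet.{u}}
    (h : ∀ ξ < β, f ξ = g ξ) : seqSet β f = seqSet β g := by
  ext p
  rw [mem_seqSet, mem_seqSet]
  exact exists_congr fun ξ => and_congr_right fun hξ => by rw [h ξ hξ]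

theorem seqSet_mem_funs {β : Ordinal.{u}} {f : Ordinal.{u} → ZFSet.{u}} {M : ZFSet.{u}}
    (h : ∀ ξ < β, f ξ ∈ M) : seqSet β f ∈ ZFSet.funs β.toZFSet M := by
  rw [ZFSet.mem_funs]
  refine ⟨fun p hp => ?_, fun z hz => ?_⟩
  · obtain ⟨ξ, hξ, rfl⟩ := mem_seqSet.1 hp
    exact ZFSet.pair_mem_prod.2 ⟨Ordinal.toZFSet_mem_toZFSet_iff.2 hξ, h ξ hξ⟩
  · obtain ⟨ξ, hξ, rfl⟩ := Ordinal.mem_toZFSet_iff.1 hz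
    exact ⟨f ξ, pair_mem_seqSet.2 ⟨hξ, rfl⟩, fun y hy => (pair_mem_seqSet.1 hy).2⟩

theorem exists_eq_seqSet {β : Ordinal.{u}} {f M : ZFSet.{u}} (hf : f ∈ ZFSet.funs β.toZFSet M) :
    ∃ g : Ordinal.{u} → ZFSet.{u}, (∀ ξ < β, g ξ ∈ M) ∧ f = seqSet β g := by
  obtain ⟨hsub, hfun⟩ := ZFSet.mem_funs.1 hf
  have h : ∀ ξ : Ordinal.{u}, ∃ y, ξ < β → ZFSet.pair ξ.toZFSet y ∈ f := fun ξ => by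
    by_cases hξ : ξ < β
    · obtain ⟨y, hy, -⟩ := hfun _ (Ordinal.toZFSet_mem_toZFSet_iff.2 hξ)
      exact ⟨y, fun _ => hy⟩
    · exact ⟨∅, fun h => absurd h hξ⟩
  choose g hg using h
  refine ⟨g, fun ξ hξ => (ZFSet.pair_mem_prod.1 (hsub (hg ξ hξ))).2, ?_⟩
  ext p
  rw [mem_seqSet]
  constructor
  · intro hp
    obtain ⟨a, ha, b, hb, rfl⟩ := ZFSet.mem_prod.1 (hsub hp)
    obtain ⟨ξ, hξ, rfl⟩ := Ordinal.mem_toZFSet_iff.1 ha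
    exact ⟨ξ, hξ, by rw [(hfun _ ha).unique (hg ξ hξ) hp]⟩
  · rintro ⟨ξ, hξ, rfl⟩
    exact hg ξ hξ

theorem card_seqSet_le (β : Ordinal.{u}) (f : Ordinal.{u} → ZFSet.{u}) :
    (seqSet β f).card ≤ β.card := by
  rw [← Cardinal.mk_toType]
  refine card_le_of_forall_exists (fun i : β.ToType =>
    ZFSet.pair (i.toOrd : Ordinal.{u}).toZFSet (f i.toOrd)) fun p hp => ?_
  obtain ⟨ξ, hξ, rfl⟩ := mem_seqSet.1 hp
  exact ⟨Ordinal.ToType.mk ⟨ξ, hξ⟩, by simp [Ordinal.ToType.toOrd]⟩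

theorem seqSet_mem_hereditary {θ : Cardinal.{u}} (hθ : θ.IsRegular) {β : Ordinal.{u}}
    (hβ : β < θ.ord) {f : Ordinal.{u} → ZFSet.{u}} (hf : ∀ ξ < β, f ξ ∈ hereditary θ) :
    seqSet β f ∈ hereditary θ := by
  refine mem_hereditary_of_subset hθ (fun p hp => ?_)
    ((card_seqSet_le β f).trans_lt (Cardinal.lt_ord.1 hβ))
  obtain ⟨ξ, hξ, rfl⟩ := mem_seqSet.1 hp
  exact pair_mem_hereditary hθ (toZFSet_mem_hereditary (hξ.trans hβ)) (hf ξ hξ)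

/-! ### Skolem hulls closed under short sequences -/

open Classical in
/-- A witness in `H` for a formula with parameters `x`. -/
def skolem (H : ZFSet.{u}) {n : ℕ} (φ : setLanguage.BoundedFormula Empty (n + 1))
    (x : Fin n → ZFSet.{u}) : ZFSet.{u} :=
  if h : ∃ a : H, ∃ hx : ∀ i, x i ∈ H,
      φ.Realize default (Fin.snoc (fun i => (⟨x i, hx i⟩ : H)) a : Fin (n + 1) → H)
    then h.choose else ∅

theorem skolem_mem {θ : Cardinal.{u}} (hθ : θ.IsRegular) {n : ℕ}
    (φ : setLanguage.BoundedFormula Empty (n + 1)) (x : Fin n → ZFSet.{u}) :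
    skolem (hereditary θ) φ x ∈ hereditary θ := by
  unfold skolem
  split_ifs with h
  · exact h.choose.2
  · exact empty_mem_hereditary hθ

theorem skolem_spec {H : ZFSet.{u}} {n : ℕ} (φ : setLanguage.BoundedFormula Empty (n + 1))
    (x : Fin n → H) (a : H) (h : φ.Realize default (Fin.snoc x a : Fin (n + 1) → H)) :
    ∃ b : H, (b : ZFSet.{u}) = skolem H φ (fun i => x i) ∧
      φ.Realize default (Fin.snoc x b : Fin (n + 1) → H) := by
  have h' : ∃ a : H, ∃ hx : ∀ i, (x i : ZFSet.{u}) ∈ H,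
      φ.Realize default (Fin.snoc (fun i => (⟨x i, hx i⟩ : H)) a : Fin (n + 1) → H) :=
    ⟨a, fun i => (x i).2, h⟩
  refine ⟨h'.choose, ?_, h'.choose_spec.2⟩
  rw [skolem, dif_pos h']

/-- The Tarski–Vaught test. -/
theorem isElemSubmodel_of_exists {M H : ZFSet.{u}} (hMH : M ⊆ H)
    (h : ∀ (n : ℕ) (φ : setLanguage.BoundedFormula Empty (n + 1)) (x : Fin n → H),
      (∀ i, (x i : ZFSet.{u}) ∈ M) → ∀ a : H,
        φ.Realize default (Fin.snoc x a : Fin (n + 1) → H) →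
          ∃ b : H, (b : ZFSet.{u}) ∈ M ∧
            φ.Realize default (Fin.snoc x b : Fin (n + 1) → H)) : IsElemSubmodel M H := by
  let i : M ↪[setLanguage] H :=
    { toFun := fun x => ⟨x, hMH x.2⟩
      inj' := fun x y hxy => Subtype.ext (congrArg (fun z : H => (z : ZFSet.{u})) hxy)
      map_fun' := fun f => f.elim
      map_rel' := fun {n} r x => by cases r; exact Iff.rfl }
  refine ⟨i.toElementaryEmbedding fun n φ x a ha => ?_, fun x => rfl⟩
  obtain ⟨b, hb, hφ⟩ := h n φ (i ∘ x) (fun j => (x j).2) a ha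
  exact ⟨⟨b, hb⟩, hφ⟩

/-- The nodes of the terms that generate a hull: generators, Skolem functions of two structures,
and sequences of length less than `κ`. -/
def HullNode (κ : Cardinal.{u}) (J : Type u) : Type u :=
  J ⊕ (Bool × Σ n, setLanguage.BoundedFormula Empty (n + 1)) ⊕ κ.ord.ToType

/-- The arities of the nodes. -/
def HullNode.Arity {κ : Cardinal.{u}} {J : Type u} : HullNode κ J → Type u
  | .inl _ => PEmpty
  | .inr (.inl b) => ULift (Fin b.2.1)
  | .inr (.inr x) => (x.toOrd : Ordinal.{u}).ToType

/-- The value of a term. -/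
def hullEval (κ : Cardinal.{u}) (H₁ H₂ : ZFSet.{u}) {J : Type u} (s : J → ZFSet.{u}) :
    WType (HullNode.Arity (κ := κ) (J := J)) → ZFSet.{u}
  | ⟨.inl j, _⟩ => s j
  | ⟨.inr (.inl b), c⟩ =>
    skolem (cond b.1 H₁ H₂) b.2.2 fun i => hullEval κ H₁ H₂ s (c (ULift.up i))
  | ⟨.inr (.inr _), c⟩ => ZFSet.range fun i =>
    ZFSet.pair (i.toOrd : Ordinal.{u}).toZFSet (hullEval κ H₁ H₂ s (c i))

/-- The closure of the range of `s` under Skolem functions for `H₁` and `H₂` and under sequences of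
length less than `κ`. -/
def hull (κ : Cardinal.{u}) (H₁ H₂ : ZFSet.{u}) {J : Type u} (s : J → ZFSet.{u}) : ZFSet.{u} :=
  ZFSet.range (hullEval κ H₁ H₂ s)

section hull

variable {κ : Cardinal.{u}} {H₁ H₂ : ZFSet.{u}} {J : Type u} {s : J → ZFSet.{u}}

theorem hullEval_skolem (b : Bool × Σ n, setLanguage.BoundedFormula Empty (n + 1))
    (c : ULift (Fin b.2.1) → WType (HullNode.Arity (κ := κ) (J := J))) :
    hullEval κ H₁ H₂ s ⟨.inr (.inl b), c⟩ =
      skolem (cond b.1 H₁ H₂) b.2.2 fun i => hullEval κ H₁ H₂ s (c (ULift.up i)) := rfl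

open Classical in
theorem hullEval_seq (x : κ.ord.ToType)
    (c : (x.toOrd : Ordinal.{u}).ToType → WType (HullNode.Arity (κ := κ) (J := J))) :
    hullEval κ H₁ H₂ s ⟨.inr (.inr x), c⟩ =
      seqSet x.toOrd fun ξ => if h : ξ < (x.toOrd : Ordinal.{u}) then
        hullEval κ H₁ H₂ s (c (Ordinal.ToType.mk ⟨ξ, h⟩)) else ∅ := by
  change ZFSet.range (fun i : (x.toOrd : Ordinal.{u}).ToType =>
    ZFSet.pair (i.toOrd : Ordinal.{u}).toZFSet (hullEval κ H₁ H₂ s (c i))) = _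
  ext p
  rw [ZFSet.mem_range, mem_seqSet]
  constructor
  · rintro ⟨i, rfl⟩
    refine ⟨i.toOrd, i.toOrd.2, ?_⟩
    have hi : (i.toOrd : Ordinal.{u}) < (x.toOrd : Ordinal.{u}) := i.toOrd.2
    rw [dif_pos hi]
    congr 3
    exact Ordinal.ToType.mk.apply_symm_apply i
  · rintro ⟨ξ, hξ, rfl⟩
    refine ⟨Ordinal.ToType.mk ⟨ξ, hξ⟩, ?_⟩
    rw [dif_pos hξ]
    simp [Ordinal.ToType.toOrd]

theorem mem_hull_of_generator (j : J) : s j ∈ hull κ H₁ H₂ s :=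
  ZFSet.mem_range.2 ⟨⟨.inl j, PEmpty.elim⟩, rfl⟩

theorem skolem_mem_hull (b : Bool) {n : ℕ} (φ : setLanguage.BoundedFormula Empty (n + 1))
    {x : Fin n → ZFSet.{u}} (hx : ∀ i, x i ∈ hull κ H₁ H₂ s) :
    skolem (cond b H₁ H₂) φ x ∈ hull κ H₁ H₂ s := by
  choose c hc using fun i => ZFSet.mem_range.1 (hx i)
  refine ZFSet.mem_range.2 ⟨⟨.inr (.inl ⟨b, n, φ⟩), fun i : ULift (Fin n) => c i.down⟩, ?_⟩
  refine (hullEval_skolem ⟨b, n, φ⟩ fun i => c i.down).trans ?_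
  simp only [hc]

theorem seqSet_mem_hull {β : Ordinal.{u}} (hβ : β < κ.ord) {f : Ordinal.{u} → ZFSet.{u}}
    (hf : ∀ ξ < β, f ξ ∈ hull κ H₁ H₂ s) : seqSet β f ∈ hull κ H₁ H₂ s := by
  obtain ⟨x, hx⟩ : ∃ x : κ.ord.ToType, (x.toOrd : Ordinal.{u}) = β :=
    ⟨Ordinal.ToType.mk ⟨β, hβ⟩, by simp [Ordinal.ToType.toOrd]⟩
  subst hx
  choose c hc using fun i : (x.toOrd : Ordinal.{u}).ToType =>
    ZFSet.mem_range.1 (hf i.toOrd i.toOrd.2)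
  refine ZFSet.mem_range.2 ⟨⟨.inr (.inr x), c⟩, (hullEval_seq x c).trans (seqSet_congr ?_)⟩
  intro ξ hξ
  rw [dif_pos hξ, hc]
  simp [Ordinal.ToType.toOrd]

theorem hull_induction {P : ZFSet.{u} → Prop} (hs : ∀ j, P (s j))
    (hskolem : ∀ (b : Bool) (n : ℕ) (φ : setLanguage.BoundedFormula Empty (n + 1))
      (x : Fin n → ZFSet.{u}), (∀ i, P (x i)) → P (skolem (cond b H₁ H₂) φ x))
    (hseq : ∀ β < κ.ord, ∀ f : Ordinal.{u} → ZFSet.{u}, (∀ ξ < β, P (f ξ)) → P (seqSet β f))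
    {z : ZFSet.{u}} (hz : z ∈ hull κ H₁ H₂ s) : P z := by
  obtain ⟨t, rfl⟩ := ZFSet.mem_range.1 hz
  clear hz
  induction t with
  | mk a c ih =>
    rcases a with j | b | x
    · exact hs j
    · exact (hullEval_skolem b c).symm ▸ hskolem _ _ _ _ fun i => ih (ULift.up i)
    · refine (hullEval_seq x c).symm ▸ hseq x.toOrd x.toOrd.2 _ fun ξ hξ => ?_
      rw [dif_pos hξ]
      exact ih _

theorem hull_subset_hull {J' : Type u} {s' : J' → ZFSet.{u}}
    (h : ∀ j, s j ∈ hull κ H₁ H₂ s') : hull κ H₁ H₂ s ⊆ hull κ H₁ H₂ s' :=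
  fun _ hz => hull_induction h (fun b _ φ _ hx => skolem_mem_hull b φ hx)
    (fun _ hβ _ hf => seqSet_mem_hull hβ hf) hz

theorem hull_subset_hereditary {θ θ' : Cardinal.{u}} (hθ : θ.IsRegular) (hθ' : θ'.IsRegular)
    (hle : θ ≤ θ') (hκ : κ < θ') (hs : ∀ j, s j ∈ hereditary θ') :
    hull κ (hereditary θ') (hereditary θ) s ⊆ hereditary θ' := fun _ hz => by
  refine hull_induction hs (fun b n φ x _ => ?_) (fun β hβ f hf => ?_) hz
  · cases b
    · exact hereditary_mono hle (skolem_mem hθ φ x)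
    · exact skolem_mem hθ' φ x
  · exact seqSet_mem_hereditary hθ' (hβ.trans (Cardinal.ord_lt_ord.2 hκ)) hf

theorem isElemSubmodel_hull (h : hull κ H₁ H₂ s ⊆ H₁) : IsElemSubmodel (hull κ H₁ H₂ s) H₁ := by
  refine isElemSubmodel_of_exists h fun n φ x hx a ha => ?_
  obtain ⟨b, hb, hφ⟩ := skolem_spec φ x a ha
  refine ⟨b, ?_, hφ⟩
  rw [hb]
  exact skolem_mem_hull true φ hx

/-- The reason for closing under Skolem functions of two structures: the trace on `H₂` is elementary
in `H₂` even if `H₂` is not an element of `H₁`. -/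
theorem isElemSubmodel_hull_inter : IsElemSubmodel (hull κ H₁ H₂ s ∩ H₂) H₂ := by
  refine isElemSubmodel_of_exists (fun z hz => (ZFSet.mem_inter.1 hz).2) fun n φ x hx a ha => ?_
  obtain ⟨b, hb, hφ⟩ := skolem_spec φ x a ha
  refine ⟨b, ZFSet.mem_inter.2 ⟨?_, b.2⟩, hφ⟩
  rw [hb]
  exact skolem_mem_hull false φ fun i => (ZFSet.mem_inter.1 (hx i)).1

theorem card_boundedFormula_le :
    Cardinal.mk (Σ n, setLanguage.BoundedFormula Empty (n + 1)) ≤ Cardinal.aleph0 := by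
  have h := Language.BoundedFormula.card_le (L := setLanguage) (α := Empty)
  have hc : setLanguage.card ≤ Cardinal.aleph0 := by
    rw [Language.card, Cardinal.mk_le_aleph0_iff]
    have h₁ : IsEmpty (Σ n, setLanguage.Functions n) := ⟨fun f => f.2.elim⟩
    have h₂ : ∀ n, Countable (setLanguage.Relations n) := fun n =>
      ⟨⟨fun _ => 0, fun a b _ => by cases a; cases b; rfl⟩⟩
    rw [Language.Symbols]
    infer_instance
  have h₁ : Cardinal.mk (Σ n, setLanguage.BoundedFormula Empty n) ≤ Cardinal.aleph0 := by
    refine h.trans (max_le le_rfl ?_)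
    simpa using hc
  refine (Cardinal.mk_le_of_injective (f := fun φ : Σ n, setLanguage.BoundedFormula Empty (n + 1) =>
    (⟨φ.1 + 1, φ.2⟩ : Σ n, setLanguage.BoundedFormula Empty n)) ?_).trans h₁
  rintro ⟨n, φ⟩ ⟨m, ψ⟩ h
  obtain ⟨h₁, h₂⟩ := Sigma.mk.inj h
  obtain rfl : n = m := Nat.succ_injective h₁
  obtain rfl : φ = ψ := eq_of_heq h₂
  rfl

/-- There are at most `κ` nodes, all of arity less than `κ`, so `κ^{<κ} = κ` bounds the number of
well-founded terms. Working with terms avoids a transfinite iteration of the closure. -/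
theorem card_hull_le (hκ : Cardinal.aleph0 ≤ κ) (hpow : Cardinal.powerlt κ κ = κ)
    (hJ : Cardinal.mk J ≤ κ) : (hull κ H₁ H₂ s).card ≤ κ := by
  refine (card_le_of_forall_exists (hullEval κ H₁ H₂ s) fun z hz => ZFSet.mem_range.1 hz).trans ?_
  refine WType.cardinalMk_le_of_le ?_
  have hκ₁ : (1 : Cardinal.{u}) ≤ κ := Cardinal.one_le_aleph0.trans hκ
  have h : ∀ a : HullNode κ J, κ ^ Cardinal.mk a.Arity ≤ κ := by
    intro a
    have hlt : ∀ c < κ, κ ^ c ≤ κ := fun c hc => by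
      conv_rhs => rw [← hpow]
      exact Cardinal.le_powerlt κ hc
    refine hlt _ ?_
    rcases a with j | b | x
    · simpa [HullNode.Arity] using (zero_lt_one.trans_le hκ₁)
    · simpa [HullNode.Arity] using Cardinal.natCast_lt_aleph0.trans_le hκ
    · simpa [HullNode.Arity] using Cardinal.lt_ord.1 x.toOrd.2
  refine (Cardinal.sum_le_sum _ _ h).trans ?_
  rw [Cardinal.sum_const']
  refine (mul_le_mul_left ?_ _).trans (Cardinal.mul_eq_self hκ).le
  have h₁ : Cardinal.mk (HullNode κ J) = Cardinal.mk J + (Cardinal.lift.{u}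
      (Cardinal.mk (Bool × Σ n, setLanguage.BoundedFormula Empty (n + 1))) + κ) := by
    simp [HullNode]
  rw [h₁]
  refine Cardinal.add_le_of_le hκ hJ (Cardinal.add_le_of_le hκ ?_ le_rfl)
  refine le_trans ?_ hκ
  rw [Cardinal.lift_le_aleph0, Cardinal.mk_prod, Cardinal.lift_id, Cardinal.lift_id]
  exact (Cardinal.mul_le_of_le le_rfl (Cardinal.mk_le_aleph0) card_boundedFormula_le)

end hull

/-! ### Ordered pairs in a structure -/

/-- `⟨M, ∈⟩` satisfies that `p` is the ordered pair `(x, y)`. -/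
def IsOPairIn {M : ZFSet.{u}} (p x y : M) : Prop :=
  ∃ s d : M, IsPairIn s x x ∧ IsPairIn d x y ∧ IsPairIn p s d

theorem FO.opair {ι : Type*} (i j k : ι) : FO.{u} fun _ v => IsOPairIn (v i) (v j) (v k) := by
  unfold IsOPairIn
  exact .ex (.ex (.and (.isPair _ _ _) (.and (.isPair _ _ _) (.isPair _ _ _))))

theorem isOPairIn_iff {H : ZFSet.{u}} (hH : H.IsTransitive) {p x y : H} :
    IsOPairIn p x y ↔ (p : ZFSet.{u}) = ZFSet.pair x y := by
  constructor
  · rintro ⟨s, d, hs, hd, hp⟩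
    rw [isPairIn_iff hH] at hs hd hp
    rw [hp, hs, hd, ZFSet.pair_eq_singleton]
    rfl
  · intro h
    have hp := p.2
    rw [h] at hp
    have hs : ({↑x} : ZFSet.{u}) ∈ H := hH _ hp (by simp [ZFSet.pair])
    have hd : ({↑x, ↑y} : ZFSet.{u}) ∈ H := hH _ hp (by simp [ZFSet.pair])
    refine ⟨⟨_, hs⟩, ⟨_, hd⟩, ?_, ?_, ?_⟩ <;> rw [isPairIn_iff hH]
    · simp
    · exact h

/-! ### Definable subsets of `κ` and of `κ × κ` -/

/-- The subset of `k` given by a predicate. -/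
def subsetOf {k : ZFSet.{u}} (P : k → Prop) : ZFSet.{u} :=
  ZFSet.sep (fun ν => ∃ h : ν ∈ k, P ⟨ν, h⟩) k

theorem mem_subsetOf {k : ZFSet.{u}} {P : k → Prop} {ν : ZFSet.{u}} :
    ν ∈ subsetOf P ↔ ∃ h : ν ∈ k, P ⟨ν, h⟩ := by
  rw [subsetOf, ZFSet.mem_sep]
  exact ⟨fun h => h.2, fun h => ⟨h.1, h⟩⟩

theorem subsetOf_subset {k : ZFSet.{u}} {P : k → Prop} : subsetOf P ⊆ k :=
  ZFSet.sep_subset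

/-- The binary relation on `k` given by a predicate. -/
def relOn {k : ZFSet.{u}} (Q : k → k → Prop) : ZFSet.{u} :=
  ZFSet.sep (fun p => ∃ a b : k, Q a b ∧ p = ZFSet.pair a b) (k.prod k)

theorem mem_relOn {k : ZFSet.{u}} {Q : k → k → Prop} {p : ZFSet.{u}} :
    p ∈ relOn Q ↔ ∃ a b : k, Q a b ∧ p = ZFSet.pair a b := by
  rw [relOn, ZFSet.mem_sep, and_iff_right_iff_imp]
  rintro ⟨a, b, -, rfl⟩
  exact ZFSet.pair_mem_prod.2 ⟨a.2, b.2⟩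

theorem pair_mem_relOn {k : ZFSet.{u}} {Q : k → k → Prop} {a b : k} :
    ZFSet.pair a b ∈ relOn Q ↔ Q a b := by
  rw [mem_relOn]
  constructor
  · rintro ⟨a', b', h, hp⟩
    obtain ⟨h₁, h₂⟩ := ZFSet.pair_inj.1 hp
    rwa [Subtype.ext h₁, Subtype.ext h₂]
  · exact fun h => ⟨a, b, h, rfl⟩

/-- The row `{ν < κ | (ξ, ν) ∈ R}` of a relation. -/
def row (k R ξ : ZFSet.{u}) : ZFSet.{u} :=
  ZFSet.sep (fun ν => ZFSet.pair ξ ν ∈ R) k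

theorem row_relOn {k : ZFSet.{u}} {Q : k → k → Prop} (a : k) :
    row k (relOn Q) a = subsetOf (Q a) := by
  ext ν
  rw [row, ZFSet.mem_sep, mem_subsetOf]
  constructor
  · rintro ⟨h, hν⟩
    exact ⟨h, (pair_mem_relOn (Q := Q) (a := a) (b := ⟨ν, h⟩)).1 hν⟩
  · rintro ⟨h, hν⟩
    exact ⟨h, (pair_mem_relOn (Q := Q) (a := a) (b := ⟨ν, h⟩)).2 hν⟩

/-- `M` is an elementary submodel of `H(θ)` with `κ + 1 ⊆ M`. -/
structure IsSubmodel (κ θ : Cardinal.{u}) (M : ZFSet.{u}) : Prop where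
  reg : θ.IsRegular
  lt : κ < θ
  elem : IsElemSubmodel M (hereditary θ)
  succ_subset : (Order.succ κ.ord).toZFSet ⊆ M

section submodel

variable {κ θ : Cardinal.{u}} {M : ZFSet.{u}}

/-- The cardinal `κ` as an element of `H(θ)`. -/
def kH (h : κ < θ) : hereditary θ :=
  ⟨κ.ord.toZFSet, toZFSet_mem_hereditary (Cardinal.ord_lt_ord.2 h)⟩

theorem IsSubmodel.toZFSet_mem (hM : IsSubmodel κ θ M) {o : Ordinal.{u}} (ho : o ≤ κ.ord) :
    o.toZFSet ∈ M :=
  hM.succ_subset (Ordinal.toZFSet_mem_toZFSet_iff.2 (Order.lt_succ_of_le ho))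

theorem IsSubmodel.mem_of_mem (hM : IsSubmodel κ θ M) {x : ZFSet.{u}}
    (hx : x ∈ κ.ord.toZFSet) : x ∈ M := by
  obtain ⟨o, ho, rfl⟩ := Ordinal.mem_toZFSet_iff.1 hx
  exact hM.toZFSet_mem ho.le

/-- An element of `κ` as an element of `H(θ)`. -/
def inH (h : κ < θ) (ξ : κ.ord.toZFSet) : hereditary θ :=
  ⟨ξ, isTransitive_hereditary θ _ (kH h).2 ξ.2⟩

theorem IsSubmodel.subsetOf_mem (hM : IsSubmodel κ θ M) {ι : Type*}
    {P : ∀ K : ZFSet.{u}, (ι → K) → K → Prop}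
    (hP : FO fun K (v : Option ι → K) => P K (fun i => v (some i)) (v none))
    {v : ι → hereditary θ} (hv : ∀ i, (v i : ZFSet.{u}) ∈ M) :
    subsetOf (fun ξ : κ.ord.toZFSet => P _ v (inH hM.lt ξ)) ∈ M := by
  refine hM.elem.mem_of_definable (isTransitive_hereditary θ) (ι := Option ι)
    (P := fun K w z => E z (w none) ∧ P K (fun i => w (some i)) z)
    (v := fun o => o.elim (kH hM.lt) v) (.and (.mem _ _) ?_) ?_
    (mem_hereditary_of_subset_mem (kH hM.lt).2 subsetOf_subset) ?_
  · exact hP.relabel fun o : Option ι => o.elim none fun i => some (some i)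
  · rintro (_ | i)
    · exact hM.toZFSet_mem le_rfl
    · exact hv i
  · intro z
    rw [mem_subsetOf]
    exact ⟨fun ⟨h, h'⟩ => ⟨h, h'⟩, fun ⟨h, h'⟩ => ⟨h, h'⟩⟩

theorem relOn_mem_hereditary (hθ : θ.IsRegular) {k : ZFSet.{u}} (hk : k ∈ hereditary θ)
    {Q : k → k → Prop} : relOn Q ∈ hereditary θ := by
  refine mem_hereditary_of_subset hθ (fun p hp => ?_) ?_
  · obtain ⟨a, b, -, rfl⟩ := mem_relOn.1 hp
    exact pair_mem_hereditary hθ (isTransitive_hereditary θ _ hk a.2)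
      (isTransitive_hereditary θ _ hk b.2)
  · exact ((ZFSet.card_mono ZFSet.sep_subset).trans (card_prod_le _ _)).trans_lt
      (Cardinal.mul_lt_of_lt hθ.aleph0_le (card_lt_of_mem_hereditary hk)
        (card_lt_of_mem_hereditary hk))

theorem IsSubmodel.relOn_mem (hM : IsSubmodel κ θ M) {ι : Type*}
    {P : ∀ K : ZFSet.{u}, (ι → K) → K → K → Prop}
    (hP : FO fun K (v : Option (Option ι) → K) =>
      P K (fun i => v (some (some i))) (v (some none)) (v none))
    {v : ι → hereditary θ} (hv : ∀ i, (v i : ZFSet.{u}) ∈ M) :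
    relOn (fun a b : κ.ord.toZFSet => P _ v (inH hM.lt a) (inH hM.lt b)) ∈ M := by
  refine hM.elem.mem_of_definable (isTransitive_hereditary θ) (ι := Option ι)
    (P := fun K w p => ∃ a b : K, E a (w none) ∧ E b (w none) ∧ IsOPairIn p a b ∧
      P K (fun i => w (some i)) a b)
    (v := fun o => o.elim (kH hM.lt) v)
    (.ex (.ex (.and (.mem _ _) (.and (.mem _ _) (.and (.opair _ _ _) ?_))))) ?_
    (relOn_mem_hereditary hM.reg (kH hM.lt).2) ?_
  · exact hP.relabel fun o : Option (Option ι) =>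
      o.elim none fun o => o.elim (some none) fun i => some (some (some (some i)))
  · rintro (_ | i)
    · exact hM.toZFSet_mem le_rfl
    · exact hv i
  · intro z
    rw [mem_relOn]
    constructor
    · rintro ⟨a, b, h, hz⟩
      exact ⟨inH hM.lt a, inH hM.lt b, a.2, b.2,
        (isOPairIn_iff (isTransitive_hereditary θ)).2 hz, h⟩
    · rintro ⟨a, b, ha, hb, hz, h⟩
      exact ⟨⟨a, ha⟩, ⟨b, hb⟩, h, (isOPairIn_iff (isTransitive_hereditary θ)).1 hz⟩

theorem IsSubmodel.sdiff_mem (hM : IsSubmodel κ θ M) {X : ZFSet.{u}} (hX : X ∈ M) :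
    κ.ord.toZFSet \ X ∈ M := by
  have := hM.subsetOf_mem (ι := Unit) (P := fun K w z => ¬ E z (w ())) (.not (.mem _ _))
    (v := fun _ => ⟨X, hM.elem.subset hX⟩) (fun _ => hX)
  convert this using 1
  ext z
  rw [ZFSet.mem_sdiff, mem_subsetOf]
  exact ⟨fun ⟨h, h'⟩ => ⟨h, h'⟩, fun ⟨h, h'⟩ => ⟨h, h'⟩⟩

/-! ### Functions on `κ` in `M` -/

/-- The elements of `M` which are, as relations, functional on `κ`. -/
def Fn (κ : Cardinal.{u}) (M : ZFSet.{u}) : Type (u + 1) :=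
  {f : ZFSet.{u} // f ∈ M ∧ ∀ ξ ∈ κ.ord.toZFSet, ∃! y, ZFSet.pair ξ y ∈ f}

instance : Small.{u} (Fn κ M) :=
  small_of_injective (f := fun f : Fn κ M => (⟨f.1, f.2.1⟩ : M)) fun _ _ h =>
    Subtype.ext (congrArg (fun z : M => (z : ZFSet.{u})) h)

/-- The function as an element of `H(θ)`. -/
def Fn.graph (hM : IsSubmodel κ θ M) (f : Fn κ M) : hereditary θ :=
  ⟨f.1, hM.elem.subset f.2.1⟩

theorem pair_mem_left_right {H p x y : ZFSet.{u}} (hH : H.IsTransitive) (hp : p ∈ H)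
    (h : ZFSet.pair x y ∈ p) : x ∈ H ∧ y ∈ H := by
  have hd : ({x, y} : ZFSet.{u}) ∈ H := hH _ (hH _ hp h) (by simp [ZFSet.pair])
  exact ⟨hH _ hd (by simp), hH _ hd (by simp)⟩

/-- The value of a function. -/
def Fn.app (hM : IsSubmodel κ θ M) (f : Fn κ M) (ξ : κ.ord.toZFSet) : hereditary θ :=
  ⟨(f.2.2 ξ ξ.2).choose, (pair_mem_left_right (isTransitive_hereditary θ)
    (hM.elem.subset f.2.1) (f.2.2 ξ ξ.2).choose_spec.1).2⟩

theorem Fn.rel_iff (hM : IsSubmodel κ θ M) (f : Fn κ M) (ξ : κ.ord.toZFSet)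
    (y : hereditary θ) : RelIn (f.graph hM) (inH hM.lt ξ) y ↔ y = f.app hM ξ := by
  rw [relIn_iff (isTransitive_hereditary θ)]
  constructor
  · exact fun h => Subtype.ext ((f.2.2 ξ ξ.2).unique h (f.2.2 ξ ξ.2).choose_spec.1)
  · rintro rfl
    exact (f.2.2 ξ ξ.2).choose_spec.1

/-- A choice function on `κ` has size less than `θ`, so it is an element of `H(θ)`. To be a choice
function for `P` is first-order, so `M` has one too. -/
theorem IsSubmodel.exists_fn (hM : IsSubmodel κ θ M) {ι : Type*}
    {P : ∀ K : ZFSet.{u}, (ι → K) → K → K → Prop}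
    (hP : FO fun K (v : Option (Option ι) → K) =>
      P K (fun i => v (some (some i))) (v (some none)) (v none))
    {v : ι → hereditary θ} (hv : ∀ i, (v i : ZFSet.{u}) ∈ M) :
    ∃ g : Fn κ M, ∀ ξ, (∃ y, P _ v (inH hM.lt ξ) y) →
      P _ v (inH hM.lt ξ) (g.app hM ξ) := by
  have h : ∀ ξ : κ.ord.toZFSet, ∃ y : hereditary θ, (∃ y, P _ v (inH hM.lt ξ) y) →
      P _ v (inH hM.lt ξ) y := fun ξ => by
    by_cases h : ∃ y, P _ v (inH hM.lt ξ) y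
    · exact ⟨h.choose, fun _ => h.choose_spec⟩
    -- Where no value satisfies `P`, any element of `H(θ)` will do.
    · exact ⟨inH hM.lt ξ, fun h' => absurd h' h⟩
  choose g₀ hg₀ using h
  have hG : ZFSet.range (fun ξ : κ.ord.toZFSet => ZFSet.pair ξ (g₀ ξ)) ∈ hereditary θ := by
    refine mem_hereditary_of_subset hM.reg (fun p hp => ?_) ?_
    · obtain ⟨ξ, rfl⟩ := ZFSet.mem_range.1 hp
      exact pair_mem_hereditary hM.reg (inH hM.lt ξ).2 (g₀ ξ).2
    · refine lt_of_le_of_lt ?_ hM.lt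
      conv_rhs => rw [← card_ord_toZFSet κ]
      refine card_le_of_forall_exists (ι := Shrink.{u} κ.ord.toZFSet) (fun i =>
        ZFSet.pair ((equivShrink _).symm i : κ.ord.toZFSet) (g₀ ((equivShrink _).symm i)))
        fun p hp => ?_
      obtain ⟨ξ, rfl⟩ := ZFSet.mem_range.1 hp
      exact ⟨equivShrink _ ξ, by simp⟩
  have hGp : ∀ (ξ : κ.ord.toZFSet) (y : hereditary θ),
      RelIn ⟨_, hG⟩ (inH hM.lt ξ) y ↔ y = g₀ ξ := by
    intro ξ y
    rw [relIn_iff (isTransitive_hereditary θ), ZFSet.mem_range]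
    constructor
    · rintro ⟨η, hη⟩
      obtain ⟨h₁, h₂⟩ := ZFSet.pair_inj.1 hη
      obtain rfl : η = ξ := Subtype.ext h₁
      exact Subtype.ext h₂.symm
    · rintro rfl
      exact ⟨ξ, rfl⟩
  obtain ⟨G, hGM, hGfun, hGP⟩ := hM.elem.exists_mem (ι := Option ι)
    (P := fun K w G => (∀ ξ, E ξ (w none) → ∃! y, RelIn G ξ y) ∧
      ∀ ξ, E ξ (w none) → ∀ y, RelIn G ξ y → (∃ y, P K (fun i => w (some i)) ξ y) →
        P K (fun i => w (some i)) ξ y)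
    (v := fun o => o.elim (kH hM.lt) v)
    (.and (.all (.imp (.mem _ _) (.existsUnique (.rel _ _ _))))
      (.all (.imp (.mem _ _) (.all (.imp (.rel _ _ _) (.imp (.ex
        (hP.relabel fun o : Option (Option ι) => o.elim none fun o => o.elim (some (some none))
          fun i => some (some (some (some (some i))))))
        (hP.relabel fun o : Option (Option ι) => o.elim none fun o => o.elim (some none)
          fun i => some (some (some (some i)))))))))) (by
      rintro (_ | i)
      · exact hM.toZFSet_mem le_rfl
      · exact hv i) (by
      refine ⟨⟨_, hG⟩, fun ξ hξ => ⟨g₀ ⟨ξ, hξ⟩, (hGp ⟨ξ, hξ⟩ _).2 rfl,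
        fun y hy => (hGp ⟨ξ, hξ⟩ _).1 hy⟩, fun ξ hξ y hy hex => ?_⟩
      obtain rfl := (hGp ⟨ξ, hξ⟩ _).1 hy
      exact hg₀ ⟨ξ, hξ⟩ hex)
  have hGM' : ∀ ξ ∈ κ.ord.toZFSet, ∃! y, ZFSet.pair ξ y ∈ (G : ZFSet.{u}) := by
    intro ξ hξ
    obtain ⟨y, hy, huniq⟩ := hGfun (inH hM.lt ⟨ξ, hξ⟩) hξ
    refine ⟨y, (relIn_iff (isTransitive_hereditary θ)).1 hy, fun z hz => ?_⟩
    have hzH := (pair_mem_left_right (isTransitive_hereditary θ) G.2 hz).2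
    exact congrArg Subtype.val (huniq ⟨z, hzH⟩
      ((relIn_iff (isTransitive_hereditary θ)).2 hz))
  let g : Fn κ M := ⟨G, hGM, hGM'⟩
  exact ⟨g, fun ξ hex => hGP (inH hM.lt ξ) ξ.2 _ ((g.rel_iff hM ξ _).2 rfl) hex⟩

/-- The values at `ξ` are reached through the graphs, which are parameters in `M`: the condition is
imposed on all tuples `z` related to `ξ` by the graphs, and there is exactly one. -/
theorem IsSubmodel.exists_fn_of_fn (hM : IsSubmodel κ θ M) {ι : Type*} [Finite ι]
    {P : ∀ K : ZFSet.{u}, (ι → K) → K → Prop}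
    (hP : FO fun K (v : Option ι → K) => P K (fun i => v (some i)) (v none)) (f : ι → Fn κ M) :
    ∃ g : Fn κ M, ∀ ξ, (∃ y, P _ (fun i => (f i).app hM ξ) y) →
      P _ (fun i => (f i).app hM ξ) (g.app hM ξ) := by
  have hfξ : ∀ (ξ : κ.ord.toZFSet) (z : ι → hereditary θ),
      (∀ i, RelIn ((f i).graph hM) (inH hM.lt ξ) (z i)) ↔ z = fun i => (f i).app hM ξ := by
    intro ξ z
    simp only [Fn.rel_iff, funext_iff]
  obtain ⟨g, hg⟩ := hM.exists_fn (ι := ι)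
    (P := fun K w ξ y => ∀ z : ι → K, (∀ i, RelIn (w i) ξ (z i)) → P K z y)
    (.allTuple (.imp (.forallFinite fun i => .rel _ _ _)
      (hP.relabel fun o : Option ι => o.elim (Sum.inl none) Sum.inr)))
    (v := fun i => (f i).graph hM) (fun i => (f i).2.1)
  simp only [hfξ, forall_eq] at hg
  exact ⟨g, hg⟩

theorem IsSubmodel.subsetOf_fn_mem (hM : IsSubmodel κ θ M) {ι : Type*} [Finite ι]
    {P : ∀ K : ZFSet.{u}, (ι → K) → Prop} (hP : FO P) (f : ι → Fn κ M) :
    subsetOf (fun ξ => P _ fun i => (f i).app hM ξ) ∈ M := by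
  have hfξ : ∀ (ξ : κ.ord.toZFSet) (z : ι → hereditary θ),
      (∀ i, RelIn ((f i).graph hM) (inH hM.lt ξ) (z i)) ↔ z = fun i => (f i).app hM ξ := by
    intro ξ z
    simp only [Fn.rel_iff, funext_iff]
  have := hM.subsetOf_mem (ι := ι)
    (P := fun K w ξ => ∀ z : ι → K, (∀ i, RelIn (w i) ξ (z i)) → P K z)
    (.allTuple (.imp (.forallFinite fun i => .rel _ _ _) (hP.relabel Sum.inr)))
    (v := fun i => (f i).graph hM) (fun i => (f i).2.1)
  simp only [hfξ, forall_eq] at this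
  exact this

end submodel

/-! ### Ultrapowers by normal measures -/

/-- `F` is an `M`-normal filter on `κ`, where `M ≺ H(θ)` is closed under `ω`-sequences, and the
restriction of `F` to the rows of any relation in `M` belongs to `M`. -/
structure IsMeasureFor (κ θ : Cardinal.{u}) (M F : ZFSet.{u}) : Prop
    extends IsSubmodel κ θ M where
  kreg : κ.IsRegular
  unc : Cardinal.aleph0 < κ
  closed : ∀ g : Ordinal.{u} → ZFSet.{u}, (∀ ξ < Ordinal.omega0, g ξ ∈ M) →
    seqSet Ordinal.omega0 g ∈ M
  normal : IsNormalFor κ M F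
  amenable : ∀ R ∈ M, ∃ B ∈ M, ∀ ξ ∈ κ.ord.toZFSet, ξ ∈ B ↔ row κ.ord.toZFSet R ξ ∈ F

theorem IsFilterOn.exists_mem {κ : Cardinal.{u}} {F : ZFSet.{u}} (hF : IsFilterOn κ F)
    (hκ : κ ≠ 0) {s : Set ZFSet.{u}} (hs : s.Finite) (h : ∀ A ∈ s, A ∈ F) :
    ∃ ξ ∈ κ.ord.toZFSet, ∀ A ∈ s, ξ ∈ A := by
  have hc := hF.2 s hs h
  by_contra! hne
  have : ZFSet.sep (fun x => ∀ A ∈ s, x ∈ A) κ.ord.toZFSet = ∅ := by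
    rw [ZFSet.eq_empty]
    intro y hy
    obtain ⟨hy, hA⟩ := ZFSet.mem_sep.1 hy
    obtain ⟨A, hAs, hyA⟩ := hne y hy
    exact hyA (hA A hAs)
  rw [this, ZFSet.card_empty] at hc
  exact hκ hc.symm

theorem mem_ord_trichotomy {κ : Cardinal.{u}} (a b : κ.ord.toZFSet) :
    (a : ZFSet.{u}) ∈ (b : ZFSet.{u}) ∨ a = b ∨ (b : ZFSet.{u}) ∈ (a : ZFSet.{u}) := by
  rw [Subtype.ext_iff]
  exact ((ZFSet.isOrdinal_toZFSet _).mem a.2).mem_trichotomous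
    ((ZFSet.isOrdinal_toZFSet _).mem b.2)

theorem card_lt_of_forall_not_mem {κ : Cardinal.{u}} (hκ : Cardinal.aleph0 ≤ κ)
    (ξ : κ.ord.toZFSet) {x : ZFSet.{u}} (hx : x ⊆ κ.ord.toZFSet)
    (h : ∀ ν ∈ x, (ξ : ZFSet.{u}) ∉ ν) : x.card < κ := by
  have hsub : x ⊆ insert (ξ : ZFSet.{u}) (ξ : ZFSet.{u}) := by
    intro ν hν
    rw [ZFSet.mem_insert_iff]
    rcases mem_ord_trichotomy ξ ⟨ν, hx hν⟩ with h' | h' | h'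
    · exact absurd h' (h ν hν)
    · exact .inl (congrArg Subtype.val h').symm
    · exact .inr h'
  refine (ZFSet.card_mono hsub).trans_lt (ZFSet.card_insert_le.trans_lt ?_)
  obtain ⟨o, ho, h⟩ := Ordinal.mem_toZFSet_iff.1 ξ.2
  rw [← h]
  exact Cardinal.add_lt_of_lt hκ (card_toZFSet_lt ho) (Cardinal.one_lt_aleph0.trans_le hκ)

namespace IsMeasureFor

variable {κ θ : Cardinal.{u}} {M F : ZFSet.{u}}

theorem exists_of_large (h : IsMeasureFor κ θ M F) {P : κ.ord.toZFSet → Prop}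
    (hP : subsetOf P ∈ F) : ∃ ξ, P ξ := by
  obtain ⟨ξ, hξ, hA⟩ := h.normal.1.exists_mem h.kreg.ne_zero (Set.finite_singleton (subsetOf P))
    (by simpa using hP)
  obtain ⟨hξ', hP'⟩ := mem_subsetOf.1 (hA _ rfl)
  exact ⟨_, hP'⟩

theorem subsetOf_not (P : κ.ord.toZFSet → Prop) :
    subsetOf (fun ξ => ¬ P ξ) = κ.ord.toZFSet \ subsetOf P := by
  ext z
  rw [ZFSet.mem_sdiff, mem_subsetOf, mem_subsetOf]
  exact ⟨fun ⟨h, h'⟩ => ⟨h, fun ⟨_, h''⟩ => h' h''⟩, fun ⟨h, h'⟩ => ⟨h, fun h'' => h' ⟨h, h''⟩⟩⟩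

theorem large_or (h : IsMeasureFor κ θ M F) {P : κ.ord.toZFSet → Prop} (hP : subsetOf P ∈ M) :
    subsetOf P ∈ F ∨ subsetOf (fun ξ => ¬ P ξ) ∈ F := by
  rw [subsetOf_not]
  exact h.normal.2.1 _ (ZFSet.mem_inter.2 ⟨ZFSet.mem_powerset.2 subsetOf_subset, hP⟩)

theorem large_of (h : IsMeasureFor κ θ M F) {P Q R : κ.ord.toZFSet → Prop}
    (hR : subsetOf R ∈ M) (hP : subsetOf P ∈ F) (hQ : subsetOf Q ∈ F)
    (hPQR : ∀ ξ, P ξ → Q ξ → R ξ) : subsetOf R ∈ F := by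
  refine (h.large_or hR).resolve_right fun hR' => ?_
  obtain ⟨ξ, hξ, hA⟩ := h.normal.1.exists_mem h.kreg.ne_zero
    (Set.toFinite {subsetOf P, subsetOf Q, subsetOf fun ξ => ¬ R ξ}) (by
      rintro A (rfl | rfl | rfl) <;> assumption)
  obtain ⟨_, h₁⟩ := mem_subsetOf.1 (hA _ (by simp : subsetOf P ∈ _))
  obtain ⟨_, h₂⟩ := mem_subsetOf.1 (hA _ (by simp : subsetOf Q ∈ _))
  obtain ⟨_, h₃⟩ := mem_subsetOf.1 (hA _ (by simp : subsetOf (fun ξ => ¬ R ξ) ∈ _))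
  exact h₃ (hPQR _ h₁ h₂)

theorem large_mono (h : IsMeasureFor κ θ M F) {P R : κ.ord.toZFSet → Prop}
    (hR : subsetOf R ∈ M) (hP : subsetOf P ∈ F) (hPR : ∀ ξ, P ξ → R ξ) : subsetOf R ∈ F :=
  h.large_of hR hP hP fun ξ h' _ => hPR ξ h'

theorem large_not_iff (h : IsMeasureFor κ θ M F) {P : κ.ord.toZFSet → Prop}
    (hP : subsetOf P ∈ M) : subsetOf (fun ξ => ¬ P ξ) ∈ F ↔ subsetOf P ∉ F := by
  refine ⟨fun h₁ h₂ => ?_, fun h₁ => (h.large_or hP).resolve_left h₁⟩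
  obtain ⟨ξ, hξ⟩ := h.exists_of_large (h.large_of (R := fun ξ => P ξ ∧ ¬ P ξ) (by
    have : subsetOf (fun ξ => P ξ ∧ ¬ P ξ) = (∅ : ZFSet.{u}) := by
      rw [ZFSet.eq_empty]
      intro y hy
      obtain ⟨_, h₁, h₂⟩ := mem_subsetOf.1 hy
      exact h₂ h₁
    rw [this, ← Ordinal.toZFSet_zero]
    exact h.toZFSet_mem zero_le) h₂ h₁ fun ξ h₁ h₂ => ⟨h₁, h₂⟩)
  exact hξ.2 hξ.1

/-- The complement of a tail is bounded in `κ`, hence smaller than the members of `F`. -/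
theorem large_tail (h : IsMeasureFor κ θ M F) (a : κ.ord.toZFSet) :
    subsetOf (fun ξ : κ.ord.toZFSet => (a : ZFSet.{u}) ∈ (ξ : ZFSet.{u})) ∈ F := by
  have hP : subsetOf (fun ξ : κ.ord.toZFSet => (a : ZFSet.{u}) ∈ (ξ : ZFSet.{u})) ∈ M :=
    h.subsetOf_mem (ι := Unit) (P := fun K w z => E (w ()) z) (.mem _ _)
      (v := fun _ => inH h.lt a) fun _ => h.mem_of_mem a.2
  refine (h.large_or hP).resolve_right fun h' => ?_
  have hc := h.normal.1.2 _ (Set.finite_singleton _) (by simpa using h')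
  refine (card_lt_of_forall_not_mem h.unc.le a (x := ZFSet.sep _ κ.ord.toZFSet)
    ZFSet.sep_subset fun ν hν => ?_).ne hc
  exact (mem_subsetOf.1 ((ZFSet.mem_sep.1 hν).2 _ rfl)).2

/-- Normality applied to the sequence of rows of a relation; this sequence lies in `M` because it is
definable from the relation. -/
theorem large_diag (h : IsMeasureFor κ θ M F) {Q : κ.ord.toZFSet → κ.ord.toZFSet → Prop}
    (hQ : relOn Q ∈ M) (hF : ∀ a, subsetOf (Q a) ∈ F) :
    subsetOf (fun b : κ.ord.toZFSet => ∀ a : κ.ord.toZFSet,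
      (a : ZFSet.{u}) ∈ (b : ZFSet.{u}) → Q a b) ∈ F := by
  let X := seqSet κ.ord fun ξ => row κ.ord.toZFSet (relOn Q) ξ.toZFSet
  have hrow : ∀ ξ < κ.ord, row κ.ord.toZFSet (relOn Q) ξ.toZFSet ∈ F := fun ξ hξ => by
    rw [row_relOn (Q := Q) ⟨ξ.toZFSet, Ordinal.toZFSet_mem_toZFSet_iff.2 hξ⟩]
    exact hF _
  have hrowH : ∀ ξ : Ordinal.{u}, row κ.ord.toZFSet (relOn Q) ξ.toZFSet ∈ hereditary θ := fun ξ =>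
    mem_hereditary_of_subset_mem (kH h.lt).2 ZFSet.sep_subset
  have hXM : X ∈ M := by
    refine h.elem.mem_of_definable (isTransitive_hereditary θ) (ι := Fin 2)
      (P := fun K w p => ∃ ξ y, E ξ (w 0) ∧ IsOPairIn p ξ y ∧
        ∀ ν, E ν y ↔ E ν (w 0) ∧ RelIn (w 1) ξ ν)
      (v := ![kH h.lt, ⟨relOn Q, h.elem.subset hQ⟩])
      (.ex (.ex (.and (.mem _ _) (.and (.opair _ _ _)
        (.all (.iff (.mem _ _) (.and (.mem _ _) (.rel _ _ _)))))))) ?_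
      (seqSet_mem_hereditary h.reg (Cardinal.ord_lt_ord.2 h.lt) fun ξ _ => hrowH ξ) ?_
    · intro i
      fin_cases i
      · exact h.toZFSet_mem le_rfl
      · exact hQ
    · intro z
      simp only [isOPairIn_iff (isTransitive_hereditary θ), relIn_iff (isTransitive_hereditary θ)]
      rw [mem_seqSet]
      constructor
      · rintro ⟨ξ, hξ, hz⟩
        have hξk : ξ.toZFSet ∈ κ.ord.toZFSet := Ordinal.toZFSet_mem_toZFSet_iff.2 hξ
        refine ⟨inH h.lt ⟨_, hξk⟩, ⟨_, hrowH ξ⟩, hξk, hz.symm, fun ν => ?_⟩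
        change (ν : ZFSet.{u}) ∈ row κ.ord.toZFSet (relOn Q) ξ.toZFSet ↔
          (ν : ZFSet.{u}) ∈ κ.ord.toZFSet ∧ ZFSet.pair ξ.toZFSet ν ∈ relOn Q
        rw [row, ZFSet.mem_sep]
      · rintro ⟨ξ, y, hξ, hz, hy⟩
        obtain ⟨o, ho, hoξ⟩ := Ordinal.mem_toZFSet_iff.1 hξ
        refine ⟨o, ho, hz.symm ▸ ?_⟩
        rw [hoξ]
        congr 1
        ext ν
        rw [row, ZFSet.mem_sep]
        constructor
        · rintro ⟨h₁, h₂⟩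
          exact (hy (inH h.lt ⟨ν, h₁⟩)).2 ⟨h₁, h₂⟩
        · intro hν
          exact (hy ⟨ν, isTransitive_hereditary θ _ y.2 hν⟩).1 hν
  have := h.normal.2.2 X hXM (seqSet_mem_funs hrow)
  convert this using 1
  ext ν
  rw [diagInter, ZFSet.mem_sep, mem_subsetOf]
  constructor
  · rintro ⟨hν, hall⟩
    refine ⟨hν, fun ξ hξ A hA => ?_⟩
    have hξk := (ZFSet.isOrdinal_toZFSet κ.ord).mem_trans hξ hν
    obtain ⟨o, ho, hoξ⟩ := Ordinal.mem_toZFSet_iff.1 hξk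
    rw [← hoξ] at hA
    obtain ⟨-, rfl⟩ := pair_mem_seqSet.1 hA
    rw [row, ZFSet.mem_sep, hoξ]
    exact ⟨hν, (pair_mem_relOn (Q := Q) (a := ⟨ξ, hξk⟩) (b := ⟨ν, hν⟩)).2 (hall _ hξ)⟩
  · rintro ⟨hν, hall⟩
    refine ⟨hν, fun a ha => ?_⟩
    obtain ⟨o, ho, hoξ⟩ := Ordinal.mem_toZFSet_iff.1 a.2
    have := hall a ha _ (by rw [← hoξ]; exact pair_mem_seqSet.2 ⟨ho, rfl⟩)
    rw [row, ZFSet.mem_sep, hoξ] at this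
    exact (pair_mem_relOn (Q := Q) (a := a) (b := ⟨ν, hν⟩)).1 this.2

theorem large_imp_iff (h : IsMeasureFor κ θ M F) {P Q : κ.ord.toZFSet → Prop}
    (hP : subsetOf P ∈ M) (hQ : subsetOf Q ∈ M) (hPQ : subsetOf (fun ξ => P ξ → Q ξ) ∈ M) :
    subsetOf (fun ξ => P ξ → Q ξ) ∈ F ↔ (subsetOf P ∈ F → subsetOf Q ∈ F) := by
  constructor
  · exact fun h₁ h₂ => h.large_of hQ h₁ h₂ fun ξ h₃ h₄ => h₃ h₄
  · intro h₁
    by_cases h₂ : subsetOf P ∈ F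
    · exact h.large_mono hPQ (h₁ h₂) fun ξ h₃ _ => h₃
    · exact h.large_mono hPQ ((h.large_not_iff hP).2 h₂) fun ξ h₃ h₄ => absurd h₄ h₃

/-- The membership relation of the ultrapower. -/
def memRel (h : IsMeasureFor κ θ M F) (f g : Fn κ M) : Prop :=
  subsetOf (fun ξ => (f.app h.toIsSubmodel ξ : ZFSet.{u}) ∈
    (g.app h.toIsSubmodel ξ : ZFSet.{u})) ∈ F

/-- The equality relation of the ultrapower. -/
def eqRel (h : IsMeasureFor κ θ M F) (f g : Fn κ M) : Prop :=
  subsetOf (fun ξ => f.app h.toIsSubmodel ξ = g.app h.toIsSubmodel ξ) ∈ F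

theorem mem_definable (h : IsMeasureFor κ θ M F) (f g : Fn κ M) :
    subsetOf (fun ξ => (f.app h.toIsSubmodel ξ : ZFSet.{u}) ∈
      (g.app h.toIsSubmodel ξ : ZFSet.{u})) ∈ M :=
  h.subsetOf_fn_mem (ι := Fin 2) (P := fun _ v => E (v 0) (v 1)) (.mem _ _) ![f, g]

theorem eq_definable (h : IsMeasureFor κ θ M F) (f g : Fn κ M) :
    subsetOf (fun ξ => f.app h.toIsSubmodel ξ = g.app h.toIsSubmodel ξ) ∈ M :=
  h.subsetOf_fn_mem (ι := Fin 2) (P := fun _ v => v 0 = v 1) (.eq _ _) ![f, g]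

theorem memRel_congr_left (h : IsMeasureFor κ θ M F) {f f' g : Fn κ M} (he : h.eqRel f f')
    (hm : h.memRel f g) : h.memRel f' g :=
  h.large_of (h.mem_definable f' g) he hm fun _ h₁ h₂ => h₁ ▸ h₂

theorem memRel_congr_right (h : IsMeasureFor κ θ M F) {f g g' : Fn κ M} (he : h.eqRel g g')
    (hm : h.memRel f g) : h.memRel f g' :=
  h.large_of (h.mem_definable f g') he hm fun _ h₁ h₂ => h₁ ▸ h₂

theorem eqRel_symm (h : IsMeasureFor κ θ M F) {f g : Fn κ M} (he : h.eqRel f g) :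
    h.eqRel g f :=
  h.large_mono (h.eq_definable g f) he fun _ h₁ => h₁.symm

/-- A descending chain gives sets `A n ∈ F` for all `n`. Closure under `ω`-sequences puts their
sequence into `M`, so a diagonal intersection is in `F`. A point of it above `ω` lies in every `A
n`, and there the values descend in `∈`. -/
theorem wellFounded_memRel (h : IsMeasureFor κ θ M F) : WellFounded h.memRel := by
  rw [wellFounded_iff_isEmpty_descending_chain]
  refine ⟨fun ⟨f, hf⟩ => ?_⟩
  let A : ℕ → ZFSet.{u} := fun n => subsetOf (fun ξ =>
    ((f (n + 1)).app h.toIsSubmodel ξ : ZFSet.{u}) ∈ ((f n).app h.toIsSubmodel ξ : ZFSet.{u}))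
  have hA : ∀ n, A n ∈ M := fun n => h.mem_definable _ _
  -- Reindexing by ordinals; only the values at finite ordinals are used.
  let g : Ordinal.{u} → ZFSet.{u} := fun ξ => A (Cardinal.toNat ξ.card)
  have hg : ∀ n : ℕ, g n = A n := fun n => by simp [g]
  have hs : seqSet Ordinal.omega0 g ∈ M := h.closed g fun ξ _ => hA _
  have hω : Ordinal.omega0.{u} < κ.ord := by
    rw [← Cardinal.ord_aleph0]
    exact Cardinal.ord_lt_ord.2 h.unc
  let Q : κ.ord.toZFSet → κ.ord.toZFSet → Prop := fun a b =>
    ∀ X : hereditary θ, RelIn ⟨_, h.elem.subset hs⟩ (inH h.lt a) X → E (inH h.lt b) X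
  have hQ : relOn Q ∈ M :=
    h.relOn_mem (ι := Unit) (P := fun K w a b => ∀ X, RelIn (w ()) a X → E b X)
      (.all (.imp (.rel _ _ _) (.mem _ _))) (v := fun _ => ⟨_, h.elem.subset hs⟩) fun _ => hs
  have hrow : ∀ a, subsetOf (Q a) ∈ M := fun a => by
    refine h.subsetOf_mem (ι := Fin 2)
      (P := fun K w b => ∀ X, RelIn (w 0) (w 1) X → E b X)
      (.all (.imp (.rel _ _ _) (.mem _ _))) (v := ![⟨_, h.elem.subset hs⟩, inH h.lt a]) ?_
    intro i
    fin_cases i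
    · exact hs
    · exact h.mem_of_mem a.2
  have hlarge : ∀ a, subsetOf (Q a) ∈ F := by
    intro a
    obtain ⟨o, ho, hoa⟩ := Ordinal.mem_toZFSet_iff.1 a.2
    by_cases hn : o < Ordinal.omega0
    · obtain ⟨n, rfl⟩ := Ordinal.lt_omega0.1 hn
      refine h.large_mono (hrow a) (hf n) fun ξ hξ X hX => ?_
      rw [relIn_iff (isTransitive_hereditary θ)] at hX
      change ZFSet.pair (a : ZFSet.{u}) X ∈ _ at hX
      rw [← hoa] at hX
      have := (pair_mem_seqSet.1 hX).2
      rw [E, this, hg]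
      exact mem_subsetOf.2 ⟨ξ.2, hξ⟩
    -- At an infinite index the condition is vacuous, and the tail merely serves as some member of
    -- `F`.
    · refine h.large_mono (hrow a) (h.large_tail a) fun ξ _ X hX => ?_
      rw [relIn_iff (isTransitive_hereditary θ)] at hX
      change ZFSet.pair (a : ZFSet.{u}) X ∈ _ at hX
      rw [← hoa] at hX
      exact absurd (pair_mem_seqSet.1 hX).1 hn
  let w : κ.ord.toZFSet := ⟨Ordinal.omega0.toZFSet, Ordinal.toZFSet_mem_toZFSet_iff.2 hω⟩
  have hD := h.large_diag hQ hlarge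
  obtain ⟨ν, hν⟩ : ∃ ν, ∀ n, ((f (n + 1)).app h.toIsSubmodel ν : ZFSet.{u}) ∈
      ((f n).app h.toIsSubmodel ν : ZFSet.{u}) := by
    have hT := h.large_tail w
    obtain ⟨ν, hν, hA'⟩ := h.normal.1.exists_mem h.kreg.ne_zero (Set.toFinite {_, _}) (by
      rintro A (rfl | rfl)
      · exact hD
      · exact hT)
    obtain ⟨_, h₁⟩ := mem_subsetOf.1 (hA' _ (.inl rfl))
    obtain ⟨_, h₂⟩ := mem_subsetOf.1 (hA' _ (.inr rfl))
    refine ⟨⟨ν, hν⟩, fun n => ?_⟩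
    have hnw : ((n : Ordinal.{u})).toZFSet ∈ Ordinal.omega0.toZFSet :=
      Ordinal.toZFSet_mem_toZFSet_iff.2 (Ordinal.natCast_lt_omega0 n)
    have hnk : ((n : Ordinal.{u})).toZFSet ∈ κ.ord.toZFSet :=
      Ordinal.toZFSet_mem_toZFSet_iff.2 ((Ordinal.natCast_lt_omega0 n).trans hω)
    have hnν : ((n : Ordinal.{u})).toZFSet ∈ ν :=
      ((ZFSet.isOrdinal_toZFSet _).mem hν).mem_trans hnw h₂
    have hAH : A n ∈ hereditary θ := h.elem.subset (hA n)
    have := h₁ ⟨_, hnk⟩ hnν ⟨_, hAH⟩ ((relIn_iff (isTransitive_hereditary θ)).2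
      (pair_mem_seqSet.2 ⟨Ordinal.natCast_lt_omega0 n, (hg n).symm⟩))
    exact (mem_subsetOf.1 (show ν ∈ A n from this)).2
  exact (wellFounded_iff_isEmpty_descending_chain.1 ZFSet.mem_wf).false ⟨_, hν⟩

/-- The Mostowski collapse of the ultrapower. -/
def collapse (h : IsMeasureFor κ θ M F) : Fn κ M → ZFSet.{u} :=
  h.wellFounded_memRel.fix fun g ih => ZFSet.range fun f : {f // h.memRel f g} => ih f f.2

theorem mem_collapse (h : IsMeasureFor κ θ M F) {g : Fn κ M} {x : ZFSet.{u}} :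
    x ∈ h.collapse g ↔ ∃ f, h.memRel f g ∧ h.collapse f = x := by
  rw [collapse, WellFounded.fix_eq, ZFSet.mem_range]
  exact ⟨fun ⟨f, hf⟩ => ⟨f, f.2, hf⟩, fun ⟨f, hf, hx⟩ => ⟨⟨f, hf⟩, hx⟩⟩

/-- The ultrapower of `M` by `F`. -/
def ultrapower (h : IsMeasureFor κ θ M F) : ZFSet.{u} :=
  ZFSet.range h.collapse

theorem isTransitive_ultrapower (h : IsMeasureFor κ θ M F) : h.ultrapower.IsTransitive := by
  intro x hx y hy
  obtain ⟨g, rfl⟩ := ZFSet.mem_range.1 hx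
  obtain ⟨f, -, rfl⟩ := h.mem_collapse.1 hy
  exact ZFSet.mem_range.2 ⟨f, rfl⟩

/-- The element of the ultrapower represented by a function. -/
def toUlt (h : IsMeasureFor κ θ M F) (f : Fn κ M) : h.ultrapower :=
  ⟨h.collapse f, ZFSet.mem_range.2 ⟨f, rfl⟩⟩

theorem toUlt_surjective (h : IsMeasureFor κ θ M F) : Function.Surjective h.toUlt := by
  rintro ⟨x, hx⟩
  obtain ⟨f, rfl⟩ := ZFSet.mem_range.1 hx
  exact ⟨f, rfl⟩

/-- Extensionality of the ultrapower: a function in `M` picks an element of the symmetric difference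
wherever the values differ. -/
theorem exists_difference (h : IsMeasureFor κ θ M F) {f g : Fn κ M} (hfg : ¬ h.eqRel f g) :
    ∃ e, h.memRel e f ∧ ¬ h.memRel e g ∨ ¬ h.memRel e f ∧ h.memRel e g := by
  rw [eqRel, ← h.large_not_iff (h.eq_definable f g)] at hfg
  obtain ⟨e, he⟩ := h.exists_fn_of_fn (ι := Fin 2)
    (P := fun K v y => ¬ (E y (v 0) ↔ E y (v 1))) (.not (.iff (.mem _ _) (.mem _ _))) ![f, g]
  have hex : ∀ ξ, f.app h.toIsSubmodel ξ ≠ g.app h.toIsSubmodel ξ →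
      ¬ (E (e.app h.toIsSubmodel ξ) (f.app h.toIsSubmodel ξ) ↔
        E (e.app h.toIsSubmodel ξ) (g.app h.toIsSubmodel ξ)) := by
    intro ξ hξ
    refine he ξ ?_
    by_contra! hall
    refine hξ (Subtype.ext (ZFSet.ext fun z => ⟨fun hz => ?_, fun hz => ?_⟩))
    · exact (hall ⟨z, isTransitive_hereditary θ _ (f.app h.toIsSubmodel ξ).2 hz⟩).1 hz
    · exact (hall ⟨z, isTransitive_hereditary θ _ (g.app h.toIsSubmodel ξ).2 hz⟩).2 hz
  refine ⟨e, ?_⟩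
  by_cases h₁ : h.memRel e f
  · refine .inl ⟨h₁, fun h₂ => ?_⟩
    obtain ⟨ξ, hξ⟩ := h.exists_of_large (h.large_of (h.eq_definable f g) h₁ h₂
      fun ξ h₃ h₄ => by_contra fun hne => hex ξ hne ⟨fun _ => h₄, fun _ => h₃⟩)
    exact (h.large_not_iff (h.eq_definable f g)).1 hfg (h.large_of (h.eq_definable f g) h₁ h₂
      fun ξ h₃ h₄ => by_contra fun hne => hex ξ hne ⟨fun _ => h₄, fun _ => h₃⟩)
  · refine .inr ⟨h₁, ?_⟩
    refine h.large_of (h.mem_definable e g) hfg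
      ((h.large_not_iff (h.mem_definable e f)).2 h₁) fun ξ hne h₃ => by_contra fun h₄ =>
        hex ξ hne ⟨fun h₅ => absurd h₅ h₃, fun h₅ => absurd h₅ h₄⟩

theorem collapse_eq_iff (h : IsMeasureFor κ θ M F) {f g : Fn κ M} :
    h.collapse f = h.collapse g ↔ h.eqRel f g := by
  constructor
  · induction f using h.wellFounded_memRel.induction generalizing g with
    | _ f ih =>
      intro hfg
      by_contra hne
      obtain ⟨e, ⟨h₁, h₂⟩ | ⟨h₁, h₂⟩⟩ := h.exists_difference hne
      · obtain ⟨e', he', hee'⟩ := h.mem_collapse.1 (hfg ▸ h.mem_collapse.2 ⟨e, h₁, rfl⟩)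
        exact h₂ (h.memRel_congr_left (h.eqRel_symm (ih e h₁ hee'.symm)) he')
      · obtain ⟨e', he', hee'⟩ := h.mem_collapse.1 (hfg.symm ▸ h.mem_collapse.2 ⟨e, h₂, rfl⟩)
        exact h₁ (h.memRel_congr_left (ih e' he' hee') he')
  · intro he
    ext x
    rw [h.mem_collapse, h.mem_collapse]
    constructor
    · exact fun ⟨e, he', hx⟩ => ⟨e, h.memRel_congr_right he he', hx⟩
    · exact fun ⟨e, he', hx⟩ => ⟨e, h.memRel_congr_right (h.eqRel_symm he) he', hx⟩

theorem collapse_mem_iff (h : IsMeasureFor κ θ M F) {f g : Fn κ M} :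
    h.collapse f ∈ h.collapse g ↔ h.memRel f g := by
  rw [h.mem_collapse]
  constructor
  · rintro ⟨e, he, heq⟩
    exact h.memRel_congr_left (h.collapse_eq_iff.1 heq) he
  · exact fun hm => ⟨f, hm, rfl⟩

theorem realize_definable (h : IsMeasureFor κ θ M F) {ι : Type*} [Finite ι] {n : ℕ}
    (φ : setLanguage.BoundedFormula ι n) (v : ι → Fn κ M) (xs : Fin n → Fn κ M) :
    subsetOf (fun ξ => φ.Realize (fun i => (v i).app h.toIsSubmodel ξ)
      fun i => (xs i).app h.toIsSubmodel ξ) ∈ M := by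
  have := h.subsetOf_fn_mem (ι := ι ⊕ Fin n)
    (P := fun K w => φ.Realize (fun i => w (.inl i)) fun i => w (.inr i))
    ⟨φ.toFormula, fun K w => Language.BoundedFormula.realize_toFormula _ _⟩ (Sum.elim v xs)
  exact this

/-- Łoś's theorem. -/
theorem realize_iff (h : IsMeasureFor κ θ M F) {ι : Type*} [Finite ι] {n : ℕ}
    (φ : setLanguage.BoundedFormula ι n) (v : ι → Fn κ M) (xs : Fin n → Fn κ M) :
    φ.Realize (fun i => h.toUlt (v i)) (fun i => h.toUlt (xs i)) ↔
      subsetOf (fun ξ => φ.Realize (fun i => (v i).app h.toIsSubmodel ξ)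
        fun i => (xs i).app h.toIsSubmodel ξ) ∈ F := by
  have hterm : ∀ {n : ℕ} (t : setLanguage.Term (ι ⊕ Fin n)), ∃ i, t = .var i := by
    intro n t
    cases t with
    | var i => exact ⟨i, rfl⟩
    | func f _ => exact f.elim
  have helim : ∀ {n : ℕ} (xs : Fin n → Fn κ M) (i : ι ⊕ Fin n),
      Sum.elim (fun i => h.toUlt (v i)) (fun i => h.toUlt (xs i)) i =
        h.toUlt (Sum.elim v xs i) := by
    intro n xs i
    cases i <;> rfl
  have helim' : ∀ {n : ℕ} (xs : Fin n → Fn κ M) (i : ι ⊕ Fin n) (ξ : κ.ord.toZFSet),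
      Sum.elim (fun i => (v i).app h.toIsSubmodel ξ)
        (fun i => (xs i).app h.toIsSubmodel ξ) i = (Sum.elim v xs i).app h.toIsSubmodel ξ := by
    intro n xs i ξ
    cases i <;> rfl
  induction φ with
  | falsum =>
    refine ⟨False.elim, fun h' => ?_⟩
    exact (h.exists_of_large h').elim fun _ => id
  | equal t₁ t₂ =>
    obtain ⟨i, rfl⟩ := hterm t₁
    obtain ⟨j, rfl⟩ := hterm t₂
    simp only [Language.BoundedFormula.Realize, Language.Term.realize_var, helim, helim']
    exact Subtype.ext_iff.trans h.collapse_eq_iff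
  | rel r ts =>
    cases r
    obtain ⟨i, hi⟩ := hterm (ts 0)
    obtain ⟨j, hj⟩ := hterm (ts 1)
    have key : ∀ (K : ZFSet.{u}) (w : _ → K) (ys : _ → K),
        (Language.BoundedFormula.rel (L := setLanguage) SetRel.mem ts).Realize w ys ↔
          E (Sum.elim w ys i) (Sum.elim w ys j) := by
      intro K w ys
      change E ((ts 0).realize (Sum.elim w ys)) ((ts 1).realize (Sum.elim w ys)) ↔ _
      rw [hi, hj]
      rfl
    simp only [key, helim, helim']
    exact h.collapse_mem_iff
  | imp φ ψ ih₁ ih₂ =>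
    simp only [Language.BoundedFormula.realize_imp]
    exact (imp_congr (ih₁ xs) (ih₂ xs)).trans (h.large_imp_iff (h.realize_definable φ v xs)
      (h.realize_definable ψ v xs) (h.realize_definable (φ.imp ψ) v xs)).symm
  | @all n φ ih =>
    simp only [Language.BoundedFormula.realize_all]
    have hsnoc : ∀ g : Fn κ M, (Fin.snoc (fun i => h.toUlt (xs i)) (h.toUlt g) :
        Fin (n + 1) → h.ultrapower) =
          fun i => h.toUlt ((Fin.snoc xs g : Fin (n + 1) → Fn κ M) i) := by
      intro g
      ext i
      refine Fin.lastCases ?_ (fun i => ?_) i <;> simp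
    have hsnoc' : ∀ (g : Fn κ M) (ξ : κ.ord.toZFSet),
        (Fin.snoc (fun i => (xs i).app h.toIsSubmodel ξ) (g.app h.toIsSubmodel ξ) :
          Fin (n + 1) → hereditary θ) =
          fun i => ((Fin.snoc xs g : Fin (n + 1) → Fn κ M) i).app h.toIsSubmodel ξ := by
      intro g ξ
      ext i
      refine Fin.lastCases ?_ (fun i => ?_) i <;> simp
    have hall := h.realize_definable φ.all v xs
    simp only [Language.BoundedFormula.realize_all] at hall
    rw [h.toUlt_surjective.forall]
    simp only [hsnoc, ih]
    constructor
    · intro H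
      by_contra hn
      rw [← h.large_not_iff hall] at hn
      -- A function in `M` picks a counterexample wherever there is one, here on a set in `F`; the
      -- assumption `H` for this function says that it picks none on a set in `F`.
      obtain ⟨g, hg⟩ := h.exists_fn_of_fn (ι := ι ⊕ Fin n)
        (P := fun K w y => ¬ φ.Realize (fun i => w (.inl i))
          (Fin.snoc (fun i => w (.inr i)) y : Fin (n + 1) → K)) (.not (by
            refine ⟨(φ.toFormula.relabel fun i : ι ⊕ Fin (n + 1) => i.elim
              (fun i => some (.inl i))
              (Fin.snoc (fun i => some (.inr i)) none : Fin (n + 1) → Option (ι ⊕ Fin n))),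
              fun K w => ?_⟩
            rw [Language.Formula.realize_relabel, Language.BoundedFormula.realize_toFormula]
            refine iff_of_eq (congrArg _ ?_)
            ext i
            refine Fin.lastCases ?_ (fun i => ?_) i <;> simp)) (Sum.elim v xs)
      obtain ⟨ξ, h₁, h₂⟩ := h.exists_of_large (h.large_of
        (R := fun ξ => ¬ φ.Realize (fun i => (v i).app h.toIsSubmodel ξ)
            (fun i => ((Fin.snoc xs g : Fin (n + 1) → Fn κ M) i).app h.toIsSubmodel ξ) ∧
          φ.Realize (fun i => (v i).app h.toIsSubmodel ξ)
            (fun i => ((Fin.snoc xs g : Fin (n + 1) → Fn κ M) i).app h.toIsSubmodel ξ)) (by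
          have := h.realize_definable (φ.not ⊓ φ) v (Fin.snoc xs g)
          simpa only [Language.BoundedFormula.realize_inf,
            Language.BoundedFormula.realize_not] using this) hn (H g) (fun ξ h₁ h₂ => by
          refine ⟨?_, h₂⟩
          rw [← hsnoc']
          exact hg ξ (not_forall.1 h₁)))
      exact h₁ h₂
    · intro H g
      refine h.large_mono (h.realize_definable φ v _) H fun ξ hξ => ?_
      rw [← hsnoc']
      exact hξ _

end IsMeasureFor

/-! ### The ultrapower embedding and its critical point -/

namespace IsMeasureFor

variable {κ θ : Cardinal.{u}} {M F : ZFSet.{u}}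

theorem large_const_iff (h : IsMeasureFor κ θ M F) {p : Prop} :
    subsetOf (fun _ : κ.ord.toZFSet => p) ∈ F ↔ p := by
  refine ⟨fun h' => (h.exists_of_large h').elim fun _ => id, fun hp => ?_⟩
  have h₀ : (0 : Ordinal.{u}).toZFSet ∈ κ.ord.toZFSet :=
    Ordinal.toZFSet_mem_toZFSet_iff.2 (Cardinal.ord_pos.2 h.kreg.pos)
  refine h.large_mono ?_ (h.large_tail ⟨_, h₀⟩) fun _ _ => hp
  have : subsetOf (fun _ : κ.ord.toZFSet => p) = κ.ord.toZFSet := by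
    ext z
    rw [mem_subsetOf]
    exact ⟨fun ⟨h, _⟩ => h, fun h => ⟨h, hp⟩⟩
  rw [this]
  exact h.toZFSet_mem le_rfl

theorem exists_const (h : IsMeasureFor κ θ M F) (x : M) :
    ∃ f : Fn κ M, ∀ ξ, (f.app h.toIsSubmodel ξ : ZFSet.{u}) = x := by
  obtain ⟨g, hg⟩ := h.exists_fn (ι := Unit) (P := fun K w _ y => y = w ()) (.eq _ _)
    (v := fun _ => ⟨x, h.elem.subset x.2⟩) fun _ => x.2
  exact ⟨g, fun ξ => congrArg Subtype.val (hg ξ ⟨_, rfl⟩)⟩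

/-- The constant function with value `x`. -/
def const (h : IsMeasureFor κ θ M F) (x : M) : Fn κ M := (h.exists_const x).choose

theorem const_app (h : IsMeasureFor κ θ M F) (x : M) (ξ : κ.ord.toZFSet) :
    (h.const x).app h.toIsSubmodel ξ = h.elem.incl x :=
  Subtype.ext (((h.exists_const x).choose_spec ξ).trans (h.elem.coe_incl x).symm)

/-- The ultrapower embedding. -/
def ultEmbedding (h : IsMeasureFor κ θ M F) : M ↪ₑ[setLanguage] h.ultrapower where
  toFun x := h.toUlt (h.const x)
  map_formula' n φ x := by
    have h₁ := h.realize_iff φ (fun i => h.const (x i)) Fin.elim0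
    have h₂ := h.elem.incl.map_formula φ x
    rw [← h₂]
    have e₁ : (fun i : Fin 0 => h.toUlt (Fin.elim0 i)) = default := Subsingleton.elim _ _
    have e₂ : ∀ ξ, (fun i : Fin 0 => (Fin.elim0 i : Fn κ M).app h.toIsSubmodel ξ) = default :=
      fun _ => Subsingleton.elim _ _
    simp only [h.const_app, e₁, e₂] at h₁
    rw [h.large_const_iff] at h₁
    exact h₁

/-- The element `y < κ` of `M`. -/
def below (h : IsMeasureFor κ θ M F) (y : κ.ord.toZFSet) : M := ⟨y, h.mem_of_mem y.2⟩

/-- Otherwise each set `{ξ | f ξ ≠ y}` is in `F`, and a point `ξ` of their diagonal intersection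
with `f ξ ∈ ξ` is contradictory for `y = f ξ`. -/
theorem regressive (h : IsMeasureFor κ θ M F) {f : Fn κ M}
    (hf : subsetOf (fun ξ : κ.ord.toZFSet =>
      (f.app h.toIsSubmodel ξ : ZFSet.{u}) ∈ (ξ : ZFSet.{u})) ∈ F) :
    ∃ y : κ.ord.toZFSet, h.eqRel f (h.const (h.below y)) := by
  by_contra! hne
  have hQ : relOn (fun y ξ : κ.ord.toZFSet => ¬ RelIn (f.graph h.toIsSubmodel)
      (inH h.lt ξ) (inH h.lt y)) ∈ M :=
    h.relOn_mem (ι := Unit) (P := fun K w y ξ => ¬ RelIn (w ()) ξ y) (.not (.rel _ _ _))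
      (v := fun _ => f.graph h.toIsSubmodel) fun _ => f.2.1
  have hD := h.large_diag hQ fun y => by
    have := (h.large_not_iff (h.eq_definable _ _)).2 (hne y)
    convert this using 5 with ξ
    rw [f.rel_iff, h.const_app, eq_comm]
    exact iff_of_eq (congrArg _ (Subtype.ext (h.elem.coe_incl (h.below y)).symm))
  obtain ⟨ξ, hξ, hA⟩ := h.normal.1.exists_mem h.kreg.ne_zero (Set.toFinite {_, _}) (by
    rintro A (rfl | rfl)
    · exact hD
    · exact hf)
  obtain ⟨_, h₁⟩ := mem_subsetOf.1 (hA _ (.inl rfl))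
  obtain ⟨_, h₂⟩ := mem_subsetOf.1 (hA _ (.inr rfl))
  have hk := (ZFSet.isOrdinal_toZFSet κ.ord).mem_trans h₂ hξ
  refine h₁ ⟨_, hk⟩ h₂ ?_
  rw [f.rel_iff]
  rfl

theorem exists_id (h : IsMeasureFor κ θ M F) :
    ∃ f : Fn κ M, ∀ ξ, f.app h.toIsSubmodel ξ = inH h.lt ξ := by
  obtain ⟨g, hg⟩ := h.exists_fn (ι := Empty) (P := fun K _ ξ y => y = ξ) (.eq _ _)
    (v := Empty.elim) fun i => i.elim
  exact ⟨g, fun ξ => hg ξ ⟨_, rfl⟩⟩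

/-- A function that represents an element of the constant `y` is regressive on the points above `y`,
so it is constant on a set in `F`; induction on `y` does the rest. -/
theorem collapse_const_below (h : IsMeasureFor κ θ M F) (y : κ.ord.toZFSet) :
    h.collapse (h.const (h.below y)) = y := by
  obtain ⟨y, hy⟩ := y
  induction y using ZFSet.inductionOn with
  | _ y ih =>
    ext z
    rw [h.mem_collapse]
    have hval : ∀ ξ, ((h.const (h.below ⟨y, hy⟩)).app h.toIsSubmodel ξ : ZFSet.{u}) = y :=
      fun ξ => by rw [h.const_app, h.elem.coe_incl]; rfl
    constructor
    · rintro ⟨f, hf, rfl⟩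
      have hlarge : subsetOf (fun ξ : κ.ord.toZFSet =>
          (f.app h.toIsSubmodel ξ : ZFSet.{u}) ∈ (ξ : ZFSet.{u})) ∈ F := by
        obtain ⟨i, hi⟩ := h.exists_id
        have hdef := h.mem_definable f i
        simp only [hi] at hdef
        refine h.large_of hdef hf (h.large_tail ⟨y, hy⟩) fun ξ h₁ h₂ => ?_
        rw [hval] at h₁
        exact ((ZFSet.isOrdinal_toZFSet _).mem ξ.2).mem_trans h₁ h₂
      obtain ⟨x, hx⟩ := h.regressive hlarge
      have hxy : (x : ZFSet.{u}) ∈ y := by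
        obtain ⟨ξ, hξ⟩ := h.exists_of_large (h.memRel_congr_left hx hf)
        rw [hval, h.const_app, h.elem.coe_incl] at hξ
        exact hξ
      rw [h.collapse_eq_iff.2 hx, ih x hxy x.2]
      exact hxy
    · intro hz
      have hzk := (ZFSet.isOrdinal_toZFSet κ.ord).mem_trans hz hy
      refine ⟨h.const (h.below ⟨z, hzk⟩), ?_, ih z hz hzk⟩
      rw [memRel]
      simp only [h.const_app, h.elem.coe_incl]
      exact h.large_const_iff.2 hz

theorem const_mem_iff (h : IsMeasureFor κ θ M F) {f : Fn κ M} (y : κ.ord.toZFSet) :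
    (y : ZFSet.{u}) ∈ h.collapse f ↔
      subsetOf (fun ξ => (y : ZFSet.{u}) ∈ (f.app h.toIsSubmodel ξ : ZFSet.{u})) ∈ F := by
  conv_lhs => rw [← h.collapse_const_below y]
  rw [h.collapse_mem_iff, memRel]
  simp only [h.const_app, h.elem.coe_incl]
  rfl

theorem exists_embedding (h : IsMeasureFor κ θ M F) :
    ∃ (N : ZFSet.{u}) (j : M ↪ₑ[setLanguage] N), N.IsTransitive ∧ IsPowersetPreserving κ j := by
  refine ⟨h.ultrapower, h.ultEmbedding, h.isTransitive_ultrapower, ?_, ?_, ?_⟩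
  · exact fun x hx => h.collapse_const_below ⟨x, hx⟩
  · refine ⟨⟨_, h.toZFSet_mem le_rfl⟩, rfl, fun heq => ?_⟩
    change h.collapse (h.const _) = κ.ord.toZFSet at heq
    -- The identity represents an element of `j(κ)`. If `j(κ) = κ`, this is some `y < κ`; but `y ∈
    -- ξ` for all `ξ` in a tail gives `y ∈ y`.
    obtain ⟨i, hi⟩ := h.exists_id
    have hmem : h.collapse i ∈ h.collapse (h.const ⟨_, h.toZFSet_mem le_rfl⟩) := by
      rw [h.collapse_mem_iff, memRel]
      refine h.large_mono (h.mem_definable _ _) (h.large_const_iff.2 trivial) fun ξ _ => ?_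
      rw [hi, h.const_app, h.elem.coe_incl]
      exact ξ.2
    rw [heq] at hmem
    have h₁ := (h.const_mem_iff (f := i) ⟨_, hmem⟩).2 (by
      simp only [hi]
      exact h.large_tail ⟨_, hmem⟩)
    exact ZFSet.mem_irrefl _ h₁
  · intro A hA
    constructor
    · intro hAM
      -- `A` is represented in the ultrapower by the function `ν ↦ A ∩ ν`.
      obtain ⟨f, hf⟩ := h.exists_fn (ι := Unit)
        (P := fun K w ν y => ∀ z, E z y ↔ E z (w ()) ∧ E z ν)
        (.all (.iff (.mem _ _) (.and (.mem _ _) (.mem _ _))))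
        (v := fun _ => ⟨A, h.elem.subset hAM⟩) fun _ => hAM
      have hf' : ∀ ξ z, z ∈ (f.app h.toIsSubmodel ξ : ZFSet.{u}) ↔
          z ∈ A ∧ z ∈ (ξ : ZFSet.{u}) := by
        intro ξ z
        have := hf ξ ⟨⟨A ∩ ξ, mem_hereditary_of_subset_mem (h.elem.subset hAM)
          fun z hz => (ZFSet.mem_inter.1 hz).1⟩, fun z => ZFSet.mem_inter⟩
        constructor
        · intro hz
          exact (this ⟨z, isTransitive_hereditary θ _ (f.app h.toIsSubmodel ξ).2 hz⟩).1 hz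
        · intro hz
          exact (this ⟨z, isTransitive_hereditary θ _ (h.elem.subset hAM) hz.1⟩).2 hz
      have : h.collapse f = A := by
        ext z
        constructor
        · intro hz
          obtain ⟨g, hg, rfl⟩ := h.mem_collapse.1 hz
          obtain ⟨i, hi⟩ := h.exists_id
          have hdef := h.mem_definable g i
          simp only [hi] at hdef
          obtain ⟨y, hy⟩ := h.regressive (h.large_mono hdef hg fun ξ hξ => ((hf' _ _).1 hξ).2)
          rw [h.collapse_eq_iff.2 hy, h.collapse_const_below]
          obtain ⟨ξ, hξ⟩ := h.exists_of_large (h.memRel_congr_left hy hg)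
          rw [hf', h.const_app, h.elem.coe_incl] at hξ
          exact hξ.1
        · intro hz
          refine (h.const_mem_iff ⟨z, hA hz⟩).2 ?_
          simp only [hf']
          have := h.large_tail ⟨z, hA hz⟩
          convert this using 4
          simp [hz]
      rw [← this]
      exact (h.toUlt f).2
    · intro hAN
      obtain ⟨f, hf⟩ := ZFSet.mem_range.1 hAN
      -- If `f` represents `A`, then `y ∈ A` holds exactly if the row `{ξ | y ∈ f ξ}` is in `F`;
      -- amenability puts the set of these `y` into `M`.
      have hQ : relOn (fun y ξ : κ.ord.toZFSet => ∀ z, RelIn (f.graph h.toIsSubmodel)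
          (inH h.lt ξ) z → E (inH h.lt y) z) ∈ M :=
        h.relOn_mem (ι := Unit) (P := fun K w y ξ => ∀ z, RelIn (w ()) ξ z → E y z)
          (.all (.imp (.rel _ _ _) (.mem _ _)))
          (v := fun _ => f.graph h.toIsSubmodel) fun _ => f.2.1
      simp only [Fn.rel_iff, forall_eq] at hQ
      obtain ⟨B, hBM, hB⟩ := h.amenable _ hQ
      have hAB : A = subsetOf (fun ξ : κ.ord.toZFSet => E (inH h.lt ξ)
          ⟨B, h.elem.subset hBM⟩) := by
        ext y
        rw [mem_subsetOf]
        constructor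
        · intro hy
          refine ⟨hA hy, (hB y (hA hy)).2 ?_⟩
          rw [row_relOn (Q := fun y ξ : κ.ord.toZFSet => E (inH h.lt y)
            (f.app h.toIsSubmodel ξ)) ⟨y, hA hy⟩]
          rw [← hf] at hy
          exact (h.const_mem_iff ⟨y, hf ▸ hA <| hf ▸ hy⟩).1 hy
        · rintro ⟨hyk, hy⟩
          have h₁ := (hB y hyk).1 hy
          rw [row_relOn (Q := fun y ξ : κ.ord.toZFSet => E (inH h.lt y)
            (f.app h.toIsSubmodel ξ)) ⟨y, hyk⟩] at h₁
          rw [← hf]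
          exact (h.const_mem_iff ⟨y, hyk⟩).2 h₁
      rw [hAB]
      exact h.subsetOf_mem (ι := Unit) (P := fun K w ξ => E ξ (w ())) (.mem _ _)
        (v := fun _ => ⟨B, h.elem.subset hBM⟩) fun _ => hBM

end IsMeasureFor

/-! ### Decoding sequences -/

/-- The length of a sequence that is given as a set of ordered pairs. -/
def seqLength (s : ZFSet.{u}) : Ordinal.{u} :=
  sInf {ξ | ∀ y, ZFSet.pair ξ.toZFSet y ∉ s}

/-- The value at `ξ` of a sequence that is given as a set of ordered pairs. -/
def seqValue (s : ZFSet.{u}) (ξ : Ordinal.{u}) : ZFSet.{u} :=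
  ZFSet.sUnion (ZFSet.sep (fun y => ZFSet.pair ξ.toZFSet y ∈ s)
    (ZFSet.sUnion (ZFSet.sUnion s)))

theorem seqLength_seqSet (β : Ordinal.{u}) (f : Ordinal.{u} → ZFSet.{u}) :
    seqLength (seqSet β f) = β := by
  have h : {ξ : Ordinal.{u} | ∀ y, ZFSet.pair ξ.toZFSet y ∉ seqSet β f} = Set.Ici β := by
    ext ξ
    simp only [Set.mem_ofPred_eq, Set.mem_Ici, pair_mem_seqSet, not_and]
    constructor
    · intro h
      by_contra! hξ
      exact h _ hξ rfl
    · exact fun h y hξ => absurd hξ h.not_gt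
  rw [seqLength, h, csInf_Ici]

theorem seqValue_seqSet {β ξ : Ordinal.{u}} (f : Ordinal.{u} → ZFSet.{u}) (hξ : ξ < β) :
    seqValue (seqSet β f) ξ = f ξ := by
  have h : ZFSet.sep (fun y => ZFSet.pair ξ.toZFSet y ∈ seqSet β f)
      (ZFSet.sUnion (ZFSet.sUnion (seqSet β f))) = {f ξ} := by
    ext y
    rw [ZFSet.mem_sep, ZFSet.mem_singleton, pair_mem_seqSet]
    constructor
    · exact fun h => h.2.2
    · rintro rfl
      refine ⟨?_, hξ, rfl⟩
      rw [ZFSet.mem_sUnion]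
      refine ⟨{ξ.toZFSet, f ξ}, ?_, by simp⟩
      rw [ZFSet.mem_sUnion]
      exact ⟨_, pair_mem_seqSet.2 ⟨hξ, rfl⟩, by simp [ZFSet.pair]⟩
  rw [seqValue, h, ZFSet.sUnion_singleton]

theorem FO.realize_snoc {n : ℕ} (φ : setLanguage.BoundedFormula Empty (n + 1)) :
    FO.{u} fun K (v : Option (Fin n) → K) =>
      φ.Realize default (Fin.snoc (fun i => v (some i)) (v none) : Fin (n + 1) → K) := by
  refine ⟨φ.toFormula.relabel fun i : Empty ⊕ Fin (n + 1) => i.elim Empty.elim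
    (Fin.snoc (fun i => some i) none : Fin (n + 1) → Option (Fin n)), fun K w => ?_⟩
  rw [Language.Formula.realize_relabel, Language.BoundedFormula.realize_toFormula]
  refine iff_of_eq (congrArg₂ _ (Subsingleton.elim _ _) ?_)
  ext i
  refine Fin.lastCases ?_ (fun i => ?_) i <;> simp

/-! ### A strategy that plays Skolem hulls -/

section strategy

/-- The generators of the hull which is formed after the models `m` and the filters `f` have been
played. -/
def generators (κ : Cardinal.{u}) (A m f : ZFSet.{u}) : κ.ord.ToType × Fin 5 → ZFSet.{u}
  | (ξ, 0) => (ξ.toOrd : Ordinal.{u}).toZFSet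
  | (_, 1) => κ.ord.toZFSet
  | (_, 2) => A
  -- All initial segments of length less than `κ` are generators, so that the hulls increase with
  -- the stage. At a stage below `κ` the whole history is one of them.
  | (ξ, 3) => seqSet (min ξ.toOrd (seqLength m)) (seqValue m)
  | (ξ, 4) => seqSet (min ξ.toOrd (seqLength m)) fun η => seqValue f η ∩ seqValue m η

/-- The hull which is formed after the models `m` and the filters `f` have been played. -/
def stageHull (κ θ θ' : Cardinal.{u}) (A m f : ZFSet.{u}) : ZFSet.{u} :=
  hull κ (hereditary θ') (hereditary θ) (generators κ A m f)

/-- The challenger plays the intersection of the hull with `H(θ)`. -/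
def hullStrategy (κ θ θ' : Cardinal.{u}) (A : ZFSet.{u}) : Strategy.{u} := fun m f =>
  stageHull κ θ θ' A m f ∩ hereditary θ

theorem exists_toOrd_eq {o β : Ordinal.{u}} (h : β < o) :
    ∃ x : o.ToType, (x.toOrd : Ordinal.{u}) = β :=
  ⟨Ordinal.ToType.mk ⟨β, h⟩, by simp [Ordinal.ToType.toOrd]⟩

variable {κ θ θ' : Cardinal.{u}} {A : ZFSet.{u}} {M F : Ordinal.{u} → ZFSet.{u}}

theorem generators_models (ξ : κ.ord.ToType) (β : Ordinal.{u}) :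
    generators κ A (seqSet β M) (seqSet β F) (ξ, 3) = seqSet (min ξ.toOrd β) M := by
  rw [generators, seqLength_seqSet]
  exact seqSet_congr fun η hη => seqValue_seqSet _ (hη.trans_le (min_le_right _ _))

theorem generators_filters (ξ : κ.ord.ToType) (β : Ordinal.{u}) :
    generators κ A (seqSet β M) (seqSet β F) (ξ, 4) =
      seqSet (min ξ.toOrd β) fun η => F η ∩ M η := by
  rw [generators, seqLength_seqSet]
  refine seqSet_congr fun η hη => ?_
  have := hη.trans_le (min_le_right _ _)
  rw [seqValue_seqSet _ this, seqValue_seqSet _ this]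

/-- The hull at stage `β` of a run. -/
def runHull (κ θ θ' : Cardinal.{u}) (A : ZFSet.{u}) (M F : Ordinal.{u} → ZFSet.{u})
    (β : Ordinal.{u}) : ZFSet.{u} :=
  stageHull κ θ θ' A (seqSet β M) (seqSet β F)

theorem ord_mem_runHull {β ξ : Ordinal.{u}} (hξ : ξ ≤ κ.ord) (hκ : κ ≠ 0) :
    ξ.toZFSet ∈ runHull κ θ θ' A M F β := by
  rcases hξ.lt_or_eq with h | rfl
  · obtain ⟨x, rfl⟩ := exists_toOrd_eq h
    exact mem_hull_of_generator (s := generators κ A (seqSet β M) (seqSet β F)) (x, 0)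
  · obtain ⟨x, -⟩ := exists_toOrd_eq (Cardinal.ord_pos.2 (pos_iff_ne_zero.2 hκ))
    exact mem_hull_of_generator (s := generators κ A (seqSet β M) (seqSet β F)) (x, 1)

theorem mem_runHull {β : Ordinal.{u}} (hκ : κ ≠ 0) : A ∈ runHull κ θ θ' A M F β := by
  obtain ⟨x, -⟩ := exists_toOrd_eq (Cardinal.ord_pos.2 (pos_iff_ne_zero.2 hκ))
  exact mem_hull_of_generator (s := generators κ A (seqSet β M) (seqSet β F)) (x, 2)

theorem models_mem_runHull {ξ β : Ordinal.{u}} (hξ : ξ < κ.ord) (hξβ : ξ ≤ β) :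
    seqSet ξ M ∈ runHull κ θ θ' A M F β := by
  obtain ⟨x, rfl⟩ := exists_toOrd_eq hξ
  have := mem_hull_of_generator (κ := κ) (H₁ := hereditary θ') (H₂ := hereditary θ)
    (s := generators κ A (seqSet β M) (seqSet β F)) (x, 3)
  rwa [generators_models, min_eq_left hξβ] at this

theorem filters_mem_runHull {ξ β : Ordinal.{u}} (hξ : ξ < κ.ord) (hξβ : ξ ≤ β) :
    seqSet ξ (fun η => F η ∩ M η) ∈ runHull κ θ θ' A M F β := by
  obtain ⟨x, rfl⟩ := exists_toOrd_eq hξ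
  have := mem_hull_of_generator (κ := κ) (H₁ := hereditary θ') (H₂ := hereditary θ)
    (s := generators κ A (seqSet β M) (seqSet β F)) (x, 4)
  rwa [generators_filters, min_eq_left hξβ] at this

theorem runHull_mono {ξ β : Ordinal.{u}} (hκ : κ ≠ 0) (hξβ : ξ ≤ β) :
    runHull κ θ θ' A M F ξ ⊆ runHull κ θ θ' A M F β := by
  refine hull_subset_hull ?_
  rintro ⟨x, i⟩
  have hx := x.toOrd.2
  have hmin : min (x.toOrd : Ordinal.{u}) ξ < κ.ord := (min_le_left _ _).trans_lt hx
  have hmin' : min (x.toOrd : Ordinal.{u}) ξ ≤ β := (min_le_right _ _).trans hξβ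
  fin_cases i
  · exact ord_mem_runHull (le_of_lt hx) hκ
  · exact ord_mem_runHull le_rfl hκ
  · exact mem_runHull hκ
  · exact generators_models x ξ ▸ models_mem_runHull hmin hmin'
  · exact generators_filters x ξ ▸ filters_mem_runHull hmin hmin'

theorem card_runHull_le (hκ : Cardinal.aleph0 ≤ κ) (hpow : Cardinal.powerlt κ κ = κ)
    (β : Ordinal.{u}) : (runHull κ θ θ' A M F β).card ≤ κ := by
  refine card_hull_le hκ hpow ?_
  have : Cardinal.mk (κ.ord.ToType × Fin 5) = κ * 5 := by
    simp [Cardinal.mk_prod]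
  rw [this]
  exact Cardinal.mul_le_of_le hκ le_rfl ((Cardinal.natCast_lt_aleph0 (n := 5)).le.trans hκ)

/-- The first `γ` models of a run are played by the strategy `hullStrategy`. -/
structure IsHullRun (κ θ θ' : Cardinal.{u}) (A : ZFSet.{u}) (M F : Ordinal.{u} → ZFSet.{u})
    (γ : Ordinal.{u}) : Prop where
  kreg : κ.IsRegular
  unc : Cardinal.aleph0 < κ
  pow : Cardinal.powerlt κ κ = κ
  reg : θ.IsRegular
  lt : κ < θ
  reg' : θ'.IsRegular
  le : θ ≤ θ'
  subset : A ⊆ κ.ord.toZFSet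
  length_le : γ ≤ κ.ord
  follows : ∀ ξ < γ, M ξ = runHull κ θ θ' A M F ξ ∩ hereditary θ

namespace IsHullRun

variable {γ β ξ : Ordinal.{u}}

theorem lt' (S : IsHullRun κ θ θ' A M F γ) : κ < θ' := S.lt.trans_le S.le

theorem card_le (S : IsHullRun κ θ θ' A M F γ) (hξ : ξ < γ) : (M ξ).card ≤ κ := by
  rw [S.follows ξ hξ]
  exact (ZFSet.card_mono fun x hx => (ZFSet.mem_inter.1 hx).1).trans
    (card_runHull_le S.kreg.aleph0_le S.pow ξ)

theorem model_mem (S : IsHullRun κ θ θ' A M F γ) (hξ : ξ < γ) : M ξ ∈ hereditary θ := by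
  refine mem_hereditary_of_subset S.reg (fun x hx => ?_) ((S.card_le hξ).trans_lt S.lt)
  rw [S.follows ξ hξ] at hx
  exact (ZFSet.mem_inter.1 hx).2

theorem seqSet_models_mem (S : IsHullRun κ θ θ' A M F γ) (hβ : β ≤ γ) :
    seqSet β M ∈ hereditary θ :=
  seqSet_mem_hereditary S.reg ((hβ.trans S.length_le).trans_lt (Cardinal.ord_lt_ord.2 S.lt))
    fun _ hξ => S.model_mem (hξ.trans_le hβ)

theorem filter_mem (S : IsHullRun κ θ θ' A M F γ) (hξ : ξ < γ) : F ξ ∩ M ξ ∈ hereditary θ :=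
  mem_hereditary_of_subset_mem (S.model_mem hξ) fun _ hx => (ZFSet.mem_inter.1 hx).2

theorem seqSet_filters_mem (S : IsHullRun κ θ θ' A M F γ) (hβ : β ≤ γ) :
    seqSet β (fun ξ => F ξ ∩ M ξ) ∈ hereditary θ :=
  seqSet_mem_hereditary S.reg ((hβ.trans S.length_le).trans_lt (Cardinal.ord_lt_ord.2 S.lt))
    fun _ hξ => S.filter_mem (hξ.trans_le hβ)

theorem runHull_subset (S : IsHullRun κ θ θ' A M F γ) (hβ : β ≤ γ) :
    runHull κ θ θ' A M F β ⊆ hereditary θ' := by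
  have hk := toZFSet_mem_hereditary (Cardinal.ord_lt_ord.2 S.lt)
  refine hull_subset_hereditary S.reg S.reg' S.le S.lt' ?_
  rintro ⟨x, i⟩
  refine hereditary_mono S.le ?_
  fin_cases i
  · exact isTransitive_hereditary θ _ hk (Ordinal.toZFSet_mem_toZFSet_iff.2 x.toOrd.2)
  · exact hk
  · exact mem_hereditary_of_subset_mem hk S.subset
  · exact generators_models x β ▸ S.seqSet_models_mem ((min_le_right _ _).trans hβ)
  · exact generators_filters x β ▸ S.seqSet_filters_mem ((min_le_right _ _).trans hβ)

theorem succ_subset (S : IsHullRun κ θ θ' A M F γ) :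
    (Order.succ κ.ord).toZFSet ⊆ runHull κ θ θ' A M F β := fun x hx => by
  obtain ⟨o, ho, rfl⟩ := Ordinal.mem_toZFSet_iff.1 hx
  exact ord_mem_runHull (Order.lt_succ_iff.1 ho) S.kreg.ne_zero

theorem isSubmodel (S : IsHullRun κ θ θ' A M F γ) (hβ : β ≤ γ) :
    IsSubmodel κ θ' (runHull κ θ θ' A M F β) :=
  ⟨S.reg', S.lt', isElemSubmodel_hull (S.runHull_subset hβ), S.succ_subset⟩

theorem succ_subset_hereditary (S : IsHullRun κ θ θ' A M F γ) :
    (Order.succ κ.ord).toZFSet ⊆ hereditary θ := fun x hx => by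
  obtain ⟨o, ho, rfl⟩ := Ordinal.mem_toZFSet_iff.1 hx
  exact toZFSet_mem_hereditary ((Order.lt_succ_iff.1 ho).trans_lt (Cardinal.ord_lt_ord.2 S.lt))

theorem le_card {κ : Cardinal.{u}} {X : ZFSet.{u}} (h : (Order.succ κ.ord).toZFSet ⊆ X) :
    κ ≤ X.card := by
  refine le_trans ?_ (ZFSet.card_mono h)
  rw [Ordinal.card_toZFSet]
  exact Cardinal.ord_le.1 (Order.le_succ _)

theorem challengerLegal (S : IsHullRun κ θ θ' A M F γ) (hβ : β < γ) :
    ChallengerLegal κ θ M F β := by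
  have hsub : (Order.succ κ.ord).toZFSet ⊆ M β := by
    rw [S.follows β hβ]
    exact fun x hx => ZFSet.mem_inter.2 ⟨S.succ_subset hx, S.succ_subset_hereditary hx⟩
  have helem : IsElemSubmodel (M β) (hereditary θ) := by
    rw [S.follows β hβ]
    exact isElemSubmodel_hull_inter
  refine ⟨⟨⟨le_antisymm (S.card_le hβ) (le_card hsub), hsub, ?_⟩, ?_⟩, helem, ?_, ?_, ?_⟩
  · exact helem.modelsZFCMinus S.reg (S.unc.trans S.lt)
  · intro δ hδ f hf
    obtain ⟨g, hg, rfl⟩ := exists_eq_seqSet hf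
    rw [S.follows β hβ] at hg ⊢
    exact ZFSet.mem_inter.2 ⟨seqSet_mem_hull hδ fun ξ hξ => (ZFSet.mem_inter.1 (hg ξ hξ)).1,
      seqSet_mem_hereditary S.reg (hδ.trans (Cardinal.ord_lt_ord.2 S.lt))
        fun ξ hξ => (ZFSet.mem_inter.1 (hg ξ hξ)).2⟩
  · intro ξ hξ x hx
    rw [S.follows ξ (hξ.trans hβ)] at hx
    rw [S.follows β hβ]
    obtain ⟨h₁, h₂⟩ := ZFSet.mem_inter.1 hx
    exact ZFSet.mem_inter.2 ⟨runHull_mono S.kreg.ne_zero hξ.le h₁, h₂⟩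
  · rw [S.follows β hβ]
    exact ZFSet.mem_inter.2 ⟨models_mem_runHull (hβ.trans_le S.length_le) le_rfl,
      S.seqSet_models_mem hβ.le⟩
  · rw [S.follows β hβ]
    exact ZFSet.mem_inter.2 ⟨filters_mem_runHull (hβ.trans_le S.length_le) le_rfl,
      S.seqSet_filters_mem hβ.le⟩

/-- The union of the hulls of a run of length `α`. -/
def limitHull (κ θ θ' α : Cardinal.{u}) (A : ZFSet.{u}) (M F : Ordinal.{u} → ZFSet.{u}) :
    ZFSet.{u} :=
  seqUnion α.ord (runHull κ θ θ' A M F)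

variable {α : Cardinal.{u}}

/-- The stages at which the elements appear have a supremum below the regular `α`, and the hulls
increase. -/
theorem exists_stage (hα : α.IsRegular) (hκ : κ ≠ 0) {ι : Type u} (hι : Cardinal.mk ι < α)
    {f : ι → ZFSet.{u}} (hf : ∀ i, f i ∈ limitHull κ θ θ' α A M F) :
    ∃ δ < α.ord, ∀ i, f i ∈ runHull κ θ θ' A M F δ := by
  choose g hg hgf using fun i => mem_seqUnion.1 (hf i)
  exact ⟨⨆ i, g i, Ordinal.iSup_lt_of_lt_cof (by rwa [hα.cof_ord]) hg,
    fun i => runHull_mono hκ (Ordinal.le_iSup g i) (hgf i)⟩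

/-- Finitely many parameters lie in one stage, which is elementary and contains a witness. -/
theorem isElemSubmodel_limitHull (S : IsHullRun κ θ θ' A M F α.ord) (hα : α.IsRegular) :
    IsElemSubmodel (limitHull κ θ θ' α A M F) (hereditary θ') := by
  refine isElemSubmodel_of_exists (fun x hx => ?_) fun n φ x hx a ha => ?_
  · obtain ⟨ξ, hξ, hx⟩ := mem_seqUnion.1 hx
    exact S.runHull_subset hξ.le hx
  · obtain ⟨δ, hδ, h⟩ := exists_stage (ι := ULift.{u} (Fin n)) hα S.kreg.ne_zero (by
      simpa using (Cardinal.natCast_lt_aleph0 (n := n)).trans_le hα.aleph0_le)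
      (f := fun i => (x i.down : ZFSet.{u})) fun i => hx i.down
    obtain ⟨b, hb, hφ⟩ := (S.isSubmodel hδ.le).elem.exists_mem (ι := Fin n)
      (P := fun K v z => φ.Realize default (Fin.snoc v z : Fin (n + 1) → K))
      (FO.realize_snoc φ) (v := x) (fun i => h ⟨i⟩) ⟨a, ha⟩
    exact ⟨b, mem_seqUnion.2 ⟨δ, hδ, hb⟩, hφ⟩

/-- The values of a short sequence appear in one stage, and each stage is closed under sequences of
length less than `κ`. -/
theorem closedUnderSeq_limitHull (S : IsHullRun κ θ θ' A M F α.ord) (hα : α.IsRegular) :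
    ClosedUnderSeq α (limitHull κ θ θ' α A M F) := by
  intro β hβ f hf
  obtain ⟨g, hg, rfl⟩ := exists_eq_seqSet hf
  obtain ⟨δ, hδ, h⟩ := exists_stage (ι := β.ToType) hα S.kreg.ne_zero (by
    rw [Cardinal.mk_toType]
    exact Cardinal.lt_ord.1 hβ) (f := fun i => g i.toOrd) fun i => hg _ i.toOrd.2
  refine mem_seqUnion.2 ⟨δ, hδ, seqSet_mem_hull (hβ.trans_le S.length_le) fun ξ hξ => ?_⟩
  obtain ⟨x, rfl⟩ := exists_toOrd_eq hξ
  exact h x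

theorem isSubmodel_limitHull (S : IsHullRun κ θ θ' A M F α.ord) (hα : α.IsRegular) :
    IsSubmodel κ θ' (limitHull κ θ θ' α A M F) :=
  ⟨S.reg', S.lt', S.isElemSubmodel_limitHull hα, fun _ hx =>
    mem_seqUnion.2 ⟨0, hα.ord_pos, S.succ_subset hx⟩⟩

theorem card_limitHull (S : IsHullRun κ θ θ' A M F α.ord) (hα : α.IsRegular) :
    (limitHull κ θ θ' α A M F).card = κ := by
  refine le_antisymm ?_ (le_card (S.isSubmodel_limitHull hα).succ_subset)
  have : limitHull κ θ θ' α A M F = ZFSet.iUnion fun x : α.ord.ToType =>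
      runHull κ θ θ' A M F x.toOrd := by
    ext z
    rw [limitHull, mem_seqUnion, ZFSet.mem_iUnion]
    constructor
    · rintro ⟨ξ, hξ, hz⟩
      obtain ⟨x, rfl⟩ := exists_toOrd_eq hξ
      exact ⟨x, hz⟩
    · exact fun ⟨x, hz⟩ => ⟨_, x.toOrd.2, hz⟩
  rw [this]
  refine card_iUnion_le S.kreg.aleph0_le ?_ fun x =>
    card_runHull_le S.kreg.aleph0_le S.pow _
  rw [Cardinal.mk_ord_toType]
  exact Cardinal.ord_le_ord.1 S.length_le

theorem mem_seqUnion_of_mem (S : IsHullRun κ θ θ' A M F γ) {x : ZFSet.{u}}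
    (hx : x ∈ hereditary θ) (h : x ∈ seqUnion γ (runHull κ θ θ' A M F)) : x ∈ seqUnion γ M := by
  obtain ⟨ξ, hξ, h⟩ := mem_seqUnion.1 h
  refine mem_seqUnion.2 ⟨ξ, hξ, ?_⟩
  rw [S.follows ξ hξ]
  exact ZFSet.mem_inter.2 ⟨h, hx⟩

theorem mem_of_subset (S : IsHullRun κ θ θ' A M F γ) {x : ZFSet.{u}}
    (hx : x ⊆ κ.ord.toZFSet) : x ∈ hereditary θ :=
  mem_hereditary_of_subset_mem (toZFSet_mem_hereditary (Cardinal.ord_lt_ord.2 S.lt)) hx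

/-- The hulls exceed the models that were played only outside `H(θ)`, while normality speaks of
subsets of `κ` and `κ`-sequences of them, which are in `H(θ)`. -/
theorem isNormalFor_limitHull (S : IsHullRun κ θ θ' A M F α.ord)
    (h : IsNormalFor κ (seqUnion α.ord M) (seqUnion α.ord F)) :
    IsNormalFor κ (limitHull κ θ θ' α A M F) (seqUnion α.ord F) := by
  refine ⟨h.1, fun B hB => ?_, fun X hX hXF => h.2.2 X (S.mem_seqUnion_of_mem ?_ hX) hXF⟩
  · obtain ⟨hBκ, hB⟩ := ZFSet.mem_inter.1 hB
    exact h.2.1 B (ZFSet.mem_inter.2 ⟨hBκ,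
      S.mem_seqUnion_of_mem (S.mem_of_subset (ZFSet.mem_powerset.1 hBκ)) hB⟩)
  · obtain ⟨g, hg, rfl⟩ := exists_eq_seqSet hXF
    exact seqSet_mem_hereditary S.reg (Cardinal.ord_lt_ord.2 S.lt)
      fun ξ hξ => S.mem_of_subset (ZFSet.mem_powerset.1 (h.1.1 (hg ξ hξ)))

/-- The hull at the successor stage contains the history of the filters, whose last value is this
set. -/
theorem filter_mem_succ (S : IsHullRun κ θ θ' A M F γ) (hξ : Order.succ ξ < γ) :
    F ξ ∩ M ξ ∈ runHull κ θ θ' A M F (Order.succ ξ) := by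
  have hM := S.isSubmodel hξ.le
  have hs := filters_mem_runHull (θ := θ) (θ' := θ') (A := A) (M := M) (F := F)
    (hξ.trans_le S.length_le) le_rfl
  have hξ' : ξ < γ := (Order.lt_succ ξ).trans hξ
  have hξM : ξ.toZFSet ∈ runHull κ θ θ' A M F (Order.succ ξ) :=
    hM.toZFSet_mem (hξ'.le.trans S.length_le)
  have hx : F ξ ∩ M ξ ∈ hereditary θ' := hereditary_mono S.le (S.filter_mem hξ')
  obtain ⟨s, hsv⟩ : ∃ s : hereditary θ',
      (s : ZFSet.{u}) = seqSet (Order.succ ξ) fun η => F η ∩ M η := ⟨⟨_, hM.elem.subset hs⟩, rfl⟩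
  obtain ⟨z, hzv⟩ : ∃ z : hereditary θ', (z : ZFSet.{u}) = ξ.toZFSet :=
    ⟨⟨_, hM.elem.subset hξM⟩, rfl⟩
  have key : ∀ y : hereditary θ', RelIn s z y ↔ (y : ZFSet.{u}) = F ξ ∩ M ξ := fun y => by
    rw [relIn_iff (isTransitive_hereditary θ'), hsv, hzv,
      pair_mem_seqSet (f := fun η => F η ∩ M η), and_iff_right (Order.lt_succ ξ)]
  rw [← hsv] at hs
  rw [← hzv] at hξM
  exact hM.elem.mem_of_unique (ι := Bool) (P := fun K v y => RelIn (v true) (v false) y)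
    (x := ⟨_, hx⟩) (.rel _ _ _) (v := fun b => cond b s z) (Bool.forall_bool.2 ⟨hξM, hs⟩)
    ((key _).2 rfl) fun y hy => Subtype.ext ((key y).1 hy)

theorem row_mem {κ θ : Cardinal.{u}} {M R : ZFSet.{u}} (hM : IsSubmodel κ θ M) (hR : R ∈ M)
    (η : κ.ord.toZFSet) : row κ.ord.toZFSet R η ∈ M := by
  have := hM.subsetOf_mem (ι := Bool) (P := fun K v ν => RelIn (v true) (v false) ν)
    (.rel _ _ _) (v := fun b => cond b ⟨R, hM.elem.subset hR⟩ (inH hM.lt η)) (Bool.forall_bool.2 ⟨hM.mem_of_mem η.2, hR⟩)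
  convert this using 1
  ext ν
  simp only [cond_true, cond_false, relIn_iff (isTransitive_hereditary θ), row, ZFSet.mem_sep,
    mem_subsetOf]
  exact ⟨fun ⟨h, h'⟩ => ⟨h, h'⟩, fun ⟨h, h'⟩ => ⟨h, h'⟩⟩

/-- The source of amenability. The rows are subsets of `κ` in the hull at `ξ`, so `M ξ` contains
them, and the next hull can separate the indices by `F ξ ∩ M ξ`. -/
theorem exists_rows (S : IsHullRun κ θ θ' A M F γ) (hξ : Order.succ ξ < γ) {R : ZFSet.{u}}
    (hR : R ∈ runHull κ θ θ' A M F ξ) :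
    ∃ B ∈ runHull κ θ θ' A M F (Order.succ ξ), ∀ η ∈ κ.ord.toZFSet,
      row κ.ord.toZFSet R η ∈ M ξ ∧ (η ∈ B ↔ row κ.ord.toZFSet R η ∈ F ξ) := by
  have hξ' : ξ < γ := (Order.lt_succ ξ).trans hξ
  have hM := S.isSubmodel hξ.le
  have hF := S.filter_mem_succ hξ
  have hR' := runHull_mono S.kreg.ne_zero (Order.le_succ ξ) hR
  have hrow : ∀ η ∈ κ.ord.toZFSet, row κ.ord.toZFSet R η ∈ M ξ := fun η hη => by
    rw [S.follows ξ hξ']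
    exact ZFSet.mem_inter.2 ⟨row_mem (S.isSubmodel hξ'.le) hR ⟨η, hη⟩,
      S.mem_of_subset ZFSet.sep_subset⟩
  have := hM.subsetOf_mem (ι := Fin 3) (P := fun K v η => ∃ r, (∀ ν, E ν r ↔ E ν (v 0) ∧
    RelIn (v 1) η ν) ∧ E r (v 2))
    (.ex (.and (.all (.iff (.mem _ _) (.and (.mem _ _) (.rel _ _ _)))) (.mem _ _)))
    (v := ![kH S.lt', ⟨R, hM.elem.subset hR'⟩, ⟨_, hM.elem.subset hF⟩]) (by
      intro i
      fin_cases i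
      · exact hM.toZFSet_mem le_rfl
      · exact hR'
      · exact hF)
  refine ⟨_, this, fun η hη => ⟨hrow η hη, ?_⟩⟩
  rw [mem_subsetOf]
  have hrowH : row κ.ord.toZFSet R η ∈ hereditary θ' :=
    hereditary_mono S.le (S.mem_of_subset ZFSet.sep_subset)
  constructor
  · rintro ⟨h₀, r, hr, hrF⟩
    have : (r : ZFSet.{u}) = row κ.ord.toZFSet R η := by
      ext ν
      rw [row, ZFSet.mem_sep]
      constructor
      · intro hν
        have := (hr ⟨ν, isTransitive_hereditary θ' _ r.2 hν⟩).1 hν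
        rw [relIn_iff (isTransitive_hereditary θ')] at this
        exact this
      · rintro ⟨hν, hν'⟩
        refine (hr (inH S.lt' ⟨ν, hν⟩)).2 ⟨hν, ?_⟩
        rw [relIn_iff (isTransitive_hereditary θ')]
        exact hν'
    rw [← this]
    exact (ZFSet.mem_inter.1 hrF).1
  · intro h
    refine ⟨hη, ⟨_, hrowH⟩, fun ν => ?_, ZFSet.mem_inter.2 ⟨h, hrow η hη⟩⟩
    rw [relIn_iff (isTransitive_hereditary θ')]
    change (ν : ZFSet.{u}) ∈ row κ.ord.toZFSet R η ↔ _
    rw [row, ZFSet.mem_sep]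
    exact Iff.rfl

theorem isMeasureFor_limitHull (S : IsHullRun κ θ θ' A M F α.ord) (hα : α.IsRegular)
    (hα₀ : Cardinal.aleph0 < α) (hJ : ∀ ξ < α.ord, JudgeLegal κ M F ξ)
    (h : IsNormalFor κ (seqUnion α.ord M) (seqUnion α.ord F)) :
    IsMeasureFor κ θ' (limitHull κ θ θ' α A M F) (seqUnion α.ord F) where
  toIsSubmodel := S.isSubmodel_limitHull hα
  kreg := S.kreg
  unc := S.unc
  closed g hg := S.closedUnderSeq_limitHull hα Ordinal.omega0 (by
    rw [← Cardinal.ord_aleph0]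
    exact Cardinal.ord_lt_ord.2 hα₀) _ (seqSet_mem_funs hg)
  normal := S.isNormalFor_limitHull h
  amenable R hR := by
    obtain ⟨ξ, hξ, hR⟩ := mem_seqUnion.1 hR
    have hξ' : Order.succ ξ < α.ord := (Cardinal.isSuccLimit_ord hα.aleph0_le).succ_lt hξ
    obtain ⟨B, hB, hBF⟩ := S.exists_rows hξ' hR
    refine ⟨B, mem_seqUnion.2 ⟨_, hξ', hB⟩, fun η hη => ?_⟩
    obtain ⟨hM, hηB⟩ := hBF η hη
    rw [hηB]
    refine ⟨fun hF => mem_seqUnion.2 ⟨ξ, hξ, hF⟩, fun hF => ?_⟩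
    -- Later filters add no row: otherwise `F ξ` has the complement of the row, and the union of the
    -- filters has two disjoint elements.
    refine ((hJ ξ hξ).measures _ (ZFSet.mem_inter.2
      ⟨ZFSet.mem_powerset.2 ZFSet.sep_subset, hM⟩)).resolve_right fun hF' => ?_
    obtain ⟨ν, -, hν⟩ := h.1.exists_mem S.kreg.ne_zero
      (s := {row κ.ord.toZFSet R η, κ.ord.toZFSet \ row κ.ord.toZFSet R η}) (by simp) (by
        rintro X (rfl | rfl)
        · exact hF
        · exact mem_seqUnion.2 ⟨ξ, hξ, hF'⟩)
    exact (ZFSet.mem_sdiff.1 (hν _ (.inr rfl))).2 (hν _ (.inl rfl))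

end IsHullRun

end strategy

/-! ### The filter property implies the Ramsey property -/

theorem isRamsey_of_filterProperty {α κ θ : Cardinal.{u}} (hα : α.IsRegular)
    (hα₀ : Cardinal.aleph0 < α) (hκ : κ.IsRegular) (hακ : α ≤ κ) (hθ : θ.IsRegular)
    (hκθ : κ < θ) (hpow : Cardinal.powerlt κ κ = κ) (h : FilterProperty κ θ α.ord) :
    IsRamsey α κ := by
  intro μ
  have hreg : (Order.succ (max μ θ)).IsRegular :=
    Cardinal.isRegular_succ (hθ.aleph0_le.trans (le_max_right _ _))
  refine ⟨_, (le_max_left μ θ).trans (Order.le_succ _), hreg, fun A hA => ?_⟩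
  have hlen : α.ord ≤ κ.ord := Cardinal.ord_le_ord.2 hακ
  have hrun : ∀ {M F : Ordinal.{u} → ZFSet.{u}} {γ : Ordinal.{u}}, γ ≤ κ.ord →
      (∀ ξ < γ, FollowsAt (hullStrategy κ θ (Order.succ (max μ θ)) A) M F ξ) →
      IsHullRun κ θ (Order.succ (max μ θ)) A M F γ := fun hγ hf =>
    ⟨hκ, hα₀.trans_le hακ, hpow, hθ, hκθ, hreg, (le_max_right μ θ).trans (Order.le_succ _), hA,
      hγ, hf⟩
  by_contra hno
  -- If no model works for `A`, the hull strategy wins: its moves are legal, and a run that the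
  -- judge wins would yield such a model. Legality at stage `β` is read off from the run of length
  -- `β + 1`.
  refine h ⟨hullStrategy κ θ (Order.succ (max μ θ)) A, fun M F => ⟨fun β hβ hf _ => ?_,
    fun hf hJ hnormal => hno ?_⟩⟩
  · exact (hrun (Order.succ_le_of_lt (hβ.trans_le hlen))
      fun ξ hξ => hf ξ (Order.lt_succ_iff.1 hξ)).challengerLegal (Order.lt_succ β)
  · have S := hrun hlen hf
    have hmeas := S.isMeasureFor_limitHull hα hα₀ hJ hnormal
    obtain ⟨N, j, hN, hj⟩ := hmeas.exists_embedding
    refine ⟨_, mem_seqUnion.2 ⟨0, hα.ord_pos, mem_runHull hκ.ne_zero⟩,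
      ⟨S.card_limitHull hα, hmeas.succ_subset, hmeas.elem.modelsZFCMinus hreg
        (S.unc.trans S.lt')⟩, hmeas.elem, S.closedUnderSeq_limitHull hα, N, j, hN, hj⟩

/-! ### Separation as a first-order sentence -/

/-- The parameters are quantified, so the sentence passes from `M` to `N` also for parameters
outside the range of `j`. -/
theorem FO.separation {ι : Type*} [Finite ι] {P : ∀ K : ZFSet.{u}, (ι → K) → K → Prop}
    (hP : FO fun K (v : Option ι → K) => P K (fun i => v (some i)) (v none)) :
    FO fun K (_ : Empty → K) => ∀ v : ι → K, ∀ a : K, ∃ b : K, ∀ z, E z b ↔ E z a ∧ P K v z :=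
  .allTuple (.all (.ex (.all (.iff (.mem _ _) (.and (.mem _ _)
    (hP.relabel fun o : Option ι => o.elim none fun i => some (some (some (Sum.inr i)))))))))

theorem IsElemSubmodel.exists_sep {θ : Cardinal.{u}} {M : ZFSet.{u}}
    (hM : IsElemSubmodel M (hereditary θ)) {ι : Type*} [Finite ι]
    {P : ∀ K : ZFSet.{u}, (ι → K) → K → Prop}
    (hP : FO fun K (v : Option ι → K) => P K (fun i => v (some i)) (v none)) (v : ι → M) (a : M) :
    ∃ b : M, ∀ z, E z b ↔ E z a ∧ P M v z :=
  (hP.separation.transfer hM.incl Empty.elim).2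
    (fun v a => separation_hereditary {z | P _ v z} a) v a

/-! ### Powerset preserving embeddings of elementary submodels of `H(θ)` -/

/-- `j` is a `κ`-powerset preserving embedding of an elementary submodel of `H(θ)` that
includes `κ + 1` into a transitive set. -/
structure IsRamseyEmbedding (κ θ : Cardinal.{u}) {M N : ZFSet.{u}}
    (j : M ↪ₑ[setLanguage] N) : Prop extends IsSubmodel κ θ M where
  trans : N.IsTransitive
  pres : IsPowersetPreserving κ j

/-- The choice `A = ∅` suffices, since everything else that `M` must contain is found by
elementarity. -/
theorem IsRamsey.exists_embedding {α κ : Cardinal.{u}} (h : IsRamsey α κ) (μ : Cardinal.{u}) :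
    ∃ θ, μ ≤ θ ∧ ∃ (M N : ZFSet.{u}) (j : M ↪ₑ[setLanguage] N),
      IsRamseyEmbedding κ θ j ∧ ClosedUnderSeq α M := by
  obtain ⟨θ, hθ, hreg, h⟩ := h (max μ (Order.succ κ))
  obtain ⟨M, -, hM, helem, hcl, N, j, hN, hj⟩ := h ∅ (ZFSet.empty_subset _)
  exact ⟨θ, (le_max_left _ _).trans hθ, M, N, j, ⟨⟨hreg, (Order.lt_succ κ).trans_le
    ((le_max_right _ _).trans hθ), helem, hM.succ_subset⟩, hN, hj⟩, hcl⟩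

namespace IsRamseyEmbedding

variable {κ θ : Cardinal.{u}} {M N : ZFSet.{u}} {j : M ↪ₑ[setLanguage] N}

/-- The cardinal `κ` as an element of `M`. -/
def kM (W : IsRamseyEmbedding κ θ j) : M := ⟨κ.ord.toZFSet, W.toZFSet_mem le_rfl⟩

theorem fix (W : IsRamseyEmbedding κ θ j) {x : M} (hx : E x W.kM) :
    (j x : ZFSet.{u}) = x :=
  W.pres.fixes_below x hx

theorem mem_iff (j : M ↪ₑ[setLanguage] N) (x y : M) : E (j x) (j y) ↔ E x y :=
  ((FO.mem true false).transfer j fun b => cond b x y).symm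

theorem subset_image (W : IsRamseyEmbedding κ θ j) :
    κ.ord.toZFSet ⊆ (j W.kM : ZFSet.{u}) := fun x hx => by
  have h := (mem_iff j ⟨x, W.mem_of_mem hx⟩ W.kM).2 hx
  rwa [E, W.fix (x := ⟨x, W.mem_of_mem hx⟩) hx] at h

theorem isOrdinal_image (W : IsRamseyEmbedding κ θ j) : (j W.kM : ZFSet.{u}).IsOrdinal := by
  have hk : κ.ord.toZFSet.IsOrdinal := ZFSet.isOrdinal_toZFSet _
  have h : FO.{u} fun _ v => (∀ x, E x (v ()) → ∀ y, E y x → E y (v ())) ∧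
      ∀ x y z, E z (v ()) → E x y → E y z → E x z :=
    .and (.all (.imp (.mem _ _) (.all (.imp (.mem _ _) (.mem _ _)))))
      (.all (.all (.all (.imp (.mem _ _) (.imp (.mem _ _) (.imp (.mem _ _) (.mem _ _)))))))
  obtain ⟨h₁, h₂⟩ := (h.transfer j fun _ => W.kM).1
    ⟨fun x hx y hy => hk.isTransitive _ hx hy, fun x y z hz hx hy =>
      (hk.mem hz).mem_trans hx hy⟩
  have hj : ∀ {x : ZFSet.{u}}, x ∈ (j W.kM : ZFSet.{u}) → x ∈ N := fun hx =>
    W.trans _ (j W.kM).2 hx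
  refine ⟨fun x hx y hy => h₁ ⟨x, hj hx⟩ hx ⟨y, W.trans _ (hj hx) hy⟩ hy, ?_⟩
  intro x y z hx hy hz
  exact h₂ ⟨x, W.trans _ (W.trans _ (hj hz) hy) hx⟩ ⟨y, W.trans _ (hj hz) hy⟩ ⟨z, hj hz⟩ hz hx hy

/-- `j(κ)` is an ordinal that includes `κ` and differs from it. -/
theorem kappa_mem_image (W : IsRamseyEmbedding κ θ j) :
    κ.ord.toZFSet ∈ (j W.kM : ZFSet.{u}) := by
  rcases (ZFSet.isOrdinal_toZFSet κ.ord).mem_trichotomous W.isOrdinal_image with h | h | h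
  · exact h
  · obtain ⟨x, hx, hne⟩ := W.pres.moves
    obtain rfl : x = W.kM := Subtype.ext hx
    exact absurd h.symm hne
  · exact absurd (W.subset_image h) (ZFSet.mem_irrefl _)

/-- The cardinal `κ` as an element of `N`. -/
def kN (W : IsRamseyEmbedding κ θ j) : N :=
  ⟨κ.ord.toZFSet, W.trans _ (j W.kM).2 W.kappa_mem_image⟩

theorem image_mem_kN (W : IsRamseyEmbedding κ θ j) {x : M} (hx : E x W.kM) :
    E (j x) W.kN := by
  rw [E, W.fix hx]
  exact hx

theorem exists_of_mem_kN (W : IsRamseyEmbedding κ θ j) {y : N} (hy : E y W.kN) :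
    ∃ x : M, E x W.kM ∧ j x = y :=
  ⟨⟨y, W.mem_of_mem hy⟩, hy, Subtype.ext (W.fix (x := ⟨y, W.mem_of_mem hy⟩) hy)⟩

/-- A set in `M` of elements of `κ` which is given by a first-order property `P` belongs to the
ultrafilter derived from `j` if and only if `κ` has the property `P` in `N`. -/
theorem kN_mem_image_iff (W : IsRamseyEmbedding κ θ j) {ι : Type*}
    {P : ∀ K : ZFSet.{u}, (ι → K) → K → Prop}
    (hP : FO fun K (v : Option ι → K) => P K (fun i => v (some i)) (v none)) {v : ι → M} {B : M}
    (hB : ∀ z, E z B ↔ E z W.kM ∧ P M v z) :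
    E W.kN (j B) ↔ P N (fun i => j (v i)) W.kN := by
  have h : FO fun K (w : Option (Option ι) → K) =>
      ∀ z, E z (w none) ↔ E z (w (some none)) ∧ P K (fun i => w (some (some i))) z :=
    .all (.iff (.mem _ _) (.and (.mem _ _)
      (hP.relabel fun o : Option ι => o.elim none fun i => some (some (some i)))))
  have : E W.kN (j B) ↔ E W.kN (j W.kM) ∧ P N (fun i => j (v i)) W.kN :=
    (h.transfer j fun o => o.elim B fun o => o.elim W.kM v).1 hB W.kN
  rw [this, and_iff_right (show E W.kN (j W.kM) from W.kappa_mem_image)]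

/-- The subsets of `κ` that are definable in `N` belong to `M`. -/
theorem exists_subset (W : IsRamseyEmbedding κ θ j) {ι : Type*} [Finite ι]
    {P : ∀ K : ZFSet.{u}, (ι → K) → K → Prop}
    (hP : FO fun K (v : Option ι → K) => P K (fun i => v (some i)) (v none)) (v : ι → N) :
    ∃ S : M, (∀ z, E z S → E z W.kM) ∧ ∀ z, E z W.kM → (E z S ↔ P N v (j z)) := by
  have hM : ∀ w : ι → M, ∀ a : M, ∃ b : M, ∀ z, E z b ↔ E z a ∧ P M w z :=
    fun w a => W.elem.exists_sep hP w a
  -- Separation in `N` produces the subset of `κ`, and powerset preservation returns it to `M`.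
  obtain ⟨S, hS⟩ := (hP.separation.transfer j Empty.elim).1 hM v W.kN
  have hSk : (S : ZFSet.{u}) ⊆ κ.ord.toZFSet := fun z hz =>
    ((hS ⟨z, W.trans _ S.2 hz⟩).1 hz).1
  refine ⟨⟨S, (W.pres.same_subsets S hSk).2 S.2⟩, fun z hz => hSk hz, fun z hz => ?_⟩
  have := hS (j z)
  rw [and_iff_right (W.image_mem_kN hz), E, W.fix hz] at this
  exact this

/-- If `κ` carries a powerset preserving embedding, then it is a strong limit cardinal. -/
theorem isStrongPrelimit (W : IsRamseyEmbedding κ θ j) : κ.IsStrongPrelimit := by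
  by_contra hno
  rw [Cardinal.not_isStrongPrelimit_iff] at hno
  -- If `μ < κ ≤ 2^μ`, some `X ∈ M` has `κ` many rows that differ on `μ`. The row of `κ` in `j(X)`,
  -- cut to `κ`, is some `y ∈ M`. By elementarity `y` agrees on `μ` with the row of some `x < κ` in
  -- `X`. Then the rows of `x` and `κ` in `j(X)` agree on `μ`, against elementarity.
  obtain ⟨μ, hμ, hκ⟩ := hno
  have hμκ : μ.ord.toZFSet ∈ κ.ord.toZFSet :=
    Ordinal.toZFSet_mem_toZFSet_iff.2 (Cardinal.ord_lt_ord.2 hμ)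
  let m : M := ⟨μ.ord.toZFSet, W.mem_of_mem hμκ⟩
  have hm : E m W.kM := hμκ
  -- a relation with pairwise distinct rows
  have hex : ∃ X : M, ∀ x y, E x W.kM → E y W.kM → x ≠ y →
      ∃ z, E z m ∧ ¬ (RelIn X x z ↔ RelIn X y z) := by
    have hFO : FO.{u} fun K (v : Option Bool → K) => ∀ x y, E x (v (some true)) →
        E y (v (some true)) → x ≠ y →
        ∃ z, E z (v (some false)) ∧ ¬ (RelIn (v none) x z ↔ RelIn (v none) y z) :=
      .all (.all (.imp (.mem _ _) (.imp (.mem _ _) (.imp (.not (.eq _ _)) (.ex (.and (.mem _ _)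
        (.not (.iff (.rel _ _ _) (.rel _ _ _)))))))))
    let v : Bool → M := fun b => cond b W.kM m
    refine (hFO.ex (P := fun K (v : Bool → K) X => ∀ x y, E x (v true) →
      E y (v true) → x ≠ y →
      ∃ z, E z (v false) ∧ ¬ (RelIn X x z ↔ RelIn X y z))
      |>.transfer W.elem.incl v).2 ?_
    have hinj : Nonempty (κ.ord.ToType ↪ Set μ.ord.ToType) := by
      rw [← Cardinal.le_def, Cardinal.mk_set, Cardinal.mk_ord_toType, Cardinal.mk_ord_toType]
      exact hκ
    obtain ⟨f⟩ := hinj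
    have hmH : μ.ord.toZFSet ∈ hereditary θ := W.elem.subset m.2
    have hkH : κ.ord.toZFSet ∈ hereditary θ := W.elem.subset W.kM.2
    let Q : κ.ord.toZFSet → κ.ord.toZFSet → Prop := fun a b =>
      ∃ (x : κ.ord.ToType) (y : μ.ord.ToType), (a : ZFSet.{u}) = (x.toOrd : Ordinal.{u}).toZFSet ∧
        (b : ZFSet.{u}) = (y.toOrd : Ordinal.{u}).toZFSet ∧ y ∈ f x
    have hinj' : ∀ {o : Ordinal.{u}} {x y : o.ToType}, (x.toOrd : Ordinal.{u}).toZFSet =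
        (y.toOrd : Ordinal.{u}).toZFSet → x = y := fun h =>
      Ordinal.ToType.mk.symm.injective (Subtype.ext (Ordinal.toZFSet_injective h))
    refine ⟨⟨relOn Q, relOn_mem_hereditary W.reg hkH⟩, fun a b ha hb hab => ?_⟩
    have hv : ((W.elem.incl (v true) : hereditary θ) : ZFSet.{u}) = κ.ord.toZFSet :=
      W.elem.coe_incl _
    have hv' : ((W.elem.incl (v false) : hereditary θ) : ZFSet.{u}) = μ.ord.toZFSet :=
      W.elem.coe_incl _
    rw [E, hv] at ha hb
    obtain ⟨o, ho, hoa⟩ := Ordinal.mem_toZFSet_iff.1 ha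
    obtain ⟨o', ho', hob⟩ := Ordinal.mem_toZFSet_iff.1 hb
    obtain ⟨x, rfl⟩ := exists_toOrd_eq ho
    obtain ⟨x', rfl⟩ := exists_toOrd_eq ho'
    have hne : f x ≠ f x' := fun h => hab (Subtype.ext (by rw [← hoa, ← hob, f.injective h]))
    have hrow : ∀ (c : hereditary θ) (w : κ.ord.ToType) (y : μ.ord.ToType) (hy : _),
        (w.toOrd : Ordinal.{u}).toZFSet = c →
        (RelIn (⟨relOn Q, relOn_mem_hereditary W.reg hkH⟩ : hereditary θ) c
          ⟨(y.toOrd : Ordinal.{u}).toZFSet, hy⟩ ↔ y ∈ f w) := by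
      intro c w y hy hc
      rw [relIn_iff (isTransitive_hereditary θ)]
      have hyκ : (y.toOrd : Ordinal.{u}).toZFSet ∈ κ.ord.toZFSet :=
        Ordinal.toZFSet_mem_toZFSet_iff.2 (y.toOrd.2.trans (Cardinal.ord_lt_ord.2 hμ))
      have hcκ : (c : ZFSet.{u}) ∈ κ.ord.toZFSet :=
        hc ▸ Ordinal.toZFSet_mem_toZFSet_iff.2 w.toOrd.2
      refine (pair_mem_relOn (Q := Q) (a := ⟨c, hcκ⟩) (b := ⟨_, hyκ⟩)).trans ?_
      constructor
      · rintro ⟨w', y', hw, hy', h⟩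
        rw [hinj' (hc.trans hw), hinj' hy']
        exact h
      · exact fun h => ⟨w, y, hc.symm, rfl, h⟩
    obtain ⟨y, hy⟩ : ∃ y, ¬ (y ∈ f x ↔ y ∈ f x') := by
      by_contra! h
      exact hne (Set.ext h)
    have hyH : (y.toOrd : Ordinal.{u}).toZFSet ∈ μ.ord.toZFSet :=
      Ordinal.toZFSet_mem_toZFSet_iff.2 y.toOrd.2
    refine ⟨⟨_, isTransitive_hereditary θ _ hmH hyH⟩, ?_, ?_⟩
    · rw [E, hv']
      exact hyH
    · rwa [hrow a x y _ hoa, hrow b x' y _ hob]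
  obtain ⟨X, hX⟩ := hex
  obtain ⟨y, -, hy⟩ := W.exists_subset (ι := Bool) (P := fun K v z => RelIn (v true) (v false) z)
    (.rel _ _ _) (fun b => cond b (j X) W.kN)
  simp only [cond_true, cond_false] at hy
  have hmk : ∀ {z : M}, E z m → E z W.kM := fun hz =>
    (ZFSet.isOrdinal_toZFSet κ.ord).isTransitive _ hμκ hz
  have hmN : ∀ {z : N}, E z (j m) → ∃ x : M, E x m ∧ j x = z := fun {z} hz => by
    have hz' : (z : ZFSet.{u}) ∈ μ.ord.toZFSet := by rwa [E, W.fix hm] at hz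
    have hzk : E z W.kN := (ZFSet.isOrdinal_toZFSet κ.ord).isTransitive _ hμκ hz'
    obtain ⟨x, hx, rfl⟩ := W.exists_of_mem_kN hzk
    refine ⟨x, ?_, rfl⟩
    rwa [W.fix hx] at hz'
  -- the row of `κ` in the image of the relation is already a row below `κ`
  have hcell : ∀ z, E z (j m) → (E z (j y) ↔ RelIn (j X) W.kN z) := fun z hz => by
    obtain ⟨z, hz', rfl⟩ := hmN hz
    exact (mem_iff j z y).trans (hy z (hmk hz'))
  have hrow : FO.{u} fun K (v : Fin 4 → K) => ∃ x, E x (v 0) ∧ ∀ z, E z (v 1) →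
      (E z (v 2) ↔ RelIn (v 3) x z) :=
    .ex (.and (.mem _ _) (.all (.imp (.mem _ _) (.iff (.mem _ _) (.rel _ _ _)))))
  obtain ⟨x, hx, hxy⟩ := (hrow.transfer j ![W.kM, m, y, X]).2
    ⟨W.kN, W.kappa_mem_image, hcell⟩
  have hdist : FO.{u} fun K (v : Fin 3 → K) => ∀ x y, E x (v 0) → E y (v 0) → x ≠ y →
      ∃ z, E z (v 1) ∧ ¬ (RelIn (v 2) x z ↔ RelIn (v 2) y z) :=
    .all (.all (.imp (.mem _ _) (.imp (.mem _ _) (.imp (.not (.eq _ _)) (.ex (.and (.mem _ _)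
      (.not (.iff (.rel _ _ _) (.rel _ _ _)))))))))
  obtain ⟨z, hz, hne⟩ := (hdist.transfer j ![W.kM, m, X]).1 hX (j x) W.kN
    ((mem_iff j _ _).2 hx) W.kappa_mem_image fun h => by
      have := W.image_mem_kN hx
      rw [h] at this
      exact ZFSet.mem_irrefl _ this
  obtain ⟨z, hz', rfl⟩ := hmN hz
  have h₁ : E z y ↔ RelIn X x z := hxy z hz'
  have h₂ : E z y ↔ RelIn (j X) W.kN (j z) := hy z (hmk hz')
  have h₃ := (FO.rel (0 : Fin 3) 1 2).transfer j ![X, x, z]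
  exact hne (h₃.symm.trans (h₁.symm.trans h₂))

end IsRamseyEmbedding

/-- A function from `X` to `K` is determined by its graph, a subset of `X × K` of size less than
`κ`; a regular strong limit `κ` has only `κ` many subsets of smaller size. -/
theorem powerlt_self_of_isStrongPrelimit {κ : Cardinal.{u}} (hκ : κ.IsRegular)
    (h : κ.IsStrongPrelimit) : Cardinal.powerlt κ κ = κ := by
  refine le_antisymm (Cardinal.powerlt_le.2 fun μ hμ => ?_) ?_
  · induction κ using Cardinal.inductionOn with | _ K
    induction μ using Cardinal.inductionOn with | _ X
    rcases isEmpty_or_nonempty X with hX | hX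
    · simpa using Cardinal.one_le_aleph0.trans hκ.aleph0_le
    · have hXK : Cardinal.mk (X × K) = Cardinal.mk K := by
        rw [← Cardinal.mul_def]
        exact Cardinal.mul_eq_right hκ.aleph0_le hμ.le (Cardinal.mk_ne_zero X)
      rw [← hXK] at h hκ
      rw [Cardinal.power_def]
      conv_rhs => rw [← hXK, ← Cardinal.mk_subset_mk_lt_cof h]
      refine Cardinal.mk_le_of_injective (f := fun f : X → K =>
        ⟨Set.range fun x => (x, f x), ?_⟩) fun f g hfg => ?_
      · rw [hκ.cof_ord, hXK]
        exact Cardinal.mk_range_le.trans_lt hμ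
      · funext x
        have hx : (x, f x) ∈ Set.range fun x => (x, g x) := by
          rw [← show (Set.range fun x => (x, f x)) = Set.range fun x => (x, g x) from
            congrArg Subtype.val hfg]
          exact Set.mem_range_self x
        obtain ⟨y, hy⟩ := hx
        rw [Prod.mk.injEq] at hy
        rw [← hy.2, hy.1]
  · have := Cardinal.le_powerlt κ (c := 1) (b := κ) (Cardinal.one_lt_aleph0.trans_le hκ.aleph0_le)
    rwa [Cardinal.power_one] at this

/-! ### A first-order version of the game

The judge's moves are recorded as a sequence `f`, and `T` is a relation between such sequences and
the challenger's next moves. -/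

/-- `F` is a set of unbounded subsets of `k` which is a normal ultrafilter as far as the set `m`
is concerned. -/
def IsGoodIn {K : ZFSet.{u}} (k m F : K) : Prop :=
  (∀ X, E X F → E X m ∧ (∀ ν, E ν X → E ν k) ∧ ∀ δ, E δ k → ∃ ν, E ν X ∧ E δ ν) ∧
  (∀ X Y, E X m → E Y m → (∀ ν, E ν X → E ν k) → (∀ ν, E ν Y ↔ E ν k ∧ ¬ E ν X) →
    E X F ∨ E Y F) ∧
  (∀ X Y Z, E X F → E Y F → E Z m → (∀ ν, E ν Z ↔ E ν X ∧ E ν Y) → E Z F) ∧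
  ∀ s D, E s m → E D m → (∀ ξ, E ξ k → ∃ X, E X F ∧ ∀ Y, RelIn s ξ Y ↔ Y = X) →
    (∀ ν, E ν D ↔ E ν k ∧ ∀ ξ, E ξ ν → ∀ X, RelIn s ξ X → E ν X) → E D F

theorem FO.isGood {ι : Type*} (a b c : ι) : FO.{u} fun _ v => IsGoodIn (v a) (v b) (v c) := by
  unfold IsGoodIn
  refine .and ?_ (.and ?_ (.and ?_ ?_))
  · exact .all (.imp (.mem _ _) (.and (.mem _ _) (.and (.all (.imp (.mem _ _) (.mem _ _)))
      (.all (.imp (.mem _ _) (.ex (.and (.mem _ _) (.mem _ _))))))))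
  · exact .all (.all (.imp (.mem _ _) (.imp (.mem _ _) (.imp (.all (.imp (.mem _ _) (.mem _ _)))
      (.imp (.all (.iff (.mem _ _) (.and (.mem _ _) (.not (.mem _ _)))))
        (.or (.mem _ _) (.mem _ _)))))))
  · exact .all (.all (.all (.imp (.mem _ _) (.imp (.mem _ _) (.imp (.mem _ _)
      (.imp (.all (.iff (.mem _ _) (.and (.mem _ _) (.mem _ _)))) (.mem _ _)))))))
  · exact .all (.all (.imp (.mem _ _) (.imp (.mem _ _) (.imp (.all (.imp (.mem _ _)
      (.ex (.and (.mem _ _) (.all (.iff (.rel _ _ _) (.eq _ _))))))) (.imp (.all (.iff (.mem _ _)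
        (.and (.mem _ _) (.all (.imp (.mem _ _) (.all (.imp (.rel _ _ _) (.mem _ _))))))))
        (.mem _ _))))))

/-- `f'` is the restriction of the sequence `f` to `ξ`. -/
def IsRestrIn {K : ZFSet.{u}} (f' f ξ : K) : Prop :=
  ∀ p, E p f' ↔ E p f ∧ ∃ η Y, E η ξ ∧ IsOPairIn p η Y

theorem FO.isRestr {ι : Type*} (a b c : ι) : FO.{u} fun _ v => IsRestrIn (v a) (v b) (v c) := by
  unfold IsRestrIn
  exact .all (.iff (.mem _ _) (.and (.mem _ _) (.ex (.ex (.and (.mem _ _) (.opair _ _ _))))))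

/-- `f` is a sequence of length `b` of moves of the judge against `T`. -/
def IsRunIn {K : ZFSet.{u}} (T k b f : K) : Prop :=
  (∀ p, E p f → ∃ ξ F, E ξ b ∧ IsOPairIn p ξ F) ∧
  ∀ ξ, E ξ b → ∃ F, (∀ Y, RelIn f ξ Y ↔ Y = F) ∧ ∃ f' m, IsRestrIn f' f ξ ∧ RelIn T f' m ∧
    -- The restriction to `X` in `m` is needed because the answers of an arbitrary relation `T` need
    -- not increase.
    IsGoodIn k m F ∧ ∀ η, E η ξ → ∀ Y, RelIn f η Y → ∀ X, E X Y → E X m → E X F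

theorem FO.isRun {ι : Type*} (a b c d : ι) :
    FO.{u} fun _ v => IsRunIn (v a) (v b) (v c) (v d) := by
  unfold IsRunIn
  exact .and (.all (.imp (.mem _ _) (.ex (.ex (.and (.mem _ _) (.opair _ _ _))))))
    (.all (.imp (.mem _ _) (.ex (.and (.all (.iff (.rel _ _ _) (.eq _ _)))
      (.ex (.ex (.and (.isRestr _ _ _) (.and (.rel _ _ _) (.and (.isGood _ _ _)
        (.all (.imp (.mem _ _) (.all (.imp (.rel _ _ _) (.all (.imp (.mem _ _)
          (.imp (.mem _ _) (.mem _ _)))))))))))))))))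

/-- `T` provides a move of size at most `k` as long as the judge obeys the rules, and the judge
cannot obey the rules for `a` many stages. -/
def IsWinIn {K : ZFSet.{u}} (T k a : K) : Prop :=
  (∀ b f, E b a → IsRunIn T k b f → ∃ m, RelIn T f m ∧
    -- The enumeration `g` turns questions about elements of `m` into questions about subsets of
    -- `κ`.
    ∃ g, ∀ x, E x m → ∃ ξ, E ξ k ∧ ∀ y, RelIn g ξ y ↔ y = x) ∧
  ¬ ∃ f, IsRunIn T k a f

theorem FO.isWin {ι : Type*} (a b c : ι) : FO.{u} fun _ v => IsWinIn (v a) (v b) (v c) := by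
  unfold IsWinIn
  exact .and (.all (.all (.imp (.mem _ _) (.imp (.isRun _ _ _ _) (.ex (.and (.rel _ _ _)
    (.ex (.all (.imp (.mem _ _) (.ex (.and (.mem _ _) (.all (.iff (.rel _ _ _) (.eq _ _))))))))))))))
    (.not (.ex (.isRun _ _ _ _)))

section transitive

variable {H : ZFSet.{u}} {β : Ordinal.{u}} {F : Ordinal.{u} → ZFSet.{u}}

theorem isRestrIn_seqSet (hH : H.IsTransitive) {ξ : Ordinal.{u}} (hξ : ξ ≤ β) {f' f b : H}
    (hf : (f : ZFSet.{u}) = seqSet β F) (hb : (b : ZFSet.{u}) = ξ.toZFSet) :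
    IsRestrIn f' f b ↔ (f' : ZFSet.{u}) = seqSet ξ F := by
  have key : ∀ p : H, (E p f ∧ ∃ η Y, E η b ∧ IsOPairIn p η Y) ↔
      (p : ZFSet.{u}) ∈ seqSet ξ F := by
    intro p
    rw [E, hf]
    constructor
    · rintro ⟨hp, η, Y, hη, hpη⟩
      rw [isOPairIn_iff hH] at hpη
      rw [E, hb] at hη
      obtain ⟨o, ho, hoη⟩ := Ordinal.mem_toZFSet_iff.1 hη
      rw [hpη, ← hoη] at hp ⊢
      exact pair_mem_seqSet.2 ⟨ho, (pair_mem_seqSet.1 hp).2⟩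
    · intro hp
      obtain ⟨o, ho, hop⟩ := mem_seqSet.1 hp
      have hpf : (p : ZFSet.{u}) ∈ seqSet β F := mem_seqSet.2 ⟨o, ho.trans_le hξ, hop⟩
      have hpair := pair_mem_left_right hH f.2 (by rw [hf, hop]; exact hpf)
      exact ⟨hpf, ⟨_, hpair.1⟩, ⟨_, hpair.2⟩, by
        rw [E, hb]
        exact Ordinal.toZFSet_mem_toZFSet_iff.2 ho, (isOPairIn_iff hH).2 hop.symm⟩
  rw [IsRestrIn]
  simp only [key]
  constructor
  · intro h
    ext p
    constructor
    · exact fun hp => (h ⟨p, hH _ f'.2 hp⟩).1 hp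
    · intro hp
      obtain ⟨o, ho, hop⟩ := mem_seqSet.1 hp
      have hpf : p ∈ (f : ZFSet.{u}) := hf ▸ mem_seqSet.2 ⟨o, ho.trans_le hξ, hop⟩
      exact (h ⟨p, hH _ f.2 hpf⟩).2 hp
  · intro h p
    rw [E, h]

theorem IsRunIn.exists_seqSet (hH : H.IsTransitive) {T k b f : H} (h : IsRunIn T k b f)
    (hb : (b : ZFSet.{u}) = β.toZFSet) :
    ∃ F : Ordinal.{u} → ZFSet.{u}, (f : ZFSet.{u}) = seqSet β F := by
  have hβ : ∀ ξ < β, ξ.toZFSet ∈ (b : ZFSet.{u}) := fun ξ hξ =>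
    hb ▸ Ordinal.toZFSet_mem_toZFSet_iff.2 hξ
  have : ∀ ξ : Ordinal.{u}, ∃ F, ξ < β → ∀ Y, ZFSet.pair ξ.toZFSet Y ∈ (f : ZFSet.{u}) ↔ Y = F := by
    intro ξ
    by_cases hξ : ξ < β
    · obtain ⟨F, hF, -⟩ := h.2 ⟨_, hH _ b.2 (hβ ξ hξ)⟩ (hβ ξ hξ)
      refine ⟨F, fun _ Y => ⟨fun hY => ?_, ?_⟩⟩
      · have hYH := (pair_mem_left_right hH f.2 hY).2
        exact congrArg Subtype.val ((hF ⟨Y, hYH⟩).1 ((relIn_iff hH).2 hY))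
      · rintro rfl
        exact (relIn_iff hH).1 ((hF F).2 rfl)
    · exact ⟨∅, fun h => absurd h hξ⟩
  choose F hF using this
  refine ⟨F, ZFSet.ext fun p => ?_⟩
  rw [mem_seqSet]
  constructor
  · intro hp
    obtain ⟨ξ, Y, hξ, hpξ⟩ := h.1 ⟨p, hH _ f.2 hp⟩ hp
    rw [isOPairIn_iff hH] at hpξ
    rw [E, hb] at hξ
    obtain ⟨o, ho, hoξ⟩ := Ordinal.mem_toZFSet_iff.1 hξ
    change p = _ at hpξ
    rw [hpξ, ← hoξ] at hp ⊢
    exact ⟨o, ho, by rw [(hF o ho _).1 hp]⟩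
  · rintro ⟨ξ, hξ, rfl⟩
    exact (hF ξ hξ _).2 rfl

/-- Absoluteness: in a transitive structure the formula can be replaced by a statement about
ordinals and a sequence indexed by them. -/
theorem isRunIn_seqSet (hH : H.IsTransitive) {T k b f : H} (hb : (b : ZFSet.{u}) = β.toZFSet)
    (hf : (f : ZFSet.{u}) = seqSet β F) :
    IsRunIn T k b f ↔ ∀ ξ < β, ∃ Y f' m : H, (Y : ZFSet.{u}) = F ξ ∧
      (f' : ZFSet.{u}) = seqSet ξ F ∧ RelIn T f' m ∧ IsGoodIn k m Y ∧
        ∀ η < ξ, ∀ X ∈ F η, X ∈ (m : ZFSet.{u}) → X ∈ F ξ := by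
  have hβ : ∀ {ξ}, ξ < β → ξ.toZFSet ∈ (b : ZFSet.{u}) := fun hξ =>
    hb ▸ Ordinal.toZFSet_mem_toZFSet_iff.2 hξ
  have hpair : ∀ {ξ}, ξ < β → ZFSet.pair ξ.toZFSet (F ξ) ∈ (f : ZFSet.{u}) := fun hξ =>
    hf ▸ pair_mem_seqSet.2 ⟨hξ, rfl⟩
  have hrel : ∀ {ξ} (x y : H), ξ < β → (x : ZFSet.{u}) = ξ.toZFSet →
      (RelIn f x y ↔ (y : ZFSet.{u}) = F ξ) := fun x y hξ hx => by
    rw [relIn_iff hH, hf, hx, pair_mem_seqSet, and_iff_right hξ]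
  constructor
  · intro h ξ hξ
    obtain ⟨Y, hY, f', m, hf', hT, hgood, hmono⟩ := h.2 ⟨_, hH _ b.2 (hβ hξ)⟩ (hβ hξ)
    have hYF := (hrel _ Y hξ rfl).1 ((hY Y).2 rfl)
    refine ⟨Y, f', m, hYF, (isRestrIn_seqSet hH hξ.le hf rfl).1 hf', hT, hgood,
      fun η hη X hX hXm => ?_⟩
    have hηβ := hη.trans hξ
    have h₁ := hmono ⟨_, hH _ b.2 (hβ hηβ)⟩ (Ordinal.toZFSet_mem_toZFSet_iff.2 hη)
      ⟨F η, (pair_mem_left_right hH f.2 (hpair hηβ)).2⟩ ((hrel _ _ hηβ rfl).2 rfl)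
      ⟨X, hH _ m.2 hXm⟩ hX hXm
    rwa [E, hYF] at h₁
  · intro h
    refine ⟨fun p hp => ?_, fun x hx => ?_⟩
    · rw [E, hf] at hp
      obtain ⟨ξ, hξ, hξp⟩ := mem_seqSet.1 hp
      obtain ⟨h₁, h₂⟩ := pair_mem_left_right hH f.2 (hpair hξ)
      exact ⟨⟨_, h₁⟩, ⟨_, h₂⟩, hβ hξ, (isOPairIn_iff hH).2 hξp.symm⟩
    · rw [E, hb] at hx
      obtain ⟨ξ, hξ, hξx⟩ := Ordinal.mem_toZFSet_iff.1 hx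
      obtain ⟨Y, f', m, hYF, hf', hT, hgood, hmono⟩ := h ξ hξ
      refine ⟨Y, fun Z => ?_, f', m, (isRestrIn_seqSet hH hξ.le hf hξx.symm).2 hf', hT, hgood,
        fun η hη Z hZ X hX hXm => ?_⟩
      · rw [hrel x Z hξ hξx.symm, ← hYF, Subtype.ext_iff]
      · rw [E, ← hξx] at hη
        obtain ⟨o, ho, hoη⟩ := Ordinal.mem_toZFSet_iff.1 hη
        rw [hrel η Z (ho.trans hξ) hoη.symm] at hZ
        rw [E, hZ] at hX
        rw [E, hYF]
        exact hmono o ho X hX hXm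

end transitive

/-- Definition by recursion of a sequence from its initial segments. -/
def seqRec (G : Ordinal.{u} → ZFSet.{u} → ZFSet.{u}) : Ordinal.{u} → ZFSet.{u} :=
  WellFounded.fix (r := (· < ·)) wellFounded_lt fun β ih =>
    G β (ZFSet.range fun ξ : Set.Iio β => ZFSet.pair (ξ : Ordinal.{u}).toZFSet (ih ξ ξ.2))

theorem seqRec_eq (G : Ordinal.{u} → ZFSet.{u} → ZFSet.{u}) (β : Ordinal.{u}) :
    seqRec G β = G β (seqSet β (seqRec G)) := by
  rw [seqRec, WellFounded.fix_eq]
  rfl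

/-! ### The derived ultrafilter as a play of the judge -/

namespace IsRamseyEmbedding

variable {κ θ : Cardinal.{u}} {M N : ZFSet.{u}} {j : M ↪ₑ[setLanguage] N}

/-- The elements of a set `m ∈ M` of size at most `κ` which belong to the ultrafilter derived from
`j` form a set in `M`. -/
theorem exists_filter (W : IsRamseyEmbedding κ θ j) {m g : M}
    (hg : ∀ x, E x m → ∃ ξ, E ξ W.kM ∧ ∀ y, RelIn g ξ y ↔ y = x) :
    ∃ F : M, ∀ X, E X F ↔ E X m ∧ (∀ ν, E ν X → E ν W.kM) ∧ E W.kN (j X) := by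
  -- `S` collects the indices `ξ < κ` for which `κ` is in the value of `j(g)` at `ξ`. For an index
  -- of `X` in the enumeration this value is `j(X)`.
  obtain ⟨S, hSk, hS⟩ := W.exists_subset (ι := Bool)
    (P := fun K v z => ∀ y, RelIn (v false) z y → E (v true) y)
    (.all (.imp (.rel _ _ _) (.mem _ _))) (fun b => cond b W.kN (j g))
  simp only [cond_true, cond_false] at hS
  have hval : ∀ ξ X, E ξ W.kM → (∀ y, RelIn g ξ y ↔ y = X) → (E ξ S ↔ E W.kN (j X)) := by
    intro ξ X hξ hX
    have hFO : FO.{u} fun K (v : Fin 3 → K) => ∀ y, RelIn (v 0) (v 1) y ↔ y = v 2 :=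
      .all (.iff (.rel _ _ _) (.eq _ _))
    have h : ∀ y, RelIn (j g) (j ξ) y ↔ y = j X := (hFO.transfer j ![g, ξ, X]).1 hX
    simp only [hS ξ hξ, h, forall_eq]
  obtain ⟨F, hF⟩ := W.elem.exists_sep (ι := Fin 3) (P := fun K v X => (∀ ν, E ν X → E ν (v 0)) ∧
    ∃ ξ, E ξ (v 1) ∧ ∀ y, RelIn (v 2) ξ y ↔ y = X)
    (.and (.all (.imp (.mem _ _) (.mem _ _))) (.ex (.and (.mem _ _)
      (.all (.iff (.rel _ _ _) (.eq _ _)))))) ![W.kM, S, g] m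
  refine ⟨F, fun X => (hF X).trans (and_congr_right fun hX => and_congr_right fun _ => ?_)⟩
  constructor
  · rintro ⟨ξ, hξ, hξX⟩
    exact (hval ξ X (hSk ξ hξ) hξX).1 hξ
  · intro h
    obtain ⟨ξ, hξ, hξX⟩ := hg X hX
    exact ⟨ξ, (hval ξ X hξ hξX).2 h, hξX⟩

/-- Every clause is a property of the point `κ` in `N`. Thus `κ` itself witnesses in `j(X)` that `X`
is unbounded, and diagonal intersections work because `j(s)` has the value `j(Y)` at `ξ < κ` if `s`
has the value `Y` there. -/
theorem isGoodIn (W : IsRamseyEmbedding κ θ j) {m F : M}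
    (hF : ∀ X, E X F ↔ E X m ∧ (∀ ν, E ν X → E ν W.kM) ∧ E W.kN (j X)) :
    IsGoodIn W.kM m F := by
  refine ⟨fun X hX => ?_, fun X Y hX hY hXk hXY => ?_, fun X Y Z hX hY hZ hXYZ => ?_,
    fun s D hs hD hsF hsD => ?_⟩
  · obtain ⟨hXm, hXk, hXN⟩ := (hF X).1 hX
    refine ⟨hXm, hXk, fun δ hδ => ?_⟩
    have hFO : FO.{u} fun K (v : Bool → K) => ∃ ν, E ν (v true) ∧ E (v false) ν :=
      .ex (.and (.mem _ _) (.mem _ _))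
    exact (hFO.transfer j fun b => cond b X δ).2 ⟨W.kN, hXN, W.image_mem_kN hδ⟩
  · rw [hF, hF, and_iff_right hX, and_iff_right hXk, and_iff_right hY,
      and_iff_right fun ν hν => ((hXY ν).1 hν).1, W.kN_mem_image_iff (ι := Unit)
      (P := fun K v z => ¬ E z (v ())) (.not (.mem _ _)) (v := fun _ => X) hXY]
    exact em _
  · rw [hF] at hX hY ⊢
    refine ⟨hZ, fun ν hν => hX.2.1 ν ((hXYZ ν).1 hν).1, ?_⟩
    rw [W.kN_mem_image_iff (ι := Bool) (P := fun K v z => E z (v true) ∧ E z (v false))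
      (.and (.mem _ _) (.mem _ _)) (v := fun b => cond b X Y)]
    · exact ⟨hX.2.2, hY.2.2⟩
    · exact fun ν => (hXYZ ν).trans ⟨fun h => ⟨hX.2.1 ν h.1, h⟩, fun h => h.2⟩
  · rw [hF]
    refine ⟨hD, fun ν hν => ((hsD ν).1 hν).1, ?_⟩
    rw [W.kN_mem_image_iff (ι := Unit)
      (P := fun K v z => ∀ ξ, E ξ z → ∀ X, RelIn (v ()) ξ X → E z X)
      (.all (.imp (.mem _ _) (.all (.imp (.rel _ _ _) (.mem _ _))))) (v := fun _ => s) hsD]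
    intro ξ hξ X hX
    obtain ⟨ξ, hξ', rfl⟩ := W.exists_of_mem_kN hξ
    obtain ⟨Y, hY, hYs⟩ := hsF ξ hξ'
    have hFO : FO.{u} fun K (v : Fin 3 → K) => ∀ y, RelIn (v 0) (v 1) y ↔ y = v 2 :=
      .all (.iff (.rel _ _ _) (.eq _ _))
    have h : ∀ y, RelIn (j s) (j ξ) y ↔ y = j Y := (hFO.transfer j ![s, ξ, Y]).1 hYs
    rw [(h X).1 hX]
    exact ((hF Y).1 hY).2.2

/-- The ultrafilter derived from `j` defeats every strategy in `H(θ)`. -/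
theorem not_isWinIn (W : IsRamseyEmbedding κ θ j) {α : Cardinal.{u}} (hcl : ClosedUnderSeq α M)
    (hακ : α ≤ κ) {k a : hereditary θ} (hk : (k : ZFSet.{u}) = κ.ord.toZFSet)
    (ha : (a : ZFSet.{u}) = α.ord.toZFSet) : ¬ ∃ T : hereditary θ, IsWinIn T k a := by
  intro hwin
  have hlen : α.ord ≤ κ.ord := Cardinal.ord_le_ord.2 hακ
  let aM : M := ⟨α.ord.toZFSet, W.toZFSet_mem hlen⟩
  obtain rfl : k = W.elem.incl W.kM := Subtype.ext (hk.trans (W.elem.coe_incl W.kM).symm)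
  obtain rfl : a = W.elem.incl aM := Subtype.ext (ha.trans (W.elem.coe_incl aM).symm)
  -- `M` contains its own winning `T`, because the parameters `κ` and `α` are in `M`.
  obtain ⟨T, hT⟩ := ((FO.isWin (none : Option Bool) (some true) (some false)).ex
    (P := fun K (v : Bool → K) T => IsWinIn T (v true) (v false))
    |>.transfer W.elem.incl fun b => cond b W.kM aM).2 hwin
  have hTH : IsWinIn (W.elem.incl T) (W.elem.incl W.kM) (W.elem.incl aM) :=
    ((FO.isWin (0 : Fin 3) 1 2).transfer W.elem.incl ![T, W.kM, aM]).1 hT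
  simp only [cond_true, cond_false] at hT
  let Q : M → M → M → Prop := fun f F m => RelIn T f m ∧ IsGoodIn W.kM m F ∧
    ∀ X, E X F ↔ E X m ∧ (∀ ν, E ν X → E ν W.kM) ∧ E W.kN (j X)
  have hex : ∀ b f, E b aM → IsRunIn T W.kM b f → ∃ F m, Q f F m := by
    intro b f hb hf
    obtain ⟨m, hm, g, hg⟩ := hT.1 b f hb hf
    obtain ⟨F, hF⟩ := W.exists_filter hg
    exact ⟨F, m, hm, W.isGoodIn hF, hF⟩
  classical
  -- The filters are chosen outside of `M`, given the history `z`. The default value does not occur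
  -- below `α`, as `hmain` shows.
  let G : Ordinal.{u} → ZFSet.{u} → ZFSet.{u} := fun _ z =>
    if h : ∃ F m f : M, (f : ZFSet.{u}) = z ∧ Q f F m then h.choose else ∅
  let F := seqRec G
  have hrun : ∀ β, (∀ ξ < β, ∃ Y m f : M, (Y : ZFSet.{u}) = F ξ ∧ (f : ZFSet.{u}) = seqSet ξ F ∧
      Q f Y m) → ∀ b f : hereditary θ, (b : ZFSet.{u}) = β.toZFSet →
      (f : ZFSet.{u}) = seqSet β F → IsRunIn (W.elem.incl T) (W.elem.incl W.kM) b f := by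
    intro β h b f hb hf
    rw [isRunIn_seqSet (isTransitive_hereditary θ) hb hf]
    intro ξ hξ
    obtain ⟨Y, m, f', hY, hf', hTm, hgood, hYm⟩ := h ξ hξ
    refine ⟨W.elem.incl Y, W.elem.incl f', W.elem.incl m, by rwa [W.elem.coe_incl],
      by rwa [W.elem.coe_incl], ((FO.rel (0 : Fin 3) 1 2).transfer W.elem.incl ![T, f', m]).1 hTm,
      ((FO.isGood (0 : Fin 3) 1 2).transfer W.elem.incl ![W.kM, m, Y]).1 hgood, ?_⟩
    -- Both filters are traces of the one ultrafilter derived from `j`, so a set of the earlier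
    -- filter that belongs to the later move is kept.
    intro η hη X hX hXm
    obtain ⟨Y', m', -, hY', -, -, -, hYm'⟩ := h η (hη.trans hξ)
    have hFO : FO.{u} fun K (v : Fin 3 → K) => ∀ X, E X (v 0) → E X (v 1) → E X (v 2) :=
      .all (.imp (.mem _ _) (.imp (.mem _ _) (.mem _ _)))
    have h' : ∀ X, E X (W.elem.incl Y') → E X (W.elem.incl m) → E X (W.elem.incl Y) :=
      (hFO.transfer W.elem.incl ![Y', m, Y]).1 fun X hX hXm =>
        (hYm X).2 ⟨hXm, ((hYm' X).1 hX).2⟩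
    have := h' ⟨X, isTransitive_hereditary θ _ (W.elem.incl m).2 hXm⟩ (by
      rw [E, W.elem.coe_incl, hY']
      exact hX) hXm
    rwa [E, W.elem.coe_incl, hY] at this
  have hmain : ∀ β, β < α.ord → ∃ Y m f : M, (Y : ZFSet.{u}) = F β ∧
      (f : ZFSet.{u}) = seqSet β F ∧ Q f Y m := by
    intro β
    induction β using WellFoundedLT.induction with
    | _ β ih =>
    intro hβ
    have ih' := fun ξ hξ => ih ξ hξ (hξ.trans hβ)
    -- Closure under `<α`-sequences returns the history to `M`, where `T` must answer it by a move
    -- that `M` can enumerate.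
    have hfM : seqSet β F ∈ M := hcl β hβ _ (seqSet_mem_funs fun ξ hξ => by
      obtain ⟨Y, -, -, hY, -⟩ := ih' ξ hξ
      exact hY ▸ Y.2)
    let b : M := ⟨β.toZFSet, W.toZFSet_mem (hβ.le.trans hlen)⟩
    have hM : IsRunIn T W.kM b ⟨_, hfM⟩ :=
      ((FO.isRun (0 : Fin 4) 1 2 3).transfer W.elem.incl ![T, W.kM, b, ⟨_, hfM⟩]).2
        (hrun β ih' (W.elem.incl b) (W.elem.incl ⟨_, hfM⟩) (W.elem.coe_incl _) (W.elem.coe_incl _))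
    obtain ⟨Y, m, h⟩ := hex b _ (Ordinal.toZFSet_mem_toZFSet_iff.2 hβ) hM
    have h' : ∃ Y m f : M, (f : ZFSet.{u}) = seqSet β F ∧ Q f Y m := ⟨Y, m, _, rfl, h⟩
    obtain ⟨m, f, hf, hQ⟩ := h'.choose_spec
    refine ⟨h'.choose, m, f, ?_, hf, hQ⟩
    change _ = seqRec G β
    rw [seqRec_eq]
    have hG : G β (seqSet β F) = h'.choose := dif_pos h'
    exact hG.symm
  -- The run of full length may lie outside `M`; it suffices that it is in `H(θ)`, where `T` wins
  -- too.
  have hfH : seqSet α.ord F ∈ hereditary θ := by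
    refine seqSet_mem_hereditary W.reg (hlen.trans_lt (Cardinal.ord_lt_ord.2 W.lt)) fun ξ hξ => ?_
    obtain ⟨Y, -, -, hY, -⟩ := hmain ξ hξ
    exact hY ▸ W.elem.subset Y.2
  exact hTH.2 ⟨⟨_, hfH⟩, hrun α.ord hmain _ _ (W.elem.coe_incl _) rfl⟩

end IsRamseyEmbedding

/-! ### Normal ultrafilters on a single model, seen from outside -/

/-- `F` is a set of unbounded subsets of `κ` which is a normal ultrafilter as far as the set `m`
is concerned. -/
structure IsGood (κ : Cardinal.{u}) (m F : ZFSet.{u}) : Prop where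
  mem : ∀ X ∈ F, X ∈ m
  subset : ∀ X ∈ F, X ⊆ κ.ord.toZFSet
  unbounded : ∀ X ∈ F, ∀ δ ∈ κ.ord.toZFSet, ∃ ν ∈ X, δ ∈ ν
  compl : ∀ X ∈ m, X ⊆ κ.ord.toZFSet → κ.ord.toZFSet \ X ∈ m → X ∈ F ∨ κ.ord.toZFSet \ X ∈ F
  inter : ∀ X ∈ F, ∀ Y ∈ F, X ∩ Y ∈ m → X ∩ Y ∈ F
  diag : ∀ s ∈ m, s ∈ ZFSet.funs κ.ord.toZFSet F → diagInter κ s ∈ m → diagInter κ s ∈ F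

theorem IsGoodIn.isGood {κ : Cardinal.{u}} {H : ZFSet.{u}} (hH : H.IsTransitive) {k m F : H}
    (hk : (k : ZFSet.{u}) = κ.ord.toZFSet) (h : IsGoodIn k m F) : IsGood κ m F := by
  obtain ⟨h₁, h₂, h₃, h₄⟩ := h
  have hkH : ∀ {ν : ZFSet.{u}}, ν ∈ κ.ord.toZFSet → ν ∈ H := fun hν => hH _ k.2 (hk ▸ hν)
  refine ⟨fun X hX => (h₁ ⟨X, hH _ F.2 hX⟩ hX).1, fun X hX ν hν => ?_, fun X hX δ hδ => ?_,
    fun X hX hXk hY => ?_, fun X hX Y hY hXY => ?_, fun s hs hsF hD => ?_⟩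
  · have := (h₁ ⟨X, hH _ F.2 hX⟩ hX).2.1 ⟨ν, hH _ (hH _ F.2 hX) hν⟩ hν
    rwa [E, hk] at this
  · obtain ⟨ν, hν, hδν⟩ := (h₁ ⟨X, hH _ F.2 hX⟩ hX).2.2 ⟨δ, hkH hδ⟩ (by rwa [E, hk])
    exact ⟨ν, hν, hδν⟩
  · refine h₂ ⟨X, hH _ m.2 hX⟩ ⟨_, hH _ m.2 hY⟩ hX hY (fun ν hν => ?_) fun ν => ?_
    · rw [E, hk]
      exact hXk hν
    · rw [E, E, E, hk, ZFSet.mem_sdiff]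
  · exact h₃ ⟨X, hH _ F.2 hX⟩ ⟨Y, hH _ F.2 hY⟩ ⟨_, hH _ m.2 hXY⟩ hX hY hXY fun ν =>
      ZFSet.mem_inter
  · have hsH : s ∈ H := hH _ m.2 hs
    refine h₄ ⟨s, hsH⟩ ⟨_, hH _ m.2 hD⟩ hs hD (fun ξ hξ => ?_) fun ν => ?_
    · rw [E, hk] at hξ
      obtain ⟨hsub, hfun⟩ := ZFSet.mem_funs.1 hsF
      obtain ⟨X, hX, hu⟩ := hfun ξ hξ
      have hXF := (ZFSet.pair_mem_prod.1 (hsub hX)).2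
      refine ⟨⟨X, hH _ F.2 hXF⟩, hXF, fun Y => ?_⟩
      rw [relIn_iff hH, Subtype.ext_iff]
      exact ⟨fun h => hu Y h, fun h => h ▸ hX⟩
    · change (ν : ZFSet.{u}) ∈ diagInter κ s ↔ _
      rw [diagInter, ZFSet.mem_sep, E, hk]
      refine and_congr_right fun hν => ⟨fun h ξ hξ X hX => ?_, fun h ξ hξ X hX => ?_⟩
      · rw [relIn_iff hH] at hX
        exact h ξ hξ X hX
      · exact h ⟨ξ, hH _ ν.2 hξ⟩ hξ ⟨X, (pair_mem_left_right hH hsH hX).2⟩ ((relIn_iff hH).2 hX)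

/-- Otherwise `κ` is covered by fewer than `κ` many smaller ordinals. -/
theorem card_eq_of_unbounded {κ : Cardinal.{u}} (hκ : κ.IsRegular) {X : ZFSet.{u}}
    (hX : X ⊆ κ.ord.toZFSet) (h : ∀ δ ∈ κ.ord.toZFSet, ∃ ν ∈ X, δ ∈ ν) : X.card = κ := by
  have hle : X.card ≤ κ := (ZFSet.card_mono hX).trans (card_ord_toZFSet κ).le
  refine hle.antisymm (not_lt.1 fun hlt => ?_)
  have hU := card_iUnion_lt hκ (ι := Shrink.{u} X)
    (f := fun i => ((equivShrink X).symm i : ZFSet.{u})) hlt fun i => by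
      obtain ⟨o, ho, h⟩ := Ordinal.mem_toZFSet_iff.1 (hX (shrink_mem i))
      exact h ▸ card_toZFSet_lt ho
  refine (hU.trans_le (card_ord_toZFSet κ).symm.le).not_ge (ZFSet.card_mono fun δ hδ => ?_)
  obtain ⟨ν, hν, hδν⟩ := h δ hδ
  obtain ⟨i, rfl⟩ := exists_shrink hν
  exact ZFSet.mem_iUnion.2 ⟨i, hδν⟩

theorem IsSubmodel.inter_mem {κ θ : Cardinal.{u}} {m X Y : ZFSet.{u}} (hm : IsSubmodel κ θ m)
    (hX : X ∈ m) (hY : Y ∈ m) (hXk : X ⊆ κ.ord.toZFSet) : X ∩ Y ∈ m := by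
  have := hm.subsetOf_mem (ι := Bool) (P := fun K w z => E z (w true) ∧ E z (w false))
    (.and (.mem _ _) (.mem _ _))
    (v := fun b => cond b ⟨X, hm.elem.subset hX⟩ ⟨Y, hm.elem.subset hY⟩)
    (Bool.forall_bool.2 ⟨hY, hX⟩)
  convert this using 1
  ext z
  rw [ZFSet.mem_inter, mem_subsetOf]
  exact ⟨fun h => ⟨hXk h.1, h⟩, fun h => h.2⟩

theorem IsSubmodel.diagInter_mem {κ θ : Cardinal.{u}} {m s : ZFSet.{u}} (hm : IsSubmodel κ θ m)
    (hs : s ∈ m) : diagInter κ s ∈ m := by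
  have := hm.subsetOf_mem (ι := Unit)
    (P := fun K w z => ∀ ξ, E ξ z → ∀ X, RelIn (w ()) ξ X → E z X)
    (.all (.imp (.mem _ _) (.all (.imp (.rel _ _ _) (.mem _ _)))))
    (v := fun _ => ⟨s, hm.elem.subset hs⟩) fun _ => hs
  convert this using 1
  ext z
  have hH := isTransitive_hereditary θ
  rw [diagInter, ZFSet.mem_sep, mem_subsetOf]
  constructor
  · rintro ⟨hz, h⟩
    exact ⟨hz, fun ξ hξ X hX => h ξ hξ X ((relIn_iff hH).1 hX)⟩
  · rintro ⟨hz, h⟩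
    refine ⟨hz, fun ξ hξ X hX => ?_⟩
    obtain ⟨h₁, h₂⟩ := pair_mem_left_right hH (hm.elem.subset hs) hX
    exact h ⟨ξ, h₁⟩ hξ ⟨X, h₂⟩ ((relIn_iff hH).2 hX)

theorem IsSubmodel.app_mem {κ θ : Cardinal.{u}} {m s F ξ X : ZFSet.{u}} (hm : IsSubmodel κ θ m)
    (hs : s ∈ m) (hsF : s ∈ ZFSet.funs κ.ord.toZFSet F) (hξ : ξ ∈ κ.ord.toZFSet)
    (hX : ZFSet.pair ξ X ∈ s) : X ∈ m := by
  have hH := isTransitive_hereditary θ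
  obtain ⟨h₁, h₂⟩ := pair_mem_left_right hH (hm.elem.subset hs) hX
  obtain ⟨Z, -, hu⟩ := (ZFSet.mem_funs.1 hsF).2 ξ hξ
  refine hm.elem.mem_of_unique (ι := Bool) (P := fun K v y => RelIn (v true) (v false) y)
    (x := ⟨X, h₂⟩) (.rel _ _ _) (v := fun b => cond b ⟨s, hm.elem.subset hs⟩ ⟨ξ, h₁⟩)
    (Bool.forall_bool.2 ⟨hm.mem_of_mem hξ, hs⟩) ((relIn_iff hH).2 hX) fun y hy => ?_
  exact Subtype.ext ((hu y ((relIn_iff hH).1 hy)).trans (hu X hX).symm)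

section good

variable {κ θ : Cardinal.{u}} {m F : ZFSet.{u}}

theorem IsGood.isFilterOn (h : IsGood κ m F) (hκ : κ.IsRegular) (hm : IsSubmodel κ θ m) :
    IsFilterOn κ F := by
  refine ⟨fun X hX => ZFSet.mem_powerset.2 (h.subset X hX), fun s hs hsF => ?_⟩
  suffices hmem : ZFSet.sep (fun x => ∀ A ∈ s, x ∈ A) κ.ord.toZFSet ∈ F from
    card_eq_of_unbounded hκ (h.subset _ hmem) (h.unbounded _ hmem)
  induction s, hs using Set.Finite.induction_on with
  | empty =>
    have hk : κ.ord.toZFSet ∈ F := by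
      refine (h.compl _ (hm.toZFSet_mem le_rfl) (fun _ h => h)
        (hm.sdiff_mem (hm.toZFSet_mem le_rfl))).resolve_right fun hF => ?_
      obtain ⟨ν, hν, -⟩ := h.unbounded _ hF (0 : Ordinal.{u}).toZFSet
        (Ordinal.toZFSet_mem_toZFSet_iff.2 hκ.ord_pos)
      exact (ZFSet.mem_sdiff.1 hν).2 (ZFSet.mem_sdiff.1 hν).1
    convert hk using 1
    ext z
    simp
  | @insert A s _ _ ih =>
    have hA := hsF A (Set.mem_insert _ _)
    have hs := ih fun B hB => hsF B (Set.mem_insert_of_mem _ hB)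
    convert h.inter _ hA _ hs (hm.inter_mem (h.mem _ hA) (h.mem _ hs) (h.subset _ hA)) using 1
    ext z
    rw [ZFSet.mem_sep, ZFSet.mem_inter, ZFSet.mem_sep, Set.forall_mem_insert]
    exact ⟨fun hz => ⟨hz.2.1, hz.1, hz.2.2⟩, fun hz => ⟨hz.2.1, hz.1, hz.2.2⟩⟩

theorem IsGood.measures (h : IsGood κ m F) (hm : IsSubmodel κ θ m) :
    Measures κ F (κ.ord.toZFSet.powerset ∩ m) := fun A hA => by
  obtain ⟨hAk, hA⟩ := ZFSet.mem_inter.1 hA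
  exact h.compl A hA (ZFSet.mem_powerset.1 hAk) (hm.sdiff_mem hA)

end good

/-! ### The union of the filters of a run -/

section union

variable {κ θ : Cardinal.{u}} {M F : Ordinal.{u} → ZFSet.{u}} {γ : Ordinal.{u}}

theorem isFilterOn_seqUnion (hγ : 0 < γ) (hJ : ∀ ξ < γ, JudgeLegal κ M F ξ) :
    IsFilterOn κ (seqUnion γ F) := by
  refine ⟨fun X hX => ?_, fun s hs hsF => ?_⟩
  · obtain ⟨ξ, hξ, hX⟩ := mem_seqUnion.1 hX
    exact (hJ ξ hξ).isFilter.1 hX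
  · suffices h : ∃ β < γ, ∀ A ∈ s, A ∈ F β by
      obtain ⟨β, hβ, h⟩ := h
      exact (hJ β hβ).isFilter.2 s hs h
    have hmono : ∀ {ξ β}, ξ ≤ β → β < γ → F ξ ⊆ F β := fun hξ hβ => by
      rcases hξ.lt_or_eq with h | rfl
      · exact (hJ _ hβ).mono _ h
      · exact fun _ h => h
    induction s, hs using Set.Finite.induction_on with
    | empty => exact ⟨0, hγ, fun A hA => hA.elim⟩
    | @insert A s _ _ ih =>
      obtain ⟨β, hβ, hs⟩ := ih fun B hB => hsF B (Set.mem_insert_of_mem _ hB)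
      obtain ⟨ξ, hξ, hA⟩ := mem_seqUnion.1 (hsF A (Set.mem_insert _ _))
      refine ⟨max ξ β, max_lt hξ hβ, Set.forall_mem_insert.2 ⟨?_, fun B hB => ?_⟩⟩
      · exact hmono (le_max_left _ _) (max_lt hξ hβ) hA
      · exact hmono (le_max_right _ _) (max_lt hξ hβ) (hs B hB)

/-- Normality may be asked stage by stage. A sequence in the union lies in one `M β`, together with
its values. These are in `F β` already, since `F β` measures them and the union of the filters has
no disjoint elements. So normality at stage `β` applies. -/
theorem isNormalFor_seqUnion (hκ : κ ≠ 0) (hγ : 0 < γ)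
    (hJ : ∀ ξ < γ, JudgeLegal κ M F ξ) (hM : ∀ ξ < γ, IsSubmodel κ θ (M ξ))
    (hgood : ∀ ξ < γ, IsGood κ (M ξ) (F ξ)) :
    IsNormalFor κ (seqUnion γ M) (seqUnion γ F) := by
  have hF := isFilterOn_seqUnion hγ hJ
  refine ⟨hF, fun A hA => ?_, fun s hs hsF => ?_⟩
  · obtain ⟨hAk, hA⟩ := ZFSet.mem_inter.1 hA
    obtain ⟨ξ, hξ, hA⟩ := mem_seqUnion.1 hA
    exact ((hJ ξ hξ).measures A (ZFSet.mem_inter.2 ⟨hAk, hA⟩)).imp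
      (fun h => mem_seqUnion.2 ⟨ξ, hξ, h⟩) fun h => mem_seqUnion.2 ⟨ξ, hξ, h⟩
  · obtain ⟨β, hβ, hs⟩ := mem_seqUnion.1 hs
    refine mem_seqUnion.2 ⟨β, hβ, (hgood β hβ).diag s hs ?_ ((hM β hβ).diagInter_mem hs)⟩
    obtain ⟨hsub, hfun⟩ := ZFSet.mem_funs.1 hsF
    refine ZFSet.mem_funs.2 ⟨fun p hp => ?_, hfun⟩
    obtain ⟨ξ, hξ, X, hX, rfl⟩ := ZFSet.mem_prod.1 (hsub hp)
    refine ZFSet.pair_mem_prod.2 ⟨hξ, ?_⟩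
    refine ((hJ β hβ).measures X (ZFSet.mem_inter.2 ⟨hF.1 hX,
      (hM β hβ).app_mem hs hsF hξ hp⟩)).resolve_right fun hX' => ?_
    obtain ⟨ν, -, hν⟩ := hF.exists_mem hκ (s := {X, κ.ord.toZFSet \ X}) (by simp) (by
      rintro Y (rfl | rfl)
      · exact hX
      · exact mem_seqUnion.2 ⟨β, hβ, hX'⟩)
    exact (ZFSet.mem_sdiff.1 (hν _ (.inr rfl))).2 (hν _ (.inl rfl))

end union

/-! ### Winning strategies yield first-order winning strategies -/

/-- The models that are played by a strategy against a sequence of filters. -/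
def play (σ : Strategy.{u}) (F : Ordinal.{u} → ZFSet.{u}) : Ordinal.{u} → ZFSet.{u} :=
  seqRec fun β m => σ m (seqSet β F)

theorem followsAt_play (σ : Strategy.{u}) (F : Ordinal.{u} → ZFSet.{u}) (β : Ordinal.{u}) :
    FollowsAt σ (play σ F) F β :=
  seqRec_eq _ β

theorem play_congr (σ : Strategy.{u}) {F F' : Ordinal.{u} → ZFSet.{u}} {β : Ordinal.{u}}
    (h : ∀ ξ < β, F ξ = F' ξ) : play σ F β = play σ F' β := by
  induction β using WellFoundedLT.induction with
  | _ β ih =>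
  rw [followsAt_play σ F β, followsAt_play σ F' β, seqSet_congr h,
    seqSet_congr fun ξ hξ => ih ξ hξ fun η hη => h η (hη.trans hξ)]

/-- The set of the sequences of sets of subsets of `κ` of length less than `α`. -/
def histories (κ α : Cardinal.{u}) : ZFSet.{u} :=
  seqUnion α.ord fun β => ZFSet.funs β.toZFSet κ.ord.toZFSet.powerset.powerset

/-- A strategy as a set of ordered pairs. -/
def strategySet (κ α : Cardinal.{u}) (σ : Strategy.{u}) : ZFSet.{u} :=
  ZFSet.range fun f : histories κ α => ZFSet.pair f (play σ (seqValue f) (seqLength f))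

theorem pair_mem_strategySet {κ α : Cardinal.{u}} {σ : Strategy.{u}} {β : Ordinal.{u}}
    {F : Ordinal.{u} → ZFSet.{u}} {m : ZFSet.{u}} :
    ZFSet.pair (seqSet β F) m ∈ strategySet κ α σ ↔
      seqSet β F ∈ histories κ α ∧ m = play σ F β := by
  have h : play σ (seqValue (seqSet β F)) (seqLength (seqSet β F)) = play σ F β := by
    rw [seqLength_seqSet]
    exact play_congr σ fun ξ hξ => seqValue_seqSet F hξ
  rw [strategySet, ZFSet.mem_range]
  constructor
  · rintro ⟨f, hf⟩
    obtain ⟨h₁, h₂⟩ := ZFSet.pair_inj.1 hf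
    rw [h₁, h] at h₂
    exact ⟨h₁ ▸ f.2, h₂.symm⟩
  · rintro ⟨h₁, rfl⟩
    exact ⟨⟨_, h₁⟩, by rw [h]⟩

theorem ChallengerLegal.isSubmodel {κ θ : Cardinal.{u}} {M F : Ordinal.{u} → ZFSet.{u}}
    {β : Ordinal.{u}} (h : ChallengerLegal κ θ M F β) (hθ : θ.IsRegular) (hκθ : κ < θ) :
    IsSubmodel κ θ (M β) :=
  ⟨hθ, hκθ, h.elem, h.isModel.1.succ_subset⟩

theorem IsWinning.isWinIn {α κ θ θ' : Cardinal.{u}} {σ : Strategy.{u}}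
    (hσ : IsWinning κ θ α.ord σ) (hα : α.IsRegular) (hκ : κ.IsRegular)
    (hθ : θ.IsRegular) (hκθ : κ < θ) (hθ' : θ'.IsRegular) (hle : θ ≤ θ')
    {T k a : hereditary θ'} (hT : (T : ZFSet.{u}) = strategySet κ α σ)
    (hk : (k : ZFSet.{u}) = κ.ord.toZFSet) (ha : (a : ZFSet.{u}) = α.ord.toZFSet) :
    IsWinIn T k a := by
  have hH := isTransitive_hereditary θ'
  -- runs of the first-order game are runs of the filter game
  have hrun : ∀ β ≤ α.ord, ∀ b f : hereditary θ', (b : ZFSet.{u}) = β.toZFSet →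
      IsRunIn T k b f → ∃ F, (f : ZFSet.{u}) = seqSet β F ∧
        ∀ ξ < β, ChallengerLegal κ θ (play σ F) F ξ ∧ JudgeLegal κ (play σ F) F ξ ∧
          IsGood κ (play σ F ξ) (F ξ) := by
    intro β hβ b f hb hf
    obtain ⟨F, hF⟩ := hf.exists_seqSet hH hb
    rw [isRunIn_seqSet hH hb hF] at hf
    have hgood : ∀ ξ < β, IsGood κ (play σ F ξ) (F ξ) ∧
        ∀ η < ξ, ∀ X ∈ F η, X ∈ play σ F ξ → X ∈ F ξ := fun ξ hξ => by
      obtain ⟨Y, f', m, hY, hf', hTm, hg, hmono⟩ := hf ξ hξ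
      rw [relIn_iff hH, hT, hf', pair_mem_strategySet] at hTm
      rw [← hTm.2, ← hY]
      exact ⟨hg.isGood hH hk, hY ▸ hmono⟩
    refine ⟨F, hF, fun ξ => ?_⟩
    induction ξ using WellFoundedLT.induction with
    | _ ξ ih =>
    intro hξ
    have hC := (hσ (play σ F) F).1 ξ (hξ.trans_le hβ) (fun η _ => followsAt_play σ F η)
      fun η hη => (ih η hη (hη.trans hξ)).2.1
    obtain ⟨hg, hmono⟩ := hgood ξ hξ
    have hm := hC.isSubmodel hθ hκθ
    -- The legal moves of `σ` increase, so the restricted monotonicity of `IsRunIn` becomes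
    -- inclusion of the filters.
    exact ⟨hC, ⟨hg.isFilterOn hκ hm, hg.measures hm, fun η hη X hX => hmono η hη X hX
      (hC.mono η hη ((hgood η (hη.trans hξ)).1.mem X hX))⟩, hg⟩
  constructor
  · intro b f hb hf
    rw [E, ha] at hb
    obtain ⟨β, hβ, hβb⟩ := Ordinal.mem_toZFSet_iff.1 hb
    obtain ⟨F, hF, h⟩ := hrun β hβ.le b f hβb.symm hf
    have hC := (hσ (play σ F) F).1 β hβ (fun η _ => followsAt_play σ F η) fun η hη => (h η hη).2.1
    have hcard : (play σ F β).card = κ := hC.isModel.1.card_eq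
    have hsub : play σ F β ⊆ hereditary θ' := fun x hx =>
      hereditary_mono hle (hC.elem.subset hx)
    refine ⟨⟨play σ F β, mem_hereditary_of_subset hθ' hsub (by
      rw [hcard]
      exact hκθ.trans_le hle)⟩, ?_, ?_⟩
    · rw [relIn_iff hH, hT, hF, pair_mem_strategySet]
      exact ⟨mem_seqUnion.2 ⟨β, hβ, seqSet_mem_funs fun ξ hξ =>
        ZFSet.mem_powerset.2 (h ξ hξ).2.1.isFilter.1⟩, rfl⟩
    -- The model has size `κ`, and a bijection with `κ` supplies the enumeration demanded by
    -- `IsWinIn`.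
    · obtain ⟨e⟩ : Nonempty (κ.ord.ToType ≃ Shrink.{u} (play σ F β)) := by
        rw [← Cardinal.eq, Cardinal.mk_ord_toType]
        exact hcard.symm
      classical
      let g : Ordinal.{u} → ZFSet.{u} := fun ξ =>
        if h : ξ < κ.ord then (equivShrink (play σ F β)).symm (e (Ordinal.ToType.mk ⟨ξ, h⟩)) else ∅
      have hg : ∀ ξ (h : ξ < κ.ord),
          g ξ = (equivShrink (play σ F β)).symm (e (Ordinal.ToType.mk ⟨ξ, h⟩)) :=
        fun ξ h => dif_pos h
      refine ⟨⟨seqSet κ.ord g, seqSet_mem_hereditary hθ'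
        (Cardinal.ord_lt_ord.2 (hκθ.trans_le hle)) fun ξ hξ => ?_⟩, fun x hx => ?_⟩
      · rw [hg ξ hξ]
        exact hsub (shrink_mem _)
      · obtain ⟨i, hi⟩ := exists_shrink hx
        obtain ⟨ξ, hξ⟩ : ∃ ξ : Set.Iio κ.ord, e (Ordinal.ToType.mk ξ) = i :=
          ⟨Ordinal.ToType.mk.symm (e.symm i), by simp⟩
        have hξk : ξ.1.toZFSet ∈ (k : ZFSet.{u}) :=
          hk ▸ Ordinal.toZFSet_mem_toZFSet_iff.2 ξ.2
        refine ⟨⟨_, hH _ k.2 hξk⟩, hξk, fun y => ?_⟩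
        rw [relIn_iff hH, pair_mem_seqSet, and_iff_right (show ξ.1 < κ.ord from ξ.2),
          hg ξ.1 ξ.2, Subtype.coe_eta, hξ, hi, Subtype.ext_iff]
  · rintro ⟨f, hf⟩
    obtain ⟨F, -, h⟩ := hrun α.ord le_rfl a f ha hf
    exact (hσ (play σ F) F).2 (fun η _ => followsAt_play σ F η) (fun η hη => (h η hη).2.1)
      (isNormalFor_seqUnion hκ.ne_zero hα.ord_pos (fun η hη => (h η hη).2.1)
        (fun η hη => (h η hη).1.isSubmodel hθ hκθ) fun η hη => (h η hη).2.2)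

/-! ### The Ramsey property implies the filter property and `κ^{<κ} = κ` -/

theorem filterProperty_of_isRamsey {α κ θ : Cardinal.{u}} (hα : α.IsRegular) (hκ : κ.IsRegular)
    (hακ : α ≤ κ) (hθ : θ.IsRegular) (hκθ : κ < θ) (h : IsRamsey α κ) :
    FilterProperty κ θ α.ord := by
  rintro ⟨σ, hσ⟩
  obtain ⟨μ, hμ⟩ := exists_mem_hereditary (strategySet κ α σ)
  obtain ⟨θ', hθ', M, N, j, W, hcl⟩ := h.exists_embedding (max μ θ)
  have hle : θ ≤ θ' := (le_max_right _ _).trans hθ'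
  have hκθ' : κ.ord < θ'.ord := Cardinal.ord_lt_ord.2 (hκθ.trans_le hle)
  exact W.not_isWinIn hcl hακ (k := ⟨_, toZFSet_mem_hereditary hκθ'⟩)
    (a := ⟨_, toZFSet_mem_hereditary ((Cardinal.ord_le_ord.2 hακ).trans_lt hκθ')⟩) rfl rfl
    ⟨⟨_, hμ θ' ((le_max_left _ _).trans hθ')⟩,
      hσ.isWinIn hα hκ hθ hκθ W.reg hle rfl rfl rfl⟩

theorem powerlt_self_of_isRamsey {α κ : Cardinal.{u}} (hκ : κ.IsRegular) (h : IsRamsey α κ) :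
    Cardinal.powerlt κ κ = κ := by
  obtain ⟨_, -, _, _, _, W, -⟩ := h.exists_embedding 0
  exact powerlt_self_of_isStrongPrelimit hκ W.isStrongPrelimit

end FilterGames

end

theorem theorem5p6 (α κ : Cardinal.{u}) (hα : α.IsRegular) (hα₀ : Cardinal.aleph0 < α)
    (hκ : κ.IsRegular) (hακ : α ≤ κ) (θ : Cardinal.{u}) (hθ : θ.IsRegular) (hκθ : κ < θ) :
    FilterGames.IsRamsey α κ ↔
      Cardinal.powerlt κ κ = κ ∧ FilterGames.FilterProperty κ θ α.ord := by
  exact ⟨fun h => ⟨FilterGames.powerlt_self_of_isRamsey hκ h,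
      FilterGames.filterProperty_of_isRamsey hα hκ hακ hθ hκθ h⟩,
    fun h => FilterGames.isRamsey_of_filterProperty hα hα₀ hκ hακ hθ hκθ h.1 h.2⟩
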